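/- Setting. Let $G$ be a real finite-dimensional Lie group with unit $e$ and Lie algebra $\mathfrak g=T_eG$, equipped with a non-degenerate symmetric bilinear form $\gamma$ such that $\gamma([X,Y],Z)=\gamma(X,[Y,Z])$, and let $\mathfrak g=\mathfrak g_+\oplus\mathfrak g_-$ be a decomposition into $\gamma$-isotropic Lie subalgebras, with projections $\operatorname{pr}_\pm:\mathfrak g\to\mathfrak g_\pm$. Assume that $\gamma$ is $\operatorname{Ad}(G)$-invariant (this is automatic if $G$ is connected). For $X\in\mathfrak g$ and $a\in G$ write $aX$ and $Xa$ for the left and right translates of $X$ to $T_aG$, and similarly for tensors and for elements of $\mathfrak g^*$. Let $X_i$ be a basis of $\mathfrak g_+$ with $\gamma$-dual basis $Y_i$ of $\mathfrak g_-$, put $C=\sum_i (Y_i\otimes X_i-X_i\otimes Y_i)$ and $$\Lambda_\pm(a)=\tfrac12(aC\pm Ca)\in T_aG\otimes T_aG .$$ For a 1-form $\alpha$ let $\alpha^\sharp$ be the contraction of $\alpha$ with the first slot of $\Lambda_\pm$. The left and right dressing vector fields of $\Lambda_\pm$ belonging to $X\in\mathfrak g$ are $$\lambda_\pm(X)(a)=-(a\,\gamma(X,\cdot))^\sharp,\qquad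 \rho_\pm(X)(a)=(\gamma(X,\cdot)\,a)^\sharp ,$$ where $a\,\gamma(X,\cdot)$ and $\gamma(X,\cdot)\,a$ are the values at $a$ of the left and right invariant 1-forms with value $\gamma(X,\cdot)$ at $e$. Let $G_\pm\subset G$ be (immersed) Lie subgroups with Lie algebras $\mathfrak g_\pm$. The maps $(g,u)\mapsto gu$, $G_+\times G_-\to G$, and $(v,h)\mapsto vh$, $G_-\times G_+\to G$, are diffeomorphisms from open neighbourhoods of $(e,e)$ onto open neighbourhoods of $e$. For any choice of such neighbourhoods let $p^+_l(gu)=g$, $p^-_r(gu)=u$, $p^-_l(vh)=v$, $p^+_r(vh)=h$ be the resulting local projections, and for $a\in G$ and $b\in G$ near $e$ (depending on $a$) put $$\lambda^\pm_b(a)=p^\pm_r(ab^{-1}a^{-1})\,a,\qquad \rho^\pm_b(a)=a\,p^\pm_l(a^{-1}b^{-1}a).$$ For $B\in\mathfrak g$ let $\lambda^\pm_B(a),\rho^\pm_B(a)\in T_aG$ be the derivatives of $b\mapsto\lambda^\pm_b(a)$, $b\mapsto\rho^\pm_b(a)$ at $b=e$ in the direction $B$. Theorem 6.10. (1) For $B\in\mathfrak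 g$ and $a\in G$, $$\lambda^\pm_B(a)=-\operatorname{pr}_\pm(\operatorname{Ad}(a)B)\,a,\qquad \rho^\pm_B(a)=-a\,\operatorname{pr}_\pm(\operatorname{Ad}(a^{-1})B).$$ (2) These are smooth vector fields on $G$, and for $B,B'\in\mathfrak g$ $$[\lambda^\pm_B,\lambda^\pm_{B'}]=-\lambda^\pm_{[B,B']},\qquad [\rho^\pm_B,\rho^\pm_{B'}]=\rho^\pm_{[B,B']},\qquad [\lambda^+_B,\lambda^-_{B'}]=0,\qquad [\rho^+_B,\rho^-_{B'}]=0 .$$ (3) For $X\in\mathfrak g_+$ and $Y\in\mathfrak g_-$, $$\lambda_+(X)=\lambda^+_X,\quad \lambda_+(Y)=-\lambda^-_Y,\quad \rho_+(X)=-\rho^+_X,\quad \rho_+(Y)=\rho^-_Y,$$ $$\lambda_-(X)=\lambda^-_X,\quad \lambda_-(Y)=-\lambda^+_Y,\quad \rho_-(X)=\rho^-_X,\quad \rho_-(Y)=-\rho^+_Y .$$ (4) Let $G_+\times G_-^{\mathrm{op}}$ have the multiplication $(g,u)(g',u')=(gg',u'u)$. For $(g,u)$ near $(e,e)$, that is,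 for $((g,u),a)$ in an open neighbourhood of $\{(e,e)\}\times G$, $$(g,u).a=\lambda^+_g\lambda^-_{u^{-1}}(a)=p^-_r(auga^{-1})\,a\,g^{-1}$$ defines a smooth local left action of $G_+\times G_-^{\mathrm{op}}$ on $G$, whose infinitesimal generators are the left dressing vector fields of $\Lambda_+$: the generator of $(X,Y)\in\mathfrak g_+\times\mathfrak g_-$ is $\lambda_+(X+Y)$. Likewise $$(g,u).a=\lambda^-_g\lambda^+_{u^{-1}}(a)=p^-_r(ag^{-1}u^{-1}a^{-1})\,a\,u$$ defines a smooth local left action of $G_+\times G_-^{\mathrm{op}}$ on $G$, and the generator of $(X,Y)$ is $\lambda_-(X+Y)$. -/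

import Mathlib

open scoped Manifold ContDiff TensorProduct

noncomputable section

namespace DoubleGroup

/-- A smooth real Lie group is in particular of the smoothness class that Mathlib asks for when it
builds the Lie algebra `GroupLieAlgebra I G`. -/
instance leInftyMinSmoothness : ENat.LEInfty (minSmoothness ℝ 3) :=
  ⟨by
    rw [minSmoothness_of_isRCLikeNormedField]
    exact ENat.LEInfty.out⟩

section LieGroup

variable {E : Type*} [NormedAddCommGroup E] [NormedSpace ℝ E]
  {G : Type*} [TopologicalSpace G] [ChartedSpace E G] [Group G]

/-! ### Translations, adjoint representation, vector fields

All tangent spaces `TangentSpace 𝓘(ℝ, E) x` are, in Mathlib, copies of `E` that depend on the base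
point `x` only through the preferred chart at `x`. So vectors at the equal points `a * 1 * a⁻¹` and
`1`, or `a * 1` and `a`, are literally the same thing, and the definitions below use this. -/

/-- The left translate `aX ∈ T_a G` of `X ∈ 𝔤 = T_e G`, the derivative of `x ↦ a x` at `e`. -/
def leftTr (a : G) : GroupLieAlgebra 𝓘(ℝ, E) G →L[ℝ] TangentSpace 𝓘(ℝ, E) a :=
  (mfderiv 𝓘(ℝ, E) 𝓘(ℝ, E) (fun x : G => a * x) 1 : E →L[ℝ] E)

/-- The right translate `Xa ∈ T_a G` of `X ∈ 𝔤 = T_e G`, the derivative of `x ↦ x a` at `e`. -/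
def rightTr (a : G) : GroupLieAlgebra 𝓘(ℝ, E) G →L[ℝ] TangentSpace 𝓘(ℝ, E) a :=
  (mfderiv 𝓘(ℝ, E) 𝓘(ℝ, E) (fun x : G => x * a) 1 : E →L[ℝ] E)

/-- `T_a G → 𝔤`, `ξ ↦ a⁻¹ ξ`. -/
def leftTrInv (a : G) : TangentSpace 𝓘(ℝ, E) a →L[ℝ] GroupLieAlgebra 𝓘(ℝ, E) G :=
  (mfderiv 𝓘(ℝ, E) 𝓘(ℝ, E) (fun x : G => a⁻¹ * x) a : E →L[ℝ] E)

/-- `T_a G → 𝔤`, `ξ ↦ ξ a⁻¹`. -/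
def rightTrInv (a : G) : TangentSpace 𝓘(ℝ, E) a →L[ℝ] GroupLieAlgebra 𝓘(ℝ, E) G :=
  (mfderiv 𝓘(ℝ, E) 𝓘(ℝ, E) (fun x : G => x * a⁻¹) a : E →L[ℝ] E)

/-- The adjoint representation: `Ad a` is the derivative at `e` of `x ↦ a x a⁻¹`. -/
def Ad (a : G) : GroupLieAlgebra 𝓘(ℝ, E) G →L[ℝ] GroupLieAlgebra 𝓘(ℝ, E) G :=
  (mfderiv 𝓘(ℝ, E) 𝓘(ℝ, E) (fun x : G => a * x * a⁻¹) 1 : E →L[ℝ] E)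

/-- Smoothness of a vector field, as a section of the tangent bundle. -/
def SmoothField [LieGroup 𝓘(ℝ, E) ∞ G] (V : (a : G) → TangentSpace 𝓘(ℝ, E) a) : Prop :=
  ContMDiff 𝓘(ℝ, E) 𝓘(ℝ, E).tangent ∞
    (fun a => (⟨a, V a⟩ : TangentBundle 𝓘(ℝ, E) G))

/-- The derivative at a point `e` of a manifold `K`, in the direction `v ∈ T_e K`, of the orbit map
`k ↦ σ k a` of a (local) action `σ` of `K` on `G` with `σ e a = a`: the value at `a` of the
infinitesimal generator of `σ` that belongs to `v`. -/
def infGen {EK : Type*} [NormedAddCommGroup EK] [NormedSpace ℝ EK]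
    {HK : Type*} [TopologicalSpace HK] (IK : ModelWithCorners ℝ EK HK)
    {K : Type*} [TopologicalSpace K] [ChartedSpace HK K]
    (σ : K → G → G) (e : K) (v : TangentSpace IK e) (a : G) : TangentSpace 𝓘(ℝ, E) a :=
  (mfderiv IK 𝓘(ℝ, E) (fun k => σ k a) e : EK →L[ℝ] E) v

/-- The infinitesimal generator `σ_B` of a (local) action `σ` of `G` on `G`, for `B ∈ 𝔤`. -/
def gen (σ : G → G → G) (B : GroupLieAlgebra 𝓘(ℝ, E) G) (a : G) : TangentSpace 𝓘(ℝ, E) a :=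
  infGen 𝓘(ℝ, E) σ 1 B a

/-- `σ`, restricted to the open set `W ⊆ K × G`, is a smooth local left action on `G` of the manifold
`K` with the (local) group multiplication `mul` and the unit `e`. -/
structure IsLocalLeftAction {EK : Type*} [NormedAddCommGroup EK] [NormedSpace ℝ EK]
    {HK : Type*} [TopologicalSpace HK] (IK : ModelWithCorners ℝ EK HK)
    {K : Type*} [TopologicalSpace K] [ChartedSpace HK K]
    (mul : K → K → K) (e : K) (W : Set (K × G)) (σ : K → G → G) : Prop where
  isOpen : IsOpen W
  unit_mem : ∀ a : G, (e, a) ∈ W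
  smooth : ContMDiffOn (IK.prod 𝓘(ℝ, E)) 𝓘(ℝ, E) ∞ (fun p : K × G => σ p.1 p.2) W
  unit_act : ∀ a : G, σ e a = a
  mul_act : ∀ (k k' : K) (a : G), (k', a) ∈ W → (k, σ k' a) ∈ W → (mul k k', a) ∈ W →
    σ k (σ k' a) = σ (mul k k') a

/-! ### Tensors and dressing vector fields -/

/-- Contraction `ī_α Λ` of a 2-tensor `Λ ∈ V ⊗ V` with a linear form in the first slot. -/
def sharp {V : Type*} [AddCommGroup V] [Module ℝ V] (Λ : V ⊗[ℝ] V) (α : Module.Dual ℝ V) : V :=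
  TensorProduct.lid ℝ V (LinearMap.rTensor V α Λ)

/-- The left dressing vector field `a ↦ -(aα)^♯` of a field `Λ` of 2-tensors; here `aα` is the left
invariant 1-form with value `α ∈ 𝔤*` at `e`. -/
def leftDressing (Λ : (a : G) → TangentSpace 𝓘(ℝ, E) a ⊗[ℝ] TangentSpace 𝓘(ℝ, E) a)
    (α : Module.Dual ℝ (GroupLieAlgebra 𝓘(ℝ, E) G)) (a : G) : TangentSpace 𝓘(ℝ, E) a :=
  -sharp (Λ a) (α ∘ₗ (leftTrInv a).toLinearMap)

/-- The right dressing vector field `a ↦ (αa)^♯` of a field `Λ` of 2-tensors; here `αa` is the right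
invariant 1-form with value `α ∈ 𝔤*` at `e`. -/
def rightDressing (Λ : (a : G) → TangentSpace 𝓘(ℝ, E) a ⊗[ℝ] TangentSpace 𝓘(ℝ, E) a)
    (α : Module.Dual ℝ (GroupLieAlgebra 𝓘(ℝ, E) G)) (a : G) : TangentSpace 𝓘(ℝ, E) a :=
  sharp (Λ a) (α ∘ₗ (rightTrInv a).toLinearMap)

/-- The bivector `C = ∑ Yᵢ ∧ Xᵢ`, with the convention `Y ∧ X = Y ⊗ X - X ⊗ Y`. -/
def bivector {V : Type*} [AddCommGroup V] [Module ℝ V] {ι : Type*} [Fintype ι] (X Y : ι → V) :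
    V ⊗[ℝ] V :=
  ∑ i, (Y i ⊗ₜ[ℝ] X i - X i ⊗ₜ[ℝ] Y i)

/-- The left translate `aC` of a 2-tensor `C ∈ 𝔤 ⊗ 𝔤`. -/
def leftTr₂ (a : G) (C : GroupLieAlgebra 𝓘(ℝ, E) G ⊗[ℝ] GroupLieAlgebra 𝓘(ℝ, E) G) :
    TangentSpace 𝓘(ℝ, E) a ⊗[ℝ] TangentSpace 𝓘(ℝ, E) a :=
  TensorProduct.map (leftTr a).toLinearMap (leftTr a).toLinearMap C

/-- The right translate `Ca` of a 2-tensor `C ∈ 𝔤 ⊗ 𝔤`. -/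
def rightTr₂ (a : G) (C : GroupLieAlgebra 𝓘(ℝ, E) G ⊗[ℝ] GroupLieAlgebra 𝓘(ℝ, E) G) :
    TangentSpace 𝓘(ℝ, E) a ⊗[ℝ] TangentSpace 𝓘(ℝ, E) a :=
  TensorProduct.map (rightTr a).toLinearMap (rightTr a).toLinearMap C

/-- The tensor field `Λ₊(a) = ½ (aC + Ca)`. -/
def LambdaPlus (C : GroupLieAlgebra 𝓘(ℝ, E) G ⊗[ℝ] GroupLieAlgebra 𝓘(ℝ, E) G) (a : G) :
    TangentSpace 𝓘(ℝ, E) a ⊗[ℝ] TangentSpace 𝓘(ℝ, E) a :=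
  (1 / 2 : ℝ) • (leftTr₂ a C + rightTr₂ a C)

/-- The tensor field `Λ₋(a) = ½ (aC - Ca)`. -/
def LambdaMinus (C : GroupLieAlgebra 𝓘(ℝ, E) G ⊗[ℝ] GroupLieAlgebra 𝓘(ℝ, E) G) (a : G) :
    TangentSpace 𝓘(ℝ, E) a ⊗[ℝ] TangentSpace 𝓘(ℝ, E) a :=
  (1 / 2 : ℝ) • (leftTr₂ a C - rightTr₂ a C)

end LieGroup

/-! ### Manin decompositions -/

section Manin

variable {L : Type*} [LieRing L] [LieAlgebra ℝ L]

/-- `γ` is an inner product (symmetric, non-degenerate, of any signature) on the Lie algebra `L`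
that is `ad`-invariant, and `L = gp ⊕ gm` with `γ`-isotropic Lie subalgebras `gp` and `gm`. -/
structure IsManinDecomposition (γ : LinearMap.BilinForm ℝ L) (gp gm : LieSubalgebra ℝ L) :
    Prop where
  symm : ∀ x y : L, γ x y = γ y x
  nondegenerate : ∀ x : L, (∀ y : L, γ x y = 0) → x = 0
  invariant : ∀ x y z : L, γ ⁅x, y⁆ z = γ x ⁅y, z⁆
  isCompl : IsCompl gp.toSubmodule gm.toSubmodule
  isotropic_plus : ∀ x ∈ gp, ∀ y ∈ gp, γ x y = 0
  isotropic_minus : ∀ x ∈ gm, ∀ y ∈ gm, γ x y = 0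

variable {γ : LinearMap.BilinForm ℝ L} {gp gm : LieSubalgebra ℝ L}

/-- The projection of `L = gp ⊕ gm` onto `gp`. -/
def IsManinDecomposition.prPlus (h : IsManinDecomposition γ gp gm) : L →ₗ[ℝ] L :=
  gp.toSubmodule.projection gm.toSubmodule h.isCompl

/-- The projection of `L = gp ⊕ gm` onto `gm`. -/
def IsManinDecomposition.prMinus (h : IsManinDecomposition γ gp gm) : L →ₗ[ℝ] L :=
  gm.toSubmodule.projection gp.toSubmodule h.isCompl.symm

end Manin

/-! ### Lie subgroups and local factorizations -/

section Subgroups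

variable {E : Type*} [NormedAddCommGroup E] [NormedSpace ℝ E]
  {G : Type*} [TopologicalSpace G] [ChartedSpace E G] [Group G]
  {E₁ : Type*} [NormedAddCommGroup E₁] [NormedSpace ℝ E₁]
  {K₁ : Type*} [TopologicalSpace K₁] [ChartedSpace E₁ K₁] [Group K₁]
  {E₂ : Type*} [NormedAddCommGroup E₂] [NormedSpace ℝ E₂]
  {K₂ : Type*} [TopologicalSpace K₂] [ChartedSpace E₂ K₂] [Group K₂]

/-- The tangent map at the unit of a homomorphism of Lie groups. -/
def lieMap (j : K₁ →* G) : GroupLieAlgebra 𝓘(ℝ, E₁) K₁ →L[ℝ] GroupLieAlgebra 𝓘(ℝ, E) G :=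
  (mfderiv 𝓘(ℝ, E₁) 𝓘(ℝ, E) (fun k : K₁ => j k) 1 : E₁ →L[ℝ] E)

/-- `j` exhibits the Lie group `K₁` as a (not necessarily closed, not necessarily connected) Lie
subgroup of `G` with Lie algebra `h`: it is an injective smooth homomorphism and an immersion, and
its tangent map at the unit has image `h`. -/
structure IsLieSubgroup [FiniteDimensional ℝ E] [LieGroup 𝓘(ℝ, E) ∞ G] (j : K₁ →* G)
    (h : LieSubalgebra ℝ (GroupLieAlgebra 𝓘(ℝ, E) G)) : Prop where
  smooth : ContMDiff 𝓘(ℝ, E₁) 𝓘(ℝ, E) ∞ (fun k : K₁ => j k)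
  injective : Function.Injective j
  immersion : Function.Injective (lieMap (E := E) (E₁ := E₁) j)
  range_eq : Set.range (lieMap (E := E) (E₁ := E₁) j) = (h : Set (GroupLieAlgebra 𝓘(ℝ, E) G))

/-- `Φ` is a diffeomorphism from an open neighbourhood of `(e, e)` in `K₁ × K₂` onto an open subset
of `G`, and is given by multiplication, `Φ (k, l) = k l`, on this neighbourhood. -/
structure IsLocalFactorization (j₁ : K₁ →* G) (j₂ : K₂ →* G)
    (Φ : OpenPartialHomeomorph (K₁ × K₂) G) : Prop where
  unit_mem : ((1 : K₁), (1 : K₂)) ∈ Φ.source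
  eq_mul : ∀ k ∈ Φ.source, Φ k = j₁ k.1 * j₂ k.2
  smooth : ContMDiffOn (𝓘(ℝ, E₁).prod 𝓘(ℝ, E₂)) 𝓘(ℝ, E) ∞ Φ Φ.source
  smooth_symm : ContMDiffOn 𝓘(ℝ, E) (𝓘(ℝ, E₁).prod 𝓘(ℝ, E₂)) ∞ Φ.symm Φ.target

/-- The projection `k l ↦ k`, defined on `Φ.target`, with values in the subgroup, seen in `G`. -/
def leftFactor (j₁ : K₁ →* G) (Φ : OpenPartialHomeomorph (K₁ × K₂) G) (x : G) : G :=
  j₁ (Φ.symm x).1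

/-- The projection `k l ↦ l`, defined on `Φ.target`, with values in the subgroup, seen in `G`. -/
def rightFactor (j₂ : K₂ →* G) (Φ : OpenPartialHomeomorph (K₁ × K₂) G) (x : G) : G :=
  j₂ (Φ.symm x).2

end Subgroups

/-- `(b, a) ↦ p(a b⁻¹ a⁻¹) a` for a locally defined map `p : G → G`. -/
def leftMove {G : Type*} [Group G] (p : G → G) (b a : G) : G := p (a * b⁻¹ * a⁻¹) * a

/-- `(b, a) ↦ a p(a⁻¹ b⁻¹ a)` for a locally defined map `p : G → G`. -/
def rightMove {G : Type*} [Group G] (p : G → G) (b a : G) : G := a * p (a⁻¹ * b⁻¹ * a)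

section Families

variable {G : Type*} [TopologicalSpace G] [Group G]
  {Gp : Type*} [TopologicalSpace Gp] [Group Gp] {Gm : Type*} [TopologicalSpace Gm] [Group Gm]

/-! The four local families, for local inverses `Φ` of `(g, u) ↦ g u` on `G₊ × G₋` and `Ψ` of
`(v, h) ↦ v h` on `G₋ × G₊`. -/

/-- `λ⁺_b(a) = p⁺_r(a b⁻¹ a⁻¹) a`, where `p⁺_r(v h) = h`. -/
def lamPlus (jp : Gp →* G) (Ψ : OpenPartialHomeomorph (Gm × Gp) G) : G → G → G :=
  leftMove (rightFactor jp Ψ)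

/-- `λ⁻_b(a) = p⁻_r(a b⁻¹ a⁻¹) a`, where `p⁻_r(g u) = u`. -/
def lamMinus (jm : Gm →* G) (Φ : OpenPartialHomeomorph (Gp × Gm) G) : G → G → G :=
  leftMove (rightFactor jm Φ)

/-- `ρ⁺_b(a) = a p⁺_l(a⁻¹ b⁻¹ a)`, where `p⁺_l(g u) = g`. -/
def rhoPlus (jp : Gp →* G) (Φ : OpenPartialHomeomorph (Gp × Gm) G) : G → G → G :=
  rightMove (leftFactor jp Φ)

/-- `ρ⁻_b(a) = a p⁻_l(a⁻¹ b⁻¹ a)`, where `p⁻_l(v h) = v`. -/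
def rhoMinus (jm : Gm →* G) (Ψ : OpenPartialHomeomorph (Gm × Gp) G) : G → G → G :=
  rightMove (leftFactor jm Ψ)

/-- The multiplication of the group `G₊ × G₋ᵒᵖ`: `(g, u) (g', u') = (g g', u' u)`. -/
def mulOp (k k' : Gp × Gm) : Gp × Gm := (k.1 * k'.1, k'.2 * k.2)

/-- `(g, u).a = λ⁺_g(λ⁻_{u⁻¹}(a))`. -/
def dressPlus (jp : Gp →* G) (jm : Gm →* G) (Φ : OpenPartialHomeomorph (Gp × Gm) G)
    (Ψ : OpenPartialHomeomorph (Gm × Gp) G) (k : Gp × Gm) (a : G) : G :=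
  lamPlus jp Ψ (jp k.1) (lamMinus jm Φ (jm k.2)⁻¹ a)

/-- `(g, u).a = λ⁻_g(λ⁺_{u⁻¹}(a))`. -/
def dressMinus (jp : Gp →* G) (jm : Gm →* G) (Φ : OpenPartialHomeomorph (Gp × Gm) G)
    (Ψ : OpenPartialHomeomorph (Gm × Gp) G) (k : Gp × Gm) (a : G) : G :=
  lamMinus jm Φ (jp k.1) (lamPlus jp Ψ (jm k.2)⁻¹ a)

end Families

end DoubleGroup

end

open DoubleGroup

/-! Everything follows from the derivative of the local projections at the unit. The multiplication
`G₊ × G₋ → G` has at `(e, e)` the derivative `(ξ, η) ↦ ξ + η`, an isomorphism because `𝔤 = 𝔤₊ ⊕ 𝔤₋`.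
So local factorizations exist (`exists_isLocalFactorization`), and their two factors have the
derivatives `pr_±` at `e` (`hasD_factors`). The chain rule then gives the generators.

For the brackets, all fields are written through left translation, as `a f(a)` with `f : G → 𝔤`: one
has `f(a) = -Ad(a⁻¹) p(Ad(a)B)` for `λ` and `f(a) = -p(Ad(a⁻¹)B)` for `ρ`. The bracket of `a f(a)`
and `a g(a)` is `a` applied to `dg(a f) - df(a g) + [f, g]` (`mlieBracket_leftTr`), and the
derivative of `Ad` is the bracket (`hasD_AdL_one_apply`). What remains are two identities for the
projections `p`, `q` of a Lie algebra that is the sum of two subalgebras (`projection_bracket_self`,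
`projection_bracket_compl`).

For the dressing fields, contracting `C` with `γ(V, ·)` gives `pr₊V - pr₋V`, by isotropy and duality
of the bases. `Ad`-invariance of `γ` turns left invariant 1-forms into right invariant ones, so for
`V` in `𝔤₊` or `𝔤₋` the half sum or half difference in `Λ_±` leaves a single projection of `Ad(a)V`
or `Ad(a⁻¹)V`. On a connected group, `Ad`-invariance follows from `ad`-invariance, since `γ(Ad(x)V,
Ad(x)W)` has zero derivative in `x`.

For the local actions, both composites have the form `a ↦ s a c(k)`, where `r s = a m(k) a⁻¹` with
`r ∈ G₊`, `s ∈ G₋`. Multiplying the factorizations for two successive steps gives a factorization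
for the product, and uniqueness of factors near `(e, e)` is the action law
(`exists_isLocalLeftAction`). -/

namespace DoubleGroup

open VectorField

/-! ### Derivatives on manifolds, read in the model spaces. -/

section HasD

variable {E : Type*} [NormedAddCommGroup E] [NormedSpace ℝ E] {H : Type*} [TopologicalSpace H]
  {I : ModelWithCorners ℝ E H} {M : Type*} [TopologicalSpace M] [ChartedSpace H M]
  {E' : Type*} [NormedAddCommGroup E'] [NormedSpace ℝ E'] {H' : Type*} [TopologicalSpace H']
  {I' : ModelWithCorners ℝ E' H'} {M' : Type*} [TopologicalSpace M'] [ChartedSpace H' M']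
  {E'' : Type*} [NormedAddCommGroup E''] [NormedSpace ℝ E''] {H'' : Type*} [TopologicalSpace H'']
  {I'' : ModelWithCorners ℝ E'' H''} {M'' : Type*} [TopologicalSpace M''] [ChartedSpace H'' M'']

variable (I I') in
/-- `HasMFDerivAt` with the derivative seen as a map between the model vector spaces, so that it
can be transported along equalities of points. -/
def HasD (f : M → M') (x : M) (f' : E →L[ℝ] E') : Prop :=
  HasMFDerivAt I I' f x f'

/-- The intermediate point is allowed to be only propositionally equal to `f x`; this is what makes
composition usable at points such as `a * 1` and `a * 1 * a⁻¹`. -/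
lemma HasD.comp {g : M' → M''} {f : M → M'} {x : M} {y : M'} {g' : E' →L[ℝ] E''}
    {f' : E →L[ℝ] E'} (hg : HasD I' I'' g y g') (hf : HasD I I' f x f') (h : f x = y) :
    HasD I I'' (fun z => g (f z)) x (g'.comp f') := by
  subst h
  exact HasMFDerivAt.comp x hg hf

lemma HasD.prodMk {f : M → M'} {g : M → M''} {x : M} {f' : E →L[ℝ] E'} {g' : E →L[ℝ] E''}
    (hf : HasD I I' f x f') (hg : HasD I I'' g x g') :
    HasD I (I'.prod I'') (fun z => (f z, g z)) x (f'.prod g') :=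
  HasMFDerivAt.prodMk hf hg

lemma HasD.mfderiv {f : M → M'} {x : M} {f' : E →L[ℝ] E'} (h : HasD I I' f x f') :
    (mfderiv I I' f x : E →L[ℝ] E') = f' := HasMFDerivAt.mfderiv h

lemma HasD.unique {f : M → M'} {x : M} {f' f'' : E →L[ℝ] E'} (h : HasD I I' f x f')
    (h' : HasD I I' f x f'') : f' = f'' := hasMFDerivAt_unique h h'

lemma HasD.congr {f g : M → M'} {x : M} {f' : E →L[ℝ] E'} (h : HasD I I' f x f')
    (h' : g =ᶠ[nhds x] f) : HasD I I' g x f' := HasMFDerivAt.congr_of_eventuallyEq h h'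

lemma _root_.ContMDiffAt.hasD {f : M → M'} {x : M} (h : ContMDiffAt I I' ∞ f x) :
    HasD I I' f x (mfderiv I I' f x : E →L[ℝ] E') :=
  (h.mdifferentiableAt (by simp)).hasMFDerivAt

lemma hasD_id (x : M) : HasD I I (fun z => z) x (ContinuousLinearMap.id ℝ E) :=
  hasMFDerivAt_id x

lemma hasD_const (c : M') (x : M) : HasD I I' (fun _ => c) x (0 : E →L[ℝ] E') :=
  hasMFDerivAt_const c x

lemma hasD_fst (x : M × M') : HasD (I.prod I') I (fun z : M × M' => z.1) x
    (ContinuousLinearMap.fst ℝ E E') := hasMFDerivAt_fst x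

lemma hasD_snd (x : M × M') : HasD (I.prod I') I' (fun z : M × M' => z.2) x
    (ContinuousLinearMap.snd ℝ E E') := hasMFDerivAt_snd x

lemma hasD_clm (L : E →L[ℝ] E') (x : E) : HasD 𝓘(ℝ, E) 𝓘(ℝ, E') (fun z => L z) x L :=
  L.hasFDerivAt.hasMFDerivAt

lemma HasD.mvfderiv_clm {g : M → E'} {a : M} {Dg : E →L[ℝ] E'} (hg : HasD I 𝓘(ℝ, E') g a Dg)
    (L : E' →L[ℝ] ℝ) (v : E) : mvfderiv I (fun x => L (g x)) a v = L (Dg v) :=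
  DFunLike.congr_fun ((hasD_clm L _).comp hg rfl).mfderiv v

/-- A map of two variables whose restrictions to the two axes through `p` have known derivatives. -/
lemma _root_.ContMDiffAt.hasD_prod {f : M × M' → M''} {p : M × M'}
    (h : ContMDiffAt (I.prod I') I'' ∞ f p) {f₁ : E →L[ℝ] E''} {f₂ : E' →L[ℝ] E''}
    (h₁ : HasD I I'' (fun z => f (z, p.2)) p.1 f₁) (h₂ : HasD I' I'' (fun z => f (p.1, z)) p.2 f₂) :
    HasD (I.prod I') I'' f p (f₁.coprod f₂) := by
  have key : f₁.coprod f₂ = (mfderiv (I.prod I') I'' f p : E × E' →L[ℝ] E'') := by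
    refine ContinuousLinearMap.ext fun v => ?_
    refine Eq.trans ?_ (mfderiv_prod_eq_add_apply (I := I) (I' := I') (I'' := I'') (f := f) (p := p)
      (v := v) (h.mdifferentiableAt (by simp))).symm
    rw [ContinuousLinearMap.coprod_apply, ← h₁.mfderiv, ← h₂.mfderiv]
    rfl
  rw [key]
  exact h.hasD

end HasD

/-! ### Translations and the adjoint representation. -/

section Group

variable {E : Type*} [NormedAddCommGroup E] [NormedSpace ℝ E]
  {G : Type*} [TopologicalSpace G] [ChartedSpace E G] [Group G] [LieGroup 𝓘(ℝ, E) ∞ G]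
  {EM : Type*} [NormedAddCommGroup EM] [NormedSpace ℝ EM] {HM : Type*} [TopologicalSpace HM]
  {IM : ModelWithCorners ℝ EM HM} {M : Type*} [TopologicalSpace M] [ChartedSpace HM M]

lemma hasD_leftTr (a : G) : HasD 𝓘(ℝ, E) 𝓘(ℝ, E) (fun x : G => a * x) 1 (leftTr a) :=
  (contMDiff_mul_left (I := 𝓘(ℝ, E)) (n := ∞)).contMDiffAt.hasD

lemma hasD_rightTr (a : G) : HasD 𝓘(ℝ, E) 𝓘(ℝ, E) (fun x : G => x * a) 1 (rightTr a) :=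
  (contMDiff_mul_right (I := 𝓘(ℝ, E)) (n := ∞)).contMDiffAt.hasD

lemma hasD_leftTrInv (a : G) : HasD 𝓘(ℝ, E) 𝓘(ℝ, E) (fun x : G => a⁻¹ * x) a (leftTrInv a) :=
  (contMDiff_mul_left (I := 𝓘(ℝ, E)) (n := ∞)).contMDiffAt.hasD

lemma hasD_rightTrInv (a : G) : HasD 𝓘(ℝ, E) 𝓘(ℝ, E) (fun x : G => x * a⁻¹) a (rightTrInv a) :=
  (contMDiff_mul_right (I := 𝓘(ℝ, E)) (n := ∞)).contMDiffAt.hasD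

lemma contMDiff_conj (a : G) : ContMDiff 𝓘(ℝ, E) 𝓘(ℝ, E) ∞ (fun x : G => a * x * a⁻¹) :=
  contMDiff_mul_right.comp contMDiff_mul_left

lemma hasD_Ad (a : G) : HasD 𝓘(ℝ, E) 𝓘(ℝ, E) (fun x : G => a * x * a⁻¹) 1 (Ad a) :=
  (contMDiff_conj a).contMDiffAt.hasD

/-- The derivative at the unit of `(a x a⁻¹) a = a x`. The identities that follow arise in the same
way from identities between translations. -/
lemma rightTr_Ad (a : G) (V : GroupLieAlgebra 𝓘(ℝ, E) G) : rightTr a (Ad a V) = leftTr a V := by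
  have h := (hasD_rightTr a).comp (hasD_Ad (E := E) a) (by simp)
  simp only [inv_mul_cancel_right] at h
  exact DFunLike.congr_fun (h.unique (hasD_leftTr a)) V

lemma Ad_mul (a b : G) (V : GroupLieAlgebra 𝓘(ℝ, E) G) : Ad (a * b) V = Ad a (Ad b V) := by
  have h := (hasD_Ad a).comp (hasD_Ad (E := E) b) (by simp)
  have h' := hasD_Ad (E := E) (a * b)
  simp only [mul_inv_rev, mul_assoc] at h h'
  exact (DFunLike.congr_fun (h.unique h') V).symm

lemma Ad_one (V : GroupLieAlgebra 𝓘(ℝ, E) G) : Ad (1 : G) V = V := by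
  have h := hasD_Ad (E := E) (1 : G)
  simp only [one_mul, inv_one, mul_one] at h
  exact DFunLike.congr_fun (h.unique (hasD_id _)) V

lemma Ad_inv_Ad (a : G) (V : GroupLieAlgebra 𝓘(ℝ, E) G) : Ad a⁻¹ (Ad a V) = V := by
  rw [← Ad_mul, inv_mul_cancel, Ad_one]

lemma Ad_Ad_inv (a : G) (V : GroupLieAlgebra 𝓘(ℝ, E) G) : Ad a (Ad a⁻¹ V) = V := by
  rw [← Ad_mul, mul_inv_cancel, Ad_one]

lemma leftTr_Ad_inv (a : G) (V : GroupLieAlgebra 𝓘(ℝ, E) G) :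
    leftTr a (Ad a⁻¹ V) = rightTr a V := by
  rw [← rightTr_Ad, Ad_Ad_inv]

lemma leftTrInv_leftTr (a : G) (V : GroupLieAlgebra 𝓘(ℝ, E) G) :
    leftTrInv a (leftTr a V) = V := by
  have h := (hasD_leftTrInv a).comp (hasD_leftTr (E := E) a) (by simp)
  simp only [inv_mul_cancel_left] at h
  exact DFunLike.congr_fun (h.unique (hasD_id _)) V

lemma leftTr_leftTrInv (a : G) (v : TangentSpace 𝓘(ℝ, E) a) :
    leftTr a (leftTrInv a v) = v := by
  have h := (hasD_leftTr a).comp (hasD_leftTrInv (E := E) a) (by simp)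
  simp only [mul_inv_cancel_left] at h
  exact DFunLike.congr_fun (h.unique (hasD_id _)) v

lemma rightTrInv_rightTr (a : G) (V : GroupLieAlgebra 𝓘(ℝ, E) G) :
    rightTrInv a (rightTr a V) = V := by
  have h := (hasD_rightTrInv a).comp (hasD_rightTr (E := E) a) (by simp)
  simp only [mul_inv_cancel_right] at h
  exact DFunLike.congr_fun (h.unique (hasD_id _)) V

lemma hasD_mul_one : HasD (𝓘(ℝ, E).prod 𝓘(ℝ, E)) 𝓘(ℝ, E) (fun p : G × G => p.1 * p.2) (1, 1)
    (ContinuousLinearMap.fst ℝ E E + ContinuousLinearMap.snd ℝ E E) := by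
  have h := (contMDiff_mul (G := G) 𝓘(ℝ, E) ∞).contMDiffAt (x := (1, 1)) |>.hasD_prod
    (f₁ := .id ℝ E) (f₂ := .id ℝ E) (by simpa using hasD_id _) (by simpa using hasD_id _)
  convert! h using 1

/-- The derivative of a product of two maps at a point where both take the value `1`. -/
lemma HasD.mul {f g : M → G} {x : M} {f' g' : EM →L[ℝ] E} (hf : HasD IM 𝓘(ℝ, E) f x f')
    (hg : HasD IM 𝓘(ℝ, E) g x g') (hf1 : f x = 1) (hg1 : g x = 1) :
    HasD IM 𝓘(ℝ, E) (fun z => f z * g z) x (f' + g') := by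
  have := hasD_mul_one.comp (hf.prodMk hg) (by rw [hf1, hg1])
  exact this

lemma hasD_inv_one : HasD 𝓘(ℝ, E) 𝓘(ℝ, E) (fun x : G => x⁻¹) 1
    (-ContinuousLinearMap.id ℝ E) := by
  obtain ⟨f', h⟩ : ∃ f' : E →L[ℝ] E, HasD 𝓘(ℝ, E) 𝓘(ℝ, E) (fun x : G => x⁻¹) 1 f' :=
    ⟨_, ((contMDiff_inv (G := G) 𝓘(ℝ, E) ∞).contMDiffAt (x := 1)).hasD⟩
  -- The product `x * x⁻¹` is constant, so the derivatives of its two factors add up to zero.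
  have h2 := (hasD_id (I := 𝓘(ℝ, E)) (1 : G)).mul h rfl inv_one
  simp only [mul_inv_cancel] at h2
  rwa [neg_eq_of_add_eq_zero_right (h2.unique (hasD_const _ _))]

end Group

/-! ### Preferred charts; smoothness of `Ad` and of left-translated fields. -/

section
variable {E : Type*} [NormedAddCommGroup E] [NormedSpace ℝ E]
  {G : Type*} [TopologicalSpace G] [ChartedSpace E G]

section Chart
variable [IsManifold 𝓘(ℝ, E) ∞ G]

lemma isManifold_one : IsManifold 𝓘(ℝ, E) 1 G :=
  IsManifold.of_le (n := ∞) (by simp)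

/-- The tangent space at `a` is identified with `E` through this very chart, so its derivative at
`a` is a coordinate change from the chart to itself. -/
lemma hasD_extChartAt_self (a : G) :
    HasD 𝓘(ℝ, E) 𝓘(ℝ, E) (extChartAt 𝓘(ℝ, E) a) a (.id ℝ E) := by
  have : IsManifold 𝓘(ℝ, E) 1 G := isManifold_one
  have h := (contMDiffAt_extChartAt (I := 𝓘(ℝ, E)) (n := ∞) (x := a)).hasD
  have h2 := mfderiv_chartAt_eq_tangentCoordChange (I := 𝓘(ℝ, E)) (mem_chart_source E a)
  have h3 : (mfderiv 𝓘(ℝ, E) 𝓘(ℝ, E) (extChartAt 𝓘(ℝ, E) a) a : E →L[ℝ] E) = .id ℝ E := by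
    refine Eq.trans (b := (tangentCoordChange 𝓘(ℝ, E) a a a : E →L[ℝ] E)) ?_ ?_
    · have h4 : (extChartAt 𝓘(ℝ, E) a : G → E) = chartAt E a := by simp
      rw [h4]
      exact h2
    · exact ContinuousLinearMap.ext fun v => tangentCoordChange_self (by simp)
  rwa [h3] at h

lemma contMDiffAt_extChartAt_symm (a : G) {x : E} (hx : x ∈ (extChartAt 𝓘(ℝ, E) a).target) :
    ContMDiffAt 𝓘(ℝ, E) 𝓘(ℝ, E) ∞ (extChartAt 𝓘(ℝ, E) a).symm x :=
  (contMDiffOn_extChartAt_symm (n := ∞) a).contMDiffAt ((isOpen_extChartAt_target a).mem_nhds hx)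

lemma hasD_extChartAt_symm_self (a : G) :
    HasD 𝓘(ℝ, E) 𝓘(ℝ, E) (extChartAt 𝓘(ℝ, E) a).symm (extChartAt 𝓘(ℝ, E) a a) (.id ℝ E) := by
  obtain ⟨f', h⟩ : ∃ f' : E →L[ℝ] E, HasD 𝓘(ℝ, E) 𝓘(ℝ, E) (extChartAt 𝓘(ℝ, E) a).symm
      (extChartAt 𝓘(ℝ, E) a a) f' :=
    ⟨_, (contMDiffAt_extChartAt_symm a (mem_extChartAt_target a)).hasD⟩
  have h2 := (hasD_extChartAt_self a).comp h (by simp)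
  have h3 := h2.unique ((hasD_id _).congr ?_)
  · rw [ContinuousLinearMap.id_comp] at h3
    rwa [h3] at h
  · filter_upwards [extChartAt_target_mem_nhds (I := 𝓘(ℝ, E)) a] with x hx
    exact (extChartAt 𝓘(ℝ, E) a).right_inv hx

/-- The Lie bracket on a manifold is defined by pulling fields back along the inverse chart, which
involves this inverse; the lemma turns it into the derivative of the chart itself. -/
lemma inverse_mfderivWithin_extChartAt_symm (a : G) {x : E}
    (hx : x ∈ (extChartAt 𝓘(ℝ, E) a).target) :
    (mfderivWithin 𝓘(ℝ, E) 𝓘(ℝ, E) (extChartAt 𝓘(ℝ, E) a).symm (Set.range 𝓘(ℝ, E)) x).inverse =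
      mfderiv 𝓘(ℝ, E) 𝓘(ℝ, E) (extChartAt 𝓘(ℝ, E) a) ((extChartAt 𝓘(ℝ, E) a).symm x) := by
  have : IsManifold 𝓘(ℝ, E) 1 G := isManifold_one
  exact ContinuousLinearMap.inverse_eq (mfderivWithin_extChartAt_symm_comp_mfderiv_extChartAt hx)
    (mfderiv_extChartAt_comp_mfderivWithin_extChartAt_symm hx)

lemma hasD_chartAt_self (a : G) : HasD 𝓘(ℝ, E) 𝓘(ℝ, E) (chartAt E a) a (.id ℝ E) := by
  simpa only [mfld_simps] using hasD_extChartAt_self (E := E) a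

lemma hasD_chartAt_symm_self (a : G) :
    HasD 𝓘(ℝ, E) 𝓘(ℝ, E) (chartAt E a).symm (chartAt E a a) (.id ℝ E) := by
  simpa only [mfld_simps] using hasD_extChartAt_symm_self (E := E) a
end Chart

variable [Group G] [LieGroup 𝓘(ℝ, E) ∞ G]

/-- Source and target points stay at the fixed point `c`, so the coordinate changes on both sides
are identities. -/
lemma inTangentCoordinates_eq_self {N : Type*} (c : G) {g : N → G} {ϕ : N → E →L[ℝ] E} {x₀ x : N}
    (h : g x = c) (h₀ : g x₀ = c) :
    inTangentCoordinates 𝓘(ℝ, E) 𝓘(ℝ, E) (fun _ => c) g ϕ x₀ x = ϕ x := by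
  have : IsManifold 𝓘(ℝ, E) 1 G := isManifold_one
  subst h
  rw [inTangentCoordinates_eq (fun _ => g x) g ϕ (x₀ := x₀) (x := x) (mem_chart_source E (g x))
    (by rw [h₀]; exact mem_chart_source E (g x)), h₀]
  refine ContinuousLinearMap.ext fun v => ?_
  simp only [ContinuousLinearMap.comp_apply]
  rw [(tangentBundleCore 𝓘(ℝ, E) G).coordChange_self _ _ (mem_chart_source E (g x)),
    (tangentBundleCore 𝓘(ℝ, E) G).coordChange_self _ _ (mem_chart_source E (g x))]

/-- `Ad a` as an endomorphism of the model space. -/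
noncomputable def AdL (a : G) : E →L[ℝ] E := Ad (E := E) a

/-- `Ad x` is a partial derivative of the smooth map `(x, y) ↦ x y x⁻¹` at `y = 1`. The image point
is always `1`, so the smoothness in tangent coordinates is smoothness as a map into the
endomorphisms of `E`. -/
lemma contMDiff_AdL : ContMDiff 𝓘(ℝ, E) 𝓘(ℝ, E →L[ℝ] E) ∞ (AdL (E := E) (G := G)) := by
  intro a
  have : IsManifold 𝓘(ℝ, E) 1 G := isManifold_one
  have hc : ContMDiff (𝓘(ℝ, E).prod 𝓘(ℝ, E)) 𝓘(ℝ, E) ∞ (fun p : G × G => p.1 * p.2 * p.1⁻¹) :=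
    (contMDiff_fst.mul contMDiff_snd).mul contMDiff_fst.inv
  have h := ContMDiffAt.mfderiv (I := 𝓘(ℝ, E)) (J := 𝓘(ℝ, E)) (I' := 𝓘(ℝ, E)) (m := ∞) (n := ∞)
    (x₀ := a) (fun x y : G => x * y * x⁻¹) (fun _ => 1)
    hc.contMDiffAt contMDiffAt_const (by simp)
  refine h.congr_of_eventuallyEq (Filter.Eventually.of_forall fun x => ?_)
  exact (inTangentCoordinates_eq_self _ (ϕ := AdL (E := E)) (by simp) (by simp)).symm

/-- The field is the tangent map of the multiplication `G × G → G` applied to the pair of the zero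
vector at `a` and `f a` at `1`. -/
lemma smoothField_leftTr {f : G → E} (hf : ContMDiff 𝓘(ℝ, E) 𝓘(ℝ, E) ∞ f) :
    SmoothField (E := E) (fun a : G => leftTr a (f a)) := by
  have : IsManifold 𝓘(ℝ, E) 1 G := isManifold_one
  have h0 : ContMDiff 𝓘(ℝ, E) 𝓘(ℝ, E).tangent ∞
      (fun g : G => (⟨g, 0⟩ : TangentBundle 𝓘(ℝ, E) G)) := Bundle.contMDiff_zeroSection _ _
  have h1 : ContMDiff 𝓘(ℝ, E) 𝓘(ℝ, E).tangent ∞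
      (fun g : G => (⟨1, f g⟩ : TangentBundle 𝓘(ℝ, E) G)) := by
    intro x
    rw [Bundle.contMDiffAt_totalSpace]
    refine ⟨contMDiffAt_const, ?_⟩
    refine (hf x).congr_of_eventuallyEq (Filter.Eventually.of_forall fun y => ?_)
    exact (tangentBundleCore 𝓘(ℝ, E) G).coordChange_self _ _ (mem_chart_source E (1 : G)) _
  have h3 : ContMDiff (𝓘(ℝ, E).prod 𝓘(ℝ, E)).tangent 𝓘(ℝ, E).tangent ∞
      (tangentMap (𝓘(ℝ, E).prod 𝓘(ℝ, E)) 𝓘(ℝ, E) (fun p : G × G => p.1 * p.2)) :=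
    (contMDiff_mul 𝓘(ℝ, E) ∞).contMDiff_tangentMap (by simp)
  have h4 := (h3.comp contMDiff_equivTangentBundleProd_symm).comp (h0.prodMk h1)
  refine h4.congr fun g => ?_
  have hD := (contMDiff_mul (G := G) 𝓘(ℝ, E) ∞).contMDiffAt (x := (g, 1)) |>.hasD_prod
    (f₁ := .id ℝ E) (by simpa using hasD_id _) (hasD_leftTr g)
  -- The tangent map produces a vector over `g * 1`, not over `g`; equality in the bundle is
  -- obtained by substituting the base point.
  have key : ∀ (b : G) (w : E), b = g → w = leftTr g (f g) →
      (⟨g, leftTr g (f g)⟩ : TangentBundle 𝓘(ℝ, E) G) = ⟨b, w⟩ := by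
    rintro b w rfl rfl
    rfl
  refine key _ _ (mul_one g) ?_
  exact (DFunLike.congr_fun hD.mfderiv ((0 : E), f g)).trans (zero_add (leftTr g (f g) : E))
end

/-! ### The Lie bracket in the chart at the unit, and the derivative of `Ad`. -/

section
variable {E : Type*} [NormedAddCommGroup E] [NormedSpace ℝ E]
  {G : Type*} [TopologicalSpace G] [ChartedSpace E G] [Group G] [LieGroup 𝓘(ℝ, E) ∞ G]

lemma lieBracketWithin_univ_eq_of_eventuallyEq {V W v w : E → E} {x : E}
    {v' w' : E →L[ℝ] E} (hV : V =ᶠ[nhds x] v) (hW : W =ᶠ[nhds x] w) (hv' : HasFDerivAt v v' x)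
    (hw' : HasFDerivAt w w' x) :
    VectorField.lieBracketWithin ℝ V W Set.univ x = w' (v x) - v' (w x) := by
  rw [VectorField.lieBracketWithin_univ, hV.lieBracket_vectorField_eq hW, VectorField.lieBracket_eq]
  simp only [hv'.fderiv, hw'.fderiv]

/-- The Lie bracket of vector fields at the centre of a chart, computed in this chart. -/
lemma mlieBracket_eq_of_chart (a : G) {V W : (x : G) → TangentSpace 𝓘(ℝ, E) x} {v w : E → E}
    {v' w' : E →L[ℝ] E}
    (hv : ∀ᶠ x in nhds (extChartAt 𝓘(ℝ, E) a a), v x = (mfderiv 𝓘(ℝ, E) 𝓘(ℝ, E)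
      (extChartAt 𝓘(ℝ, E) a) ((extChartAt 𝓘(ℝ, E) a).symm x)) (V ((extChartAt 𝓘(ℝ, E) a).symm x)))
    (hw : ∀ᶠ x in nhds (extChartAt 𝓘(ℝ, E) a a), w x = (mfderiv 𝓘(ℝ, E) 𝓘(ℝ, E)
      (extChartAt 𝓘(ℝ, E) a) ((extChartAt 𝓘(ℝ, E) a).symm x)) (W ((extChartAt 𝓘(ℝ, E) a).symm x)))
    (hv' : HasFDerivAt v v' (extChartAt 𝓘(ℝ, E) a a))
    (hw' : HasFDerivAt w w' (extChartAt 𝓘(ℝ, E) a a)) :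
    VectorField.mlieBracket 𝓘(ℝ, E) V W a =
      w' (v (extChartAt 𝓘(ℝ, E) a a)) - v' (w (extChartAt 𝓘(ℝ, E) a a)) := by
  have key : ∀ (U : (x : G) → TangentSpace 𝓘(ℝ, E) x) (u : E → E),
      (∀ᶠ x in nhds (extChartAt 𝓘(ℝ, E) a a), u x = (mfderiv 𝓘(ℝ, E) 𝓘(ℝ, E)
      (extChartAt 𝓘(ℝ, E) a) ((extChartAt 𝓘(ℝ, E) a).symm x))
        (U ((extChartAt 𝓘(ℝ, E) a).symm x))) →
      VectorField.mpullbackWithin 𝓘(ℝ, E) 𝓘(ℝ, E) (extChartAt 𝓘(ℝ, E) a).symm U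
        (Set.range 𝓘(ℝ, E)) =ᶠ[nhds (extChartAt 𝓘(ℝ, E) a a)] u := by
    intro U u hu
    filter_upwards [hu, extChartAt_target_mem_nhds (I := 𝓘(ℝ, E)) a] with x hx hx'
    rw [VectorField.mpullbackWithin_apply, inverse_mfderivWithin_extChartAt_symm a hx', hx]
    rfl
  rw [← VectorField.mlieBracketWithin_univ, VectorField.mlieBracketWithin_apply,
    (hasD_extChartAt_self a).mfderiv]
  have hs : (extChartAt 𝓘(ℝ, E) a).symm ⁻¹' Set.univ ∩ Set.range 𝓘(ℝ, E) = Set.univ := by simp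
  rw [hs]
  exact (DFunLike.congr_fun (ContinuousLinearMap.inverse_id (R := ℝ) (M := E)) _).trans
    (lieBracketWithin_univ_eq_of_eventuallyEq (key V v hv) (key W w hw) hv' hw')

variable (E G) in
/-- The multiplication of `G` in the preferred chart at `1`. -/
noncomputable def chartMul (p : E × E) : E :=
  extChartAt 𝓘(ℝ, E) (1 : G) ((extChartAt 𝓘(ℝ, E) (1 : G)).symm p.1 *
    (extChartAt 𝓘(ℝ, E) (1 : G)).symm p.2)

lemma contDiffAt_chartMul : ContDiffAt ℝ ∞ (chartMul E G)
    (extChartAt 𝓘(ℝ, E) (1 : G) 1, extChartAt 𝓘(ℝ, E) (1 : G) 1) := by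
  rw [← contMDiffAt_iff_contDiffAt]
  have h := contMDiffAt_extChartAt_symm (1 : G) (mem_extChartAt_target (I := 𝓘(ℝ, E)) 1)
  have h1 := ContMDiffAt.comp (x := (extChartAt 𝓘(ℝ, E) (1 : G) 1, extChartAt 𝓘(ℝ, E) (1 : G) 1))
    (f := (Prod.fst : E × E → E)) (I := 𝓘(ℝ, E × E)) h contDiff_fst.contMDiff.contMDiffAt
  have h2 := ContMDiffAt.comp (x := (extChartAt 𝓘(ℝ, E) (1 : G) 1, extChartAt 𝓘(ℝ, E) (1 : G) 1))
    (f := (Prod.snd : E × E → E)) (I := 𝓘(ℝ, E × E)) h contDiff_snd.contMDiff.contMDiffAt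
  refine ContMDiffAt.comp (I' := 𝓘(ℝ, E)) _ ?_ (h1.mul h2)
  simpa using contMDiffAt_extChartAt (I := 𝓘(ℝ, E)) (n := ∞) (x := (1 : G))

/-- Near the unit, the partial derivative of the multiplication in the second slot is the left
invariant field of `V`, read in the chart. -/
lemma eventually_fderiv_chartMul_inr (V : GroupLieAlgebra 𝓘(ℝ, E) G) :
    ∀ᶠ x in nhds (extChartAt 𝓘(ℝ, E) (1 : G) 1),
      fderiv ℝ (chartMul E G) (x, extChartAt 𝓘(ℝ, E) (1 : G) 1) ((0 : E), V) =
      (mfderiv 𝓘(ℝ, E) 𝓘(ℝ, E) (extChartAt 𝓘(ℝ, E) (1 : G))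
        ((extChartAt 𝓘(ℝ, E) (1 : G)).symm x)) (leftTr ((extChartAt 𝓘(ℝ, E) (1 : G)).symm x) V) := by
  have hc : ContinuousAt (fun x : E => (x, extChartAt 𝓘(ℝ, E) (1 : G) 1))
    (extChartAt 𝓘(ℝ, E) (1 : G) 1) := by fun_prop
  have he := hc.eventually ((contDiffAt_chartMul.of_le (m := 1) (by simp)).eventually (by simp))
  filter_upwards [extChartAt_target_mem_nhds (I := 𝓘(ℝ, E)) (1 : G), he] with x hx hx'
  have h1 := ((hx'.differentiableAt (by simp)).hasFDerivAt.comp _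
    (hasFDerivAt_prodMk_right x (extChartAt 𝓘(ℝ, E) (1 : G) 1))).hasMFDerivAt
  have h2 := (hasD_leftTr ((extChartAt 𝓘(ℝ, E) (1 : G)).symm x)).comp
    (hasD_extChartAt_symm_self (E := E) (1 : G)) (by simp)
  have h3 : HasD 𝓘(ℝ, E) 𝓘(ℝ, E) (extChartAt 𝓘(ℝ, E) (1 : G))
      ((extChartAt 𝓘(ℝ, E) (1 : G)).symm x) _ :=
    (contMDiffAt_extChartAt' (n := ∞) (by
      simpa using (extChartAt 𝓘(ℝ, E) (1 : G)).map_target hx)).hasD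
  exact DFunLike.congr_fun (HasD.unique h1 (h3.comp h2 (by simp))) V

/-- The right invariant counterpart. The neighbourhood is uniform in `V` because `V` will later be
`Ad x B`, which varies with the point. -/
lemma eventually_fderiv_chartMul_inl :
    ∀ᶠ x in nhds (extChartAt 𝓘(ℝ, E) (1 : G) 1), ∀ V : GroupLieAlgebra 𝓘(ℝ, E) G,
      fderiv ℝ (chartMul E G) (extChartAt 𝓘(ℝ, E) (1 : G) 1, x) (V, (0 : E)) =
      (mfderiv 𝓘(ℝ, E) 𝓘(ℝ, E) (extChartAt 𝓘(ℝ, E) (1 : G))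
        ((extChartAt 𝓘(ℝ, E) (1 : G)).symm x))
        (rightTr ((extChartAt 𝓘(ℝ, E) (1 : G)).symm x) V) := by
  have hc : ContinuousAt (fun x : E => (extChartAt 𝓘(ℝ, E) (1 : G) 1, x))
    (extChartAt 𝓘(ℝ, E) (1 : G) 1) := by fun_prop
  have he := hc.eventually ((contDiffAt_chartMul.of_le (m := 1) (by simp)).eventually (by simp))
  filter_upwards [extChartAt_target_mem_nhds (I := 𝓘(ℝ, E)) (1 : G), he] with x hx hx' V
  have h1 := ((hx'.differentiableAt (by simp)).hasFDerivAt.comp (f := fun e : E => (e, x)) _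
    (hasFDerivAt_prodMk_left (extChartAt 𝓘(ℝ, E) (1 : G) 1) x)).hasMFDerivAt
  have h2 := (hasD_rightTr ((extChartAt 𝓘(ℝ, E) (1 : G)).symm x)).comp
    (hasD_extChartAt_symm_self (E := E) (1 : G)) (by simp)
  have h3 : HasD 𝓘(ℝ, E) 𝓘(ℝ, E) (extChartAt 𝓘(ℝ, E) (1 : G))
      ((extChartAt 𝓘(ℝ, E) (1 : G)).symm x) _ :=
    (contMDiffAt_extChartAt' (n := ∞) (by
      simpa using (extChartAt 𝓘(ℝ, E) (1 : G)).map_target hx)).hasD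
  exact DFunLike.congr_fun (HasD.unique h1 (h3.comp h2 (by simp))) V

lemma hasFDerivAt_fderiv_chartMul :
    HasFDerivAt (fderiv ℝ (chartMul E G)) (fderiv ℝ (fderiv ℝ (chartMul E G))
      (extChartAt 𝓘(ℝ, E) (1 : G) 1, extChartAt 𝓘(ℝ, E) (1 : G) 1))
      (extChartAt 𝓘(ℝ, E) (1 : G) 1, extChartAt 𝓘(ℝ, E) (1 : G) 1) :=
  ((contDiffAt_chartMul.fderiv_right (m := ∞) (by simp)).differentiableAt (by simp)).hasFDerivAt

lemma leftTr_one (V : GroupLieAlgebra 𝓘(ℝ, E) G) : leftTr (1 : G) V = V := by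
  have h := hasD_leftTr (E := E) (1 : G)
  simp only [one_mul] at h
  exact DFunLike.congr_fun (h.unique (hasD_id _)) V

lemma rightTr_one (V : GroupLieAlgebra 𝓘(ℝ, E) G) : rightTr (1 : G) V = V := by
  have h := hasD_rightTr (E := E) (1 : G)
  simp only [mul_one] at h
  exact DFunLike.congr_fun (h.unique (hasD_id _)) V

lemma fderiv_chartMul_inr (V : GroupLieAlgebra 𝓘(ℝ, E) G) : fderiv ℝ (chartMul E G)
    (extChartAt 𝓘(ℝ, E) (1 : G) 1, extChartAt 𝓘(ℝ, E) (1 : G) 1) ((0 : E), V) = V := by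
  rw [(eventually_fderiv_chartMul_inr V).self_of_nhds, extChartAt_to_inv, leftTr_one]
  exact DFunLike.congr_fun (hasD_extChartAt_self (1 : G)).mfderiv V

lemma fderiv_chartMul_inl (V : GroupLieAlgebra 𝓘(ℝ, E) G) : fderiv ℝ (chartMul E G)
    (extChartAt 𝓘(ℝ, E) (1 : G) 1, extChartAt 𝓘(ℝ, E) (1 : G) 1) (V, (0 : E)) = V := by
  rw [eventually_fderiv_chartMul_inl.self_of_nhds V, extChartAt_to_inv, rightTr_one]
  exact DFunLike.congr_fun (hasD_extChartAt_self (1 : G)).mfderiv V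

/-- The bracket is that of left invariant fields, which in the chart are partial derivatives of the
multiplication. Differentiating them once more gives the antisymmetrized mixed second derivative. -/
lemma bracket_eq_fderiv_chartMul (V W : GroupLieAlgebra 𝓘(ℝ, E) G) :
    ⁅V, W⁆ = (fderiv ℝ (fderiv ℝ (chartMul E G))
        (extChartAt 𝓘(ℝ, E) (1 : G) 1, extChartAt 𝓘(ℝ, E) (1 : G) 1) (V, (0 : E)) ((0 : E), W) -
      fderiv ℝ (fderiv ℝ (chartMul E G))
        (extChartAt 𝓘(ℝ, E) (1 : G) 1, extChartAt 𝓘(ℝ, E) (1 : G) 1) (W, (0 : E)) ((0 : E), V) : E)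
        := by
  have hd : ∀ U : E, HasFDerivAt (fun x : E => fderiv ℝ (chartMul E G)
      (x, extChartAt 𝓘(ℝ, E) (1 : G) 1) ((0 : E), U)) _ (extChartAt 𝓘(ℝ, E) (1 : G) 1) := fun U =>
    (ContinuousLinearMap.apply ℝ E ((0 : E), U)).hasFDerivAt.comp _
      (hasFDerivAt_fderiv_chartMul (E := E) (G := G) |>.comp
        (f := fun e : E => (e, extChartAt 𝓘(ℝ, E) (1 : G) 1)) _
        (hasFDerivAt_prodMk_left _ (extChartAt 𝓘(ℝ, E) (1 : G) 1)))
  rw [GroupLieAlgebra.bracket_def]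
  refine (mlieBracket_eq_of_chart (1 : G) (eventually_fderiv_chartMul_inr V)
    (eventually_fderiv_chartMul_inr W) (hd V) (hd W)).trans ?_
  rw [fderiv_chartMul_inr, fderiv_chartMul_inr]
  rfl

variable (G) in
/-- The bracket of `T_e G`, as an operation on the model space. -/
noncomputable def brk (V W : E) : E :=
  (fun v w : GroupLieAlgebra 𝓘(ℝ, E) G => (⁅v, w⁆ : GroupLieAlgebra 𝓘(ℝ, E) G)) V W

/-- The derivative of the adjoint representation at the unit is the bracket. -/
lemma hasD_AdL_one_apply (V B : E) {D : E →L[ℝ] E}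
    (hD : HasD 𝓘(ℝ, E) 𝓘(ℝ, E) (fun a : G => AdL a B) 1 D) :
    D V = brk G V B := by
  set o := extChartAt 𝓘(ℝ, E) (1 : G) 1 with ho
  have hA : HasFDerivAt (fun x : E => AdL ((extChartAt 𝓘(ℝ, E) (1 : G)).symm x) B) D o :=
    (hD.comp (hasD_extChartAt_symm_self (1 : G)) (by simp)).hasFDerivAt
  have hl := (ContinuousLinearMap.apply ℝ E ((0 : E), B)).hasFDerivAt.comp o
    ((hasFDerivAt_fderiv_chartMul (E := E) (G := G)).comp (f := fun e : E => (e, o)) _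
      (hasFDerivAt_prodMk_left o o))
  have hr := ((hasFDerivAt_fderiv_chartMul (E := E) (G := G)).comp (f := fun e : E => (o, e)) _
    (hasFDerivAt_prodMk_right o o)).clm_apply (hA.prodMk (hasFDerivAt_const (0 : E) o))
  -- This is `x B = (Ad(x)B) x` in the chart. Both sides are now differentiated in `x` at the unit.
  have he : (fun x : E => fderiv ℝ (chartMul E G) (x, o) ((0 : E), B)) =ᶠ[nhds o]
      (fun x : E => fderiv ℝ (chartMul E G) (o, x)
        (AdL ((extChartAt 𝓘(ℝ, E) (1 : G)).symm x) B, (0 : E))) := by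
    filter_upwards [eventually_fderiv_chartMul_inr B, eventually_fderiv_chartMul_inl (E := E) (G := G)]
      with x hx hx'
    refine hx.trans ((hx' _).trans ?_).symm
    exact congrArg _ (rightTr_Ad _ B)
  have h : fderiv ℝ (fderiv ℝ (chartMul E G)) (o, o) (V, (0 : E)) ((0 : E), B) =
      fderiv ℝ (chartMul E G) (o, o) (D V, (0 : E)) +
      fderiv ℝ (fderiv ℝ (chartMul E G)) (o, o) ((0 : E), V)
        (AdL ((extChartAt 𝓘(ℝ, E) (1 : G)).symm o) B, (0 : E)) :=
    DFunLike.congr_fun (hl.unique (hr.congr_of_eventuallyEq he)) V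
  -- Symmetry of the second derivative turns the term with `V` in the second slot and `B` in the
  -- first into the one that occurs in `⁅V, B⁆`.
  have hs := (contDiffAt_chartMul (E := E) (G := G)).isSymmSndFDerivAt
    (by rw [minSmoothness_of_isRCLikeNormedField]; exact ENat.LEInfty.out)
  have h1 : AdL ((extChartAt 𝓘(ℝ, E) (1 : G)).symm o) B = B := by
    rw [ho, extChartAt_to_inv]
    exact Ad_one B
  have h2 : fderiv ℝ (chartMul E G) (o, o) (D V, (0 : E)) = D V := fderiv_chartMul_inl _
  rw [h1, h2, hs.eq ((0 : E), V) (B, (0 : E))] at h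
  exact (eq_sub_of_add_eq h.symm).trans (bracket_eq_fderiv_chartMul (G := G) V B).symm

lemma contMDiff_AdL_apply (B : E) : ContMDiff 𝓘(ℝ, E) 𝓘(ℝ, E) ∞ (fun a : G => AdL a B) :=
  (contMDiff_AdL (E := E) (G := G)).clm_apply contMDiff_const

/-- The left translation, as an endomorphism of the model space. -/
noncomputable def leftL (a : G) : E →L[ℝ] E := leftTr (E := E) a

/-- Since `Ad(a z) = Ad(a) Ad(z)`, the derivative at `a` is reduced to that at the unit. -/
lemma hasD_AdL_apply_leftL (a : G) (V B : E) {D : E →L[ℝ] E}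
    (hD : HasD 𝓘(ℝ, E) 𝓘(ℝ, E) (fun a : G => AdL a B) a D) :
    D (leftL a V) = AdL a (brk G V B) := by
  obtain ⟨D₁, h1⟩ : ∃ D₁ : E →L[ℝ] E, HasD 𝓘(ℝ, E) 𝓘(ℝ, E) (fun a : G => AdL a B) 1 D₁ :=
    ⟨_, (contMDiff_AdL_apply B).contMDiffAt.hasD⟩
  have h2 := (hasD_clm (AdL a) (AdL (1 : G) B)).comp h1 rfl
  have h3 := hD.comp (hasD_leftTr (E := E) a) (mul_one a)
  have h4 : (fun z : G => AdL (a * z) B) = fun z => AdL a (AdL z B) :=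
    funext fun z => Ad_mul a z B
  rw [h4] at h3
  refine (DFunLike.congr_fun (h3.unique h2) V).trans ?_
  exact congrArg (AdL a) (hasD_AdL_one_apply V B h1)
end

/-! ### `Ad` preserves brackets; brackets of fields in the left trivialization. -/

section
variable {E : Type*} [NormedAddCommGroup E] [NormedSpace ℝ E]
  {G : Type*} [TopologicalSpace G] [ChartedSpace E G] [Group G] [LieGroup 𝓘(ℝ, E) ∞ G]

lemma hasD_conj (a x : G) : ∃ D : E →L[ℝ] E, HasD 𝓘(ℝ, E) 𝓘(ℝ, E) (fun y : G => a * y * a⁻¹) x D :=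
  ⟨_, (contMDiff_conj a).contMDiffAt.hasD⟩

/-- Differentiates `a (x z) a⁻¹ = (a x a⁻¹)(a z a⁻¹)` at `z = 1`: conjugation takes the left
invariant field of `V` to that of `Ad a V`. -/
lemma mfderiv_conj_leftTr (a x : G) (V : GroupLieAlgebra 𝓘(ℝ, E) G) :
    mfderiv 𝓘(ℝ, E) 𝓘(ℝ, E) (fun y : G => a * y * a⁻¹) x (leftTr x V) =
      leftTr (a * x * a⁻¹) (Ad a V) := by
  obtain ⟨D, hD⟩ := hasD_conj (E := E) a x
  have h1 := hD.comp (hasD_leftTr x) (mul_one x)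
  have h2 := (hasD_leftTr (a * x * a⁻¹)).comp (hasD_Ad (E := E) a) (by simp)
  have h3 : (fun z : G => a * x * a⁻¹ * (a * z * a⁻¹)) = fun z => a * (x * z) * a⁻¹ := by
    funext z; group
  rw [h3] at h2
  refine Eq.trans ?_ (DFunLike.congr_fun (h1.unique h2) V)
  exact DFunLike.congr_fun hD.mfderiv _

lemma inverse_mfderiv_conj (a x : G) (v : TangentSpace 𝓘(ℝ, E) x) :
    (mfderiv 𝓘(ℝ, E) 𝓘(ℝ, E) (fun y : G => a * y * a⁻¹) x).inverse
      (mfderiv 𝓘(ℝ, E) 𝓘(ℝ, E) (fun y : G => a * y * a⁻¹) x v) = v := by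
  obtain ⟨D, hD⟩ := hasD_conj (E := E) a x
  obtain ⟨D', hD'⟩ := hasD_conj (E := E) a⁻¹ (a * x * a⁻¹)
  have h1 := hD'.comp hD rfl
  have h2 : (fun z : G => a⁻¹ * (a * z * a⁻¹) * a⁻¹⁻¹) = fun z => z := by
    funext z; group
  rw [h2] at h1
  have h1 := h1.unique (hasD_id x)
  have h3 := hD.comp (x := a * x * a⁻¹) hD' (by group)
  have h4 : (fun z : G => a * (a⁻¹ * z * a⁻¹⁻¹) * a⁻¹) = fun z => z := by
    funext z; group
  rw [h4] at h3
  have h3 := h3.unique (hasD_id _)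
  have h5 : ∀ F : E →L[ℝ] E, F = D → ∀ w : E, F.inverse (F w) = w := by
    rintro F rfl w
    rw [ContinuousLinearMap.inverse_eq h3 h1]
    exact DFunLike.congr_fun h1 w
  exact h5 _ hD.mfderiv v

lemma mpullback_conj (a : G) (V : GroupLieAlgebra 𝓘(ℝ, E) G) :
    mpullback 𝓘(ℝ, E) 𝓘(ℝ, E) (fun y : G => a * y * a⁻¹) (mulInvariantVectorField (Ad a V)) =
      mulInvariantVectorField V := by
  funext x
  rw [mpullback_apply]
  refine Eq.trans (congrArg _ (mfderiv_conj_leftTr a x V).symm) ?_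
  exact inverse_mfderiv_conj a x _

/-- Pullback along the conjugation commutes with the Lie bracket of vector fields, and it takes the
left invariant field of `Ad a V` to that of `V`; comparing values at the unit gives the claim. -/
lemma Ad_bracket [CompleteSpace E] (a : G) (V W : GroupLieAlgebra 𝓘(ℝ, E) G) :
    Ad a ⁅V, W⁆ = ⁅Ad a V, Ad a W⁆ := by
  have h := mpullback_mlieBracket (I := 𝓘(ℝ, E)) (I' := 𝓘(ℝ, E)) (n := ∞) (x₀ := (1 : G))
    (f := fun y : G => a * y * a⁻¹)
    (mdifferentiableAt_mulInvariantVectorField (Ad a V))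
    (mdifferentiableAt_mulInvariantVectorField (Ad a W)) (contMDiff_conj a).contMDiffAt
    (by rw [minSmoothness_of_isRCLikeNormedField]; exact ENat.LEInfty.out)
  have hb : ∀ X Y : GroupLieAlgebra 𝓘(ℝ, E) G, mlieBracket 𝓘(ℝ, E) (mulInvariantVectorField X)
      (mulInvariantVectorField Y) = mulInvariantVectorField ⁅X, Y⁆ :=
    fun X Y => (mulInvariantVector_mlieBracket X Y).symm
  -- The bracket is rewritten as `Ad a (Ad a⁻¹ _)`, so that the pullback formula applies to its left
  -- invariant field as well.
  rw [mpullback_conj, mpullback_conj, hb, hb, ← Ad_Ad_inv a ⁅Ad a V, Ad a W⁆, mpullback_conj] at h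
  have h1 : Ad a⁻¹ ⁅Ad a V, Ad a W⁆ = ⁅V, W⁆ := by
    have h2 := leftTr_one (E := E) (G := G)
    exact (h2 _).symm.trans (h.trans (h2 _))
  rw [← h1, Ad_Ad_inv]

lemma AdL_brk [CompleteSpace E] (a : G) (V W : E) :
    AdL a (brk G V W) = brk G (AdL a V) (AdL a W) := Ad_bracket a V W

section
variable [CompleteSpace E]

variable (G) in
/-- `ad V`, as a linear endomorphism of the model space. -/
noncomputable def adL (V : E) : E →ₗ[ℝ] E :=
  (LieAlgebra.ad ℝ (GroupLieAlgebra 𝓘(ℝ, E) G) V : GroupLieAlgebra 𝓘(ℝ, E) G →ₗ[ℝ] _)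

lemma brk_neg_swap (V W : E) : -brk G V W = brk G W V :=
  lie_skew (L := GroupLieAlgebra 𝓘(ℝ, E) G) W V

lemma brk_neg_right (V W : E) : brk G V (-W) = -brk G V W := map_neg (adL G V) W

lemma brk_neg_left (V W : E) : brk G (-V) W = -brk G V W := by
  rw [← brk_neg_swap, brk_neg_right, brk_neg_swap]
end

variable [FiniteDimensional ℝ E]

lemma mlieBracket_sum_smul_right {ι : Type*} (s : Finset ι) (f : ι → G → ℝ)
    (W : ι → (x : G) → TangentSpace 𝓘(ℝ, E) x) (V : (x : G) → TangentSpace 𝓘(ℝ, E) x) (a : G)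
    (hf : ∀ i, MDifferentiableAt 𝓘(ℝ, E) 𝓘(ℝ, ℝ) (f i) a)
    (hW : ∀ i, MDifferentiableAt 𝓘(ℝ, E) 𝓘(ℝ, E).tangent
      (fun x => (⟨x, W i x⟩ : TangentBundle 𝓘(ℝ, E) G)) a) :
    mlieBracket 𝓘(ℝ, E) V (fun x => ∑ i ∈ s, f i x • W i x) a =
      ∑ i ∈ s, (mvfderiv 𝓘(ℝ, E) (f i) a (V a) • W i a + f i a • mlieBracket 𝓘(ℝ, E) V (W i) a) := by
  classical
  have : CompleteSpace E := FiniteDimensional.complete ℝ E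
  have : IsManifold 𝓘(ℝ, E) 1 G := isManifold_one
  have : IsManifold 𝓘(ℝ, E) (minSmoothness ℝ 2) G := IsManifold.of_le (n := ∞) (by
    rw [minSmoothness_of_isRCLikeNormedField]; exact ENat.LEInfty.out)
  induction s using Finset.induction_on with
  | empty =>
    simp only [Finset.sum_empty]
    exact congrFun (mlieBracket_zero_right (W := V)) a
  | insert i s hi ih =>
    simp only [Finset.sum_insert hi]
    have h1 := mlieBracket_add_right (V := V) (W := f i • W i) (W₁ := fun x => ∑ i ∈ s, f i x • W i x)
      ((hf i).smul_section (hW i))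
      (MDifferentiableAt.sum_section fun j _ => (hf j).smul_section (hW j))
    refine h1.trans ?_
    rw [mlieBracket_smul_right (hf i) (hW i), ih]

/-- Expanding `g` in the basis `e` makes the field a combination of left invariant fields with
function coefficients. The Leibniz rule gives one term with the derivative of `g` and one with the
coefficients frozen at `a`. -/
lemma mlieBracket_leftTr_right {g : G → E} {a : G} {Dg : E →L[ℝ] E}
    (hg : HasD 𝓘(ℝ, E) 𝓘(ℝ, E) g a Dg) (V : (x : G) → TangentSpace 𝓘(ℝ, E) x) {n : Type*}
    [Fintype n] (e : Module.Basis n ℝ E) :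
    mlieBracket 𝓘(ℝ, E) V (fun x => leftTr x (g x)) a =
      leftTr a (Dg (V a)) + ∑ i, e.repr (g a) i •
        mlieBracket 𝓘(ℝ, E) V (fun x => leftTr x (e i)) a := by
  have hexp : ∀ (x : G) (w : E), leftTr (E := E) x w =
      ∑ i, (e.coord i).toContinuousLinearMap w • leftTr (E := E) x (e i) := by
    intro x w
    refine (congrArg (leftL x) (e.sum_repr w).symm).trans ?_
    exact (map_sum (leftL x) _ _).trans (Finset.sum_congr rfl fun i _ => map_smul (leftL x) _ _)
  have h1 : (fun x => leftTr (E := E) x (g x)) = fun x =>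
      ∑ i, (e.coord i).toContinuousLinearMap (g x) • leftTr (E := E) x (e i) :=
    funext fun x => hexp x (g x)
  rw [h1, mlieBracket_sum_smul_right, Finset.sum_add_distrib]
  · congr 1
    rw [hexp a (Dg (V a))]
    exact Finset.sum_congr rfl fun i _ => congrArg (· • leftTr (E := E) a (e i))
      (hg.mvfderiv_clm _ _)
  · intro i
    exact ((hasD_clm (e.coord i).toContinuousLinearMap _).comp hg rfl).mdifferentiableAt
  · intro i
    exact (smoothField_leftTr (f := fun _ => e i) contMDiff_const).mdifferentiable (by simp) a

/-- The Lie bracket of two vector fields that are given by functions into `T_e G` through left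
translation. -/
lemma mlieBracket_leftTr {f g : G → E} {a : G} {Df Dg : E →L[ℝ] E}
    (hf : HasD 𝓘(ℝ, E) 𝓘(ℝ, E) f a Df) (hg : HasD 𝓘(ℝ, E) 𝓘(ℝ, E) g a Dg) :
    mlieBracket 𝓘(ℝ, E) (fun x => leftTr x (f x)) (fun x => leftTr x (g x)) a =
      leftL a (Dg (leftL a (f a)) - Df (leftL a (g a)) + brk G (f a) (g a)) := by
  have : CompleteSpace E := FiniteDimensional.complete ℝ E
  let e := Module.finBasis ℝ E
  have h3 : ∀ (M : E →ₗ[ℝ] E) (v : E), ∑ i, e.repr v i • M (e i) = M v := by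
    intro M v
    conv_rhs => rw [← e.sum_repr v, map_sum]
    exact Finset.sum_congr rfl fun i _ => (map_smul M _ _).symm
  have hc : ∀ u v : E, mlieBracket 𝓘(ℝ, E) (fun x : G => leftTr x u) (fun x => leftTr x v) a =
      leftL a (brk G u v) := fun u v =>
    (congrFun (mulInvariantVector_mlieBracket (I := 𝓘(ℝ, E)) (G := G) u v) a).symm
  have h1 : ∀ u : E, mlieBracket 𝓘(ℝ, E) (fun x : G => leftTr x u) (fun x => leftTr x (f x)) a =
      leftL a (Df (leftL a u) + brk G u (f a)) := by
    intro u
    rw [mlieBracket_leftTr_right hf _ e]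
    simp only [hc]
    refine (congrArg (leftL a (Df (leftL a u)) + ·)
      (h3 ((leftL a).toLinearMap ∘ₗ adL G u) (f a))).trans ?_
    exact (map_add (leftL a) _ _).symm
  -- The value is put into the form of a linear map applied to `u`, so that the sum over the basis
  -- can be collected by `h3`.
  have h2 : ∀ u : E, mlieBracket 𝓘(ℝ, E) (fun x => leftTr x (f x)) (fun x : G => leftTr x u) a =
      ((leftL a).toLinearMap ∘ₗ (-(Df.toLinearMap ∘ₗ (leftL a).toLinearMap) + adL G (f a))) u := by
    intro u
    have aux : ∀ x y : E, -leftL a (x + y) = leftL a (-x + -y) := fun x y => by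
      rw [← map_neg, neg_add]
    rw [mlieBracket_swap_apply, h1]
    refine (aux _ _).trans ?_
    rw [brk_neg_swap]
    rfl
  rw [mlieBracket_leftTr_right hg _ e]
  simp only [h2]
  refine (congrArg (leftL a (Dg (leftL a (f a))) + ·) (h3 _ (g a))).trans ?_
  refine (map_add (leftL a) _ _).symm.trans (congrArg (leftL a) ?_)
  exact (by intro x y z; abel : ∀ x y z : E, x + (-y + z) = x - y + z) _ _ _
end

/-! ### Derivatives and brackets of the fields of type `λ` and `ρ`, for arbitrary endomorphisms `p`,
`p'`. -/

section
variable {E : Type*} [NormedAddCommGroup E] [NormedSpace ℝ E]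
  {G : Type*} [TopologicalSpace G] [ChartedSpace E G] [Group G] [LieGroup 𝓘(ℝ, E) ∞ G]

lemma AdL_inv_AdL (a : G) (V : E) : AdL a⁻¹ (AdL a V) = V := Ad_inv_Ad a V

lemma AdL_AdL_inv (a : G) (V : E) : AdL a (AdL a⁻¹ V) = V := Ad_Ad_inv a V

lemma AdL_injective (a : G) : Function.Injective (AdL (E := E) a) :=
  Function.LeftInverse.injective (AdL_inv_AdL a)

/-- The product rule for the evaluation pairing, with the derivative of `Ad` already known. -/
lemma HasD.AdL_apply {f : G → E} {a : G} {Df D : E →L[ℝ] E} (hf : HasD 𝓘(ℝ, E) 𝓘(ℝ, E) f a Df)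
    (hD : HasD 𝓘(ℝ, E) 𝓘(ℝ, E) (fun x => AdL x (f x)) a D) (X : E) :
    D (leftL a X) = AdL a (brk G X (f a) + Df (leftL a X)) := by
  obtain ⟨A, hA⟩ : ∃ A : E →L[ℝ] E →L[ℝ] E, HasD 𝓘(ℝ, E) 𝓘(ℝ, E →L[ℝ] E) (AdL (E := E) (G := G)) a A :=
    ⟨_, contMDiff_AdL.contMDiffAt.hasD⟩
  have h1 : HasD 𝓘(ℝ, (E →L[ℝ] E) × E) 𝓘(ℝ, E) (fun p : (E →L[ℝ] E) × E => p.1 p.2)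
      (AdL a, f a) _ :=
    ((isBoundedBilinearMap_apply (𝕜 := ℝ) (E := E) (F := E)).hasFDerivAt _).hasMFDerivAt
  have h2 : HasD 𝓘(ℝ, E) 𝓘(ℝ, (E →L[ℝ] E) × E) (fun x => (AdL (E := E) x, f x)) a
      (A.prod Df) := by
    rw [modelWithCornersSelf_prod, ← chartedSpaceSelf_prod]
    exact hA.prodMk hf
  have h3 : HasD 𝓘(ℝ, E) 𝓘(ℝ, E) (fun x => AdL x (f a)) a
      ((ContinuousLinearMap.apply ℝ E (f a)).comp A) :=
    (hasD_clm (ContinuousLinearMap.apply ℝ E (f a)) _).comp hA rfl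
  rw [hD.unique (h1.comp h2 rfl), map_add, ← hasD_AdL_apply_leftL a X (f a) h3]
  exact add_comm _ _

lemma contMDiff_AdL_inv_apply (B : E) :
    ContMDiff 𝓘(ℝ, E) 𝓘(ℝ, E) ∞ (fun a : G => AdL a⁻¹ B) :=
  (contMDiff_AdL_apply B).comp (contMDiff_inv 𝓘(ℝ, E) ∞)

/-- The product rule applied to the constant function `Ad(x) Ad(x⁻¹) B = B`. -/
lemma hasD_AdL_inv_apply_leftL (a : G) (V B : E) {D : E →L[ℝ] E}
    (hD : HasD 𝓘(ℝ, E) 𝓘(ℝ, E) (fun a : G => AdL a⁻¹ B) a D) :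
    D (leftL a V) = -brk G V (AdL a⁻¹ B) := by
  have h := hD.AdL_apply (D := 0) (by simpa only [AdL_AdL_inv] using hasD_const B a) V
  have h' := AdL_injective a (h.symm.trans (map_zero (AdL a)).symm)
  exact (neg_eq_of_add_eq_zero_right h').symm

/-- The vector field `a ↦ -p(Ad(a)B)a`, in the left trivialization. -/
noncomputable def lamField (p : E →L[ℝ] E) (B : E) (a : G) : E := -AdL a⁻¹ (p (AdL a B))

/-- The vector field `a ↦ -a p(Ad(a⁻¹)B)`, in the left trivialization. -/
noncomputable def rhoField (p : E →L[ℝ] E) (B : E) (a : G) : E := -p (AdL a⁻¹ B)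

lemma contMDiff_lamField (p : E →L[ℝ] E) (B : E) :
    ContMDiff 𝓘(ℝ, E) 𝓘(ℝ, E) ∞ (lamField (G := G) p B) := by
  have h : ContMDiff 𝓘(ℝ, E) 𝓘(ℝ, E →L[ℝ] E) ∞ (fun a : G => AdL (E := E) a⁻¹) :=
    contMDiff_AdL.comp (contMDiff_inv 𝓘(ℝ, E) ∞)
  exact (h.clm_apply (p.contMDiff.comp (contMDiff_AdL_apply B))).neg

lemma contMDiff_rhoField (p : E →L[ℝ] E) (B : E) :
    ContMDiff 𝓘(ℝ, E) 𝓘(ℝ, E) ∞ (rhoField (G := G) p B) :=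
  (p.contMDiff.comp (contMDiff_AdL_inv_apply B)).neg

lemma AdL_lamField (p : E →L[ℝ] E) (B : E) (a : G) : AdL a (lamField p B a) = -p (AdL a B) := by
  rw [lamField, map_neg, AdL_AdL_inv]

/-- The product rule is applied to `Ad(x)` times the field, which equals `-p(Ad(x)B)`; this avoids
differentiating `Ad(x⁻¹)`. -/
lemma hasD_lamField (p : E →L[ℝ] E) (B : E) (a : G) {D : E →L[ℝ] E}
    (hD : HasD 𝓘(ℝ, E) 𝓘(ℝ, E) (lamField p B) a D) (X : E) :
    AdL a (D (leftL a X)) = -p (AdL a (brk G X B)) - AdL a (brk G X (lamField p B a)) := by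
  obtain ⟨A, hA⟩ : ∃ A : E →L[ℝ] E, HasD 𝓘(ℝ, E) 𝓘(ℝ, E) (fun x : G => AdL x B) a A :=
    ⟨_, (contMDiff_AdL_apply B).contMDiffAt.hasD⟩
  have h1 : HasD 𝓘(ℝ, E) 𝓘(ℝ, E) (fun x : G => AdL x (lamField p B x)) a ((-p).comp A) := by
    simp only [AdL_lamField]
    exact (hasD_clm (-p) _).comp hA rfl
  have h2 := hD.AdL_apply h1 X
  rw [map_add] at h2
  rw [eq_sub_iff_add_eq, add_comm, ← h2, ← hasD_AdL_apply_leftL a X B hA]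
  rfl

lemma hasD_rhoField (p : E →L[ℝ] E) (B : E) (a : G) {D : E →L[ℝ] E}
    (hD : HasD 𝓘(ℝ, E) 𝓘(ℝ, E) (rhoField p B) a D) (X : E) :
    D (leftL a X) = p (brk G X (AdL a⁻¹ B)) := by
  obtain ⟨A, hA⟩ : ∃ A : E →L[ℝ] E, HasD 𝓘(ℝ, E) 𝓘(ℝ, E) (fun x : G => AdL x⁻¹ B) a A :=
    ⟨_, (contMDiff_AdL_inv_apply B).contMDiffAt.hasD⟩
  rw [hD.unique ((hasD_clm (-p) _).comp hA rfl)]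
  refine (congrArg (-p) (hasD_AdL_inv_apply_leftL a X B hA)).trans ?_
  simp

variable [FiniteDimensional ℝ E]

lemma mlieBracket_rhoField (p p' : E →L[ℝ] E) (B B' : E) (a : G) :
    mlieBracket 𝓘(ℝ, E) (fun x : G => leftTr x (rhoField (E := E) p B x))
      (fun x => leftTr x (rhoField (E := E) p' B' x)) a =
    leftL a (-(p' (brk G (p (AdL a⁻¹ B)) (AdL a⁻¹ B')) - p (brk G (p' (AdL a⁻¹ B')) (AdL a⁻¹ B)) -
      brk G (p (AdL a⁻¹ B)) (p' (AdL a⁻¹ B')))) := by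
  have : CompleteSpace E := FiniteDimensional.complete ℝ E
  obtain ⟨D, hD⟩ : ∃ A : E →L[ℝ] E, HasD 𝓘(ℝ, E) 𝓘(ℝ, E) (rhoField (G := G) p B) a A :=
    ⟨_, (contMDiff_rhoField p B).contMDiffAt.hasD⟩
  obtain ⟨D', hD'⟩ : ∃ A : E →L[ℝ] E, HasD 𝓘(ℝ, E) 𝓘(ℝ, E) (rhoField (G := G) p' B') a A :=
    ⟨_, (contMDiff_rhoField p' B').contMDiffAt.hasD⟩
  rw [mlieBracket_leftTr hD hD', hasD_rhoField p B a hD, hasD_rhoField p' B' a hD']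
  congr 1
  simp only [rhoField, brk_neg_left, brk_neg_right, map_neg]
  abel

lemma mlieBracket_lamField (p p' : E →L[ℝ] E) (B B' : E) (a : G) :
    mlieBracket 𝓘(ℝ, E) (fun x : G => leftTr x (lamField (E := E) p B x))
      (fun x => leftTr x (lamField (E := E) p' B' x)) a =
    leftL a (AdL a⁻¹ (p' (brk G (p (AdL a B)) (AdL a B')) - p (brk G (p' (AdL a B')) (AdL a B)) -
      brk G (p (AdL a B)) (p' (AdL a B')))) := by
  have : CompleteSpace E := FiniteDimensional.complete ℝ E
  obtain ⟨D, hD⟩ : ∃ A : E →L[ℝ] E, HasD 𝓘(ℝ, E) 𝓘(ℝ, E) (lamField (G := G) p B) a A :=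
    ⟨_, (contMDiff_lamField p B).contMDiffAt.hasD⟩
  obtain ⟨D', hD'⟩ : ∃ A : E →L[ℝ] E, HasD 𝓘(ℝ, E) 𝓘(ℝ, E) (lamField (G := G) p' B') a A :=
    ⟨_, (contMDiff_lamField p' B').contMDiffAt.hasD⟩
  rw [mlieBracket_leftTr hD hD']
  congr 1
  -- Derivatives of `lamField` are known only after applying `Ad a`, so the two sides are compared
  -- there; `Ad a` distributes over the brackets.
  apply AdL_injective a
  rw [AdL_AdL_inv, map_add, map_sub, hasD_lamField p B a hD, hasD_lamField p' B' a hD']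
  simp only [AdL_brk, AdL_lamField, brk_neg_left, brk_neg_right, map_neg]
  rw [← brk_neg_swap (p' (AdL a B'))]
  abel
end

/-! ### Two identities for the projections of a Lie algebra onto complementary subalgebras. -/

section Algebra
variable {L : Type*} [LieRing L] [LieAlgebra ℝ L] {g h : LieSubalgebra ℝ L}

lemma projection_add_projection (hc : IsCompl g.toSubmodule h.toSubmodule) (x : L) :
    g.toSubmodule.projection h.toSubmodule hc x +
      h.toSubmodule.projection g.toSubmodule hc.symm x = x := by
  have := Submodule.projection_add_projection_eq_self hc x
  exact this

/-- With `p`, `q` the projections, split `x = p x + q x` and `y = p y + q y`. Here `⁅p x, p y⁆` lies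
in `g` and is fixed by `p`, while `⁅q x, q y⁆` lies in `h` and is killed by `p`; the mixed terms
agree on both sides. -/
lemma projection_bracket_self (hc : IsCompl g.toSubmodule h.toSubmodule) (x y : L) :
    g.toSubmodule.projection h.toSubmodule hc ⁅g.toSubmodule.projection h.toSubmodule hc x, y⁆ -
      g.toSubmodule.projection h.toSubmodule hc ⁅g.toSubmodule.projection h.toSubmodule hc y, x⁆ -
      ⁅g.toSubmodule.projection h.toSubmodule hc x, g.toSubmodule.projection h.toSubmodule hc y⁆ =
    g.toSubmodule.projection h.toSubmodule hc ⁅x, y⁆ := by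
  have hp : ⁅g.toSubmodule.projection h.toSubmodule hc x,
      g.toSubmodule.projection h.toSubmodule hc y⁆ ∈ g :=
    g.lie_mem (Submodule.projection_apply_mem hc x) (Submodule.projection_apply_mem hc y)
  have hq : ⁅h.toSubmodule.projection g.toSubmodule hc.symm x,
      h.toSubmodule.projection g.toSubmodule hc.symm y⁆ ∈ h :=
    h.lie_mem (Submodule.projection_apply_mem hc.symm x) (Submodule.projection_apply_mem hc.symm y)
  have hp' := Submodule.projection_apply_of_mem_left hc hp
  have hq' := Submodule.projection_apply_of_mem_right hc hq
  have hx := projection_add_projection hc x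
  have hy := projection_add_projection hc y
  generalize g.toSubmodule.projection h.toSubmodule hc = p at *
  generalize h.toSubmodule.projection g.toSubmodule hc.symm = q at *
  have e1 : ⁅p x, y⁆ = ⁅p x, p y⁆ + ⁅p x, q y⁆ := by rw [← lie_add, hy]
  have e2 : ⁅p y, x⁆ = -⁅p x, p y⁆ - ⁅q x, p y⁆ := by
    rw [← lie_skew, ← hx, add_lie, hx, neg_add, sub_eq_add_neg]
  have e3 : ⁅x, y⁆ = ⁅p x, p y⁆ + ⁅p x, q y⁆ + (⁅q x, p y⁆ + ⁅q x, q y⁆) := by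
    rw [← lie_add, ← lie_add, hy, ← add_lie, hx]
  rw [e1, e2, e3]
  simp only [map_add, map_sub, map_neg, hp', hq']
  abel

/-- After the same splitting, `q` kills `⁅p x, p y⁆` and `p` kills `⁅q x, q y⁆`; only `(p + q) ⁅p x,
q y⁆ - ⁅p x, q y⁆` is left. -/
lemma projection_bracket_compl (hc : IsCompl g.toSubmodule h.toSubmodule) (x y : L) :
    h.toSubmodule.projection g.toSubmodule hc.symm ⁅g.toSubmodule.projection h.toSubmodule hc x, y⁆ -
      g.toSubmodule.projection h.toSubmodule hc
        ⁅h.toSubmodule.projection g.toSubmodule hc.symm y, x⁆ -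
      ⁅g.toSubmodule.projection h.toSubmodule hc x,
        h.toSubmodule.projection g.toSubmodule hc.symm y⁆ = 0 := by
  have hp : ⁅g.toSubmodule.projection h.toSubmodule hc x,
      g.toSubmodule.projection h.toSubmodule hc y⁆ ∈ g :=
    g.lie_mem (Submodule.projection_apply_mem hc x) (Submodule.projection_apply_mem hc y)
  have hq : ⁅h.toSubmodule.projection g.toSubmodule hc.symm x,
      h.toSubmodule.projection g.toSubmodule hc.symm y⁆ ∈ h :=
    h.lie_mem (Submodule.projection_apply_mem hc.symm x) (Submodule.projection_apply_mem hc.symm y)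
  have hp' := Submodule.projection_apply_of_mem_right hc.symm hp
  have hq' := Submodule.projection_apply_of_mem_right hc hq
  have hx := projection_add_projection hc x
  have hy := projection_add_projection hc y
  have hxy := projection_add_projection hc ⁅g.toSubmodule.projection h.toSubmodule hc x,
    h.toSubmodule.projection g.toSubmodule hc.symm y⁆
  generalize g.toSubmodule.projection h.toSubmodule hc = p at *
  generalize h.toSubmodule.projection g.toSubmodule hc.symm = q at *
  have e1 : ⁅p x, y⁆ = ⁅p x, p y⁆ + ⁅p x, q y⁆ := by rw [← lie_add, hy]
  have e2 : ⁅q y, x⁆ = -⁅p x, q y⁆ - ⁅q x, q y⁆ := by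
    rw [← lie_skew, ← hx, add_lie, hx, neg_add, sub_eq_add_neg]
  rw [e1, e2]
  simp only [map_add, map_sub, map_neg, hp', hq']
  refine Eq.trans ?_ (sub_eq_zero.2 hxy)
  abel
end Algebra

/-! ### Existence of local factorizations. -/

section Factorization
variable {E : Type*} [NormedAddCommGroup E] [NormedSpace ℝ E] [FiniteDimensional ℝ E]
  {G : Type*} [TopologicalSpace G] [ChartedSpace E G] [Group G] [LieGroup 𝓘(ℝ, E) ∞ G]
  {E₁ : Type*} [NormedAddCommGroup E₁] [NormedSpace ℝ E₁]
  {K₁ : Type*} [TopologicalSpace K₁] [ChartedSpace E₁ K₁] [Group K₁]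
  {E₂ : Type*} [NormedAddCommGroup E₂] [NormedSpace ℝ E₂]
  {K₂ : Type*} [TopologicalSpace K₂] [ChartedSpace E₂ K₂] [Group K₂]
  {j₁ : K₁ →* G} {j₂ : K₂ →* G} {g h : LieSubalgebra ℝ (GroupLieAlgebra 𝓘(ℝ, E) G)}

lemma IsLieSubgroup.hasD (hj : IsLieSubgroup (E := E) (E₁ := E₁) j₁ g) :
    HasD 𝓘(ℝ, E₁) 𝓘(ℝ, E) (fun k : K₁ => j₁ k) 1 (lieMap (E := E) (E₁ := E₁) j₁ : E₁ →L[ℝ] E) :=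
  hj.smooth.contMDiffAt.hasD

lemma contMDiff_mul_of_isLieSubgroup (h₁ : IsLieSubgroup (E := E) (E₁ := E₁) j₁ g)
    (h₂ : IsLieSubgroup (E := E) (E₁ := E₂) j₂ h) :
    ContMDiff (𝓘(ℝ, E₁).prod 𝓘(ℝ, E₂)) 𝓘(ℝ, E) ∞ (fun k : K₁ × K₂ => j₁ k.1 * j₂ k.2) :=
  (h₁.smooth.comp contMDiff_fst).mul (h₂.smooth.comp contMDiff_snd)

lemma hasD_mul_of_isLieSubgroup (h₁ : IsLieSubgroup (E := E) (E₁ := E₁) j₁ g)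
    (h₂ : IsLieSubgroup (E := E) (E₁ := E₂) j₂ h) :
    HasD (𝓘(ℝ, E₁).prod 𝓘(ℝ, E₂)) 𝓘(ℝ, E) (fun k : K₁ × K₂ => j₁ k.1 * j₂ k.2) (1, 1)
      ((lieMap (E := E) (E₁ := E₁) j₁ : E₁ →L[ℝ] E).coprod
        (lieMap (E := E) (E₁ := E₂) j₂ : E₂ →L[ℝ] E)) := by
  refine (contMDiff_mul_of_isLieSubgroup h₁ h₂).contMDiffAt.hasD_prod ?_ ?_
  · simpa using h₁.hasD
  · simpa using h₂.hasD

/-- Both tangent maps are injective and their images `g` and `h` are complementary. -/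
lemma bijective_lieMap_coprod (h₁ : IsLieSubgroup (E := E) (E₁ := E₁) j₁ g)
    (h₂ : IsLieSubgroup (E := E) (E₁ := E₂) j₂ h) (hc : IsCompl g.toSubmodule h.toSubmodule) :
    Function.Bijective ((lieMap (E := E) (E₁ := E₁) j₁ : E₁ →L[ℝ] E).coprod
        (lieMap (E := E) (E₁ := E₂) j₂ : E₂ →L[ℝ] E)) := by
  have hm₁ : ∀ ξ : E₁, lieMap (E := E) (E₁ := E₁) j₁ ξ ∈ g := fun ξ => by
    rw [← SetLike.mem_coe, ← h₁.range_eq]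
    exact Set.mem_range_self _
  have hm₂ : ∀ ξ : E₂, lieMap (E := E) (E₁ := E₂) j₂ ξ ∈ h := fun ξ => by
    rw [← SetLike.mem_coe, ← h₂.range_eq]
    exact Set.mem_range_self _
  constructor
  · refine (injective_iff_map_eq_zero _).2 ?_
    rintro ⟨ξ, η⟩ h0
    have h0 : lieMap (E := E) (E₁ := E₁) j₁ ξ + lieMap (E := E) (E₁ := E₂) j₂ η = 0 := h0
    have h1 : lieMap (E := E) (E₁ := E₁) j₁ ξ = 0 := by
      have h2 : lieMap (E := E) (E₁ := E₁) j₁ ξ ∈ h := by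
        rw [eq_neg_of_add_eq_zero_left h0]
        exact h.neg_mem (hm₂ η)
      exact Submodule.disjoint_def.1 hc.disjoint _ (hm₁ ξ) h2
    rw [h1, zero_add] at h0
    have e1 : ξ = 0 := h₁.immersion (h1.trans (map_zero _).symm)
    have e2 : η = 0 := h₂.immersion (h0.trans (map_zero _).symm)
    rw [e1, e2]
    rfl
  · intro v
    obtain ⟨x, hx, y, hy, hxy⟩ := Submodule.mem_sup.1
      (hc.sup_eq_top ▸ Submodule.mem_top : (v : GroupLieAlgebra 𝓘(ℝ, E) G) ∈
        g.toSubmodule ⊔ h.toSubmodule)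
    have hx : x ∈ Set.range (lieMap (E := E) (E₁ := E₁) j₁) := by rw [h₁.range_eq]; exact hx
    have hy : y ∈ Set.range (lieMap (E := E) (E₁ := E₂) j₂) := by rw [h₂.range_eq]; exact hy
    obtain ⟨ξ, rfl⟩ := hx
    obtain ⟨η, rfl⟩ := hy
    exact ⟨(ξ, η), hxy⟩

/-- The inverse function theorem at `(1, 1)`, applied in charts, with the derivative found above. -/
theorem exists_isLocalFactorization [FiniteDimensional ℝ E₁] [FiniteDimensional ℝ E₂]
    [IsManifold 𝓘(ℝ, E₁) ∞ K₁] [IsManifold 𝓘(ℝ, E₂) ∞ K₂]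
    (h₁ : IsLieSubgroup (E := E) (E₁ := E₁) j₁ g)
    (h₂ : IsLieSubgroup (E := E) (E₁ := E₂) j₂ h) (hc : IsCompl g.toSubmodule h.toSubmodule) :
    ∃ Φ : OpenPartialHomeomorph (K₁ × K₂) G,
      IsLocalFactorization (E := E) (E₁ := E₁) (E₂ := E₂) j₁ j₂ Φ := by
  let f : K₁ × K₂ → G := fun k => j₁ k.1 * j₂ k.2
  have hf : ContMDiff (𝓘(ℝ, E₁).prod 𝓘(ℝ, E₂)) 𝓘(ℝ, E) ∞ f := contMDiff_mul_of_isLieSubgroup h₁ h₂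
  let c := (chartAt E₁ (1 : K₁)).prod (chartAt E₂ (1 : K₂))
  let d := chartAt E (1 : G)
  let F : E₁ × E₂ → E := fun x => d (f (c.symm x))
  have hcs : ∀ x ∈ c.target, ContMDiffAt 𝓘(ℝ, E₁ × E₂) (𝓘(ℝ, E₁).prod 𝓘(ℝ, E₂)) ∞ c.symm x := by
    intro x hx
    have a1 : ContMDiffAt 𝓘(ℝ, E₁) 𝓘(ℝ, E₁) ∞ (chartAt E₁ (1 : K₁)).symm x.1 :=
      (contMDiffOn_chart_symm).contMDiffAt ((chartAt E₁ (1 : K₁)).open_target.mem_nhds hx.1)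
    have a2 : ContMDiffAt 𝓘(ℝ, E₂) 𝓘(ℝ, E₂) ∞ (chartAt E₂ (1 : K₂)).symm x.2 :=
      (contMDiffOn_chart_symm).contMDiffAt ((chartAt E₂ (1 : K₂)).open_target.mem_nhds hx.2)
    exact (ContMDiffAt.comp (I := 𝓘(ℝ, E₁ × E₂)) x a1 contDiff_fst.contMDiff.contMDiffAt).prodMk
      (ContMDiffAt.comp (I := 𝓘(ℝ, E₁ × E₂)) x a2 contDiff_snd.contMDiff.contMDiffAt)
  have hd : ∀ y ∈ d.source, ContMDiffAt 𝓘(ℝ, E) 𝓘(ℝ, E) ∞ d y := fun y hy =>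
    (contMDiffOn_chart).contMDiffAt (d.open_source.mem_nhds hy)
  let S : Set (E₁ × E₂) := c.target ∩ c.symm ⁻¹' (f ⁻¹' d.source)
  have hS : IsOpen S := c.isOpen_inter_preimage_symm (d.open_source.preimage hf.continuous)
  have hF : ∀ x ∈ S, ContDiffAt ℝ ∞ F x := fun x hx =>
    contMDiffAt_iff_contDiffAt.1 <|
      ((hd _ hx.2).comp x ((hf _).comp x (hcs x hx.1)) : ContMDiffAt 𝓘(ℝ, E₁ × E₂) 𝓘(ℝ, E) ∞ _ x)
  -- The points at which the derivative is invertible form an open set. Restricting to it makes the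
  -- local inverse smooth on its whole domain and not only at the image of `x₀`.
  let U : Set (E₁ × E₂) := S ∩ (fderiv ℝ F) ⁻¹' Set.range ((↑) : ((E₁ × E₂) ≃L[ℝ] E) → ((E₁ × E₂) →L[ℝ] E))
  have hU : IsOpen U := by
    refine ContinuousOn.isOpen_inter_preimage ?_ hS ContinuousLinearEquiv.isOpen
    intro x hx
    exact ((hF x hx).fderiv_right (m := 0) (by simp)).continuousAt.continuousWithinAt
  let x₀ : E₁ × E₂ := c (1, 1)
  have h1c : ((1, 1) : K₁ × K₂) ∈ c.source := ⟨mem_chart_source E₁ _, mem_chart_source E₂ _⟩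
  have hx₀ : c.symm x₀ = (1, 1) := c.left_inv h1c
  have hf1 : f (1, 1) = 1 := by simp [f]
  have hx₀S : x₀ ∈ S := ⟨c.map_source h1c, by
    simp only [Set.mem_preimage, hx₀, hf1]
    exact mem_chart_source E _⟩
  obtain ⟨L, hL⟩ : ∃ L : (E₁ × E₂) ≃L[ℝ] E, HasFDerivAt F (L : (E₁ × E₂) →L[ℝ] E) x₀ := by
    have b1 := hasD_chartAt_symm_self (E := E₁) (1 : K₁)
    have b2 := hasD_chartAt_symm_self (E := E₂) (1 : K₂)
    have b3 := (b1.comp (I := 𝓘(ℝ, E₁ × E₂)) (hasD_clm (.fst ℝ E₁ E₂) x₀) rfl).prodMk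
      (b2.comp (I := 𝓘(ℝ, E₁ × E₂)) (hasD_clm (.snd ℝ E₁ E₂) x₀) rfl)
    have b4 := (hasD_mul_of_isLieSubgroup h₁ h₂).comp b3 hx₀
    have b5 := (hasD_chartAt_self (E := E) (1 : G)).comp b4 ((congrArg f hx₀).trans hf1)
    refine ⟨ContinuousLinearEquiv.ofBijective _ (LinearMap.ker_eq_bot.2
      (bijective_lieMap_coprod h₁ h₂ hc).1) (LinearMap.range_eq_top.2
      (bijective_lieMap_coprod h₁ h₂ hc).2), ?_⟩
    exact HasMFDerivAt.hasFDerivAt b5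
  let T := (hF x₀ hx₀S).toOpenPartialHomeomorph F hL (by simp)
  have hT : ∀ x, T x = F x := fun x => rfl
  let T' := T.restrOpen U hU
  let Φ := c.trans (T'.trans d.symm)
  have hΦs : ∀ k ∈ Φ.source, k ∈ c.source ∧ c k ∈ U := fun k hk => ⟨hk.1, hk.2.1.2⟩
  have hΦ : ∀ k ∈ Φ.source, Φ k = f k := by
    intro k hk
    have h2 := hΦs k hk
    have h3 : f k ∈ d.source := by
      have := h2.2.1.2
      simpa only [Set.mem_preimage, c.left_inv h2.1] using this
    show d.symm (d (f (c.symm (c k)))) = f k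
    rw [c.left_inv h2.1, d.left_inv h3]
  have hx₀U : x₀ ∈ U := ⟨hx₀S, by rw [Set.mem_preimage, hL.fderiv]; exact ⟨L, rfl⟩⟩
  have hTx₀ : x₀ ∈ T.source := (hF x₀ hx₀S).mem_toOpenPartialHomeomorph_source hL (by simp)
  refine ⟨Φ, ?_, hΦ, hf.contMDiffOn.congr hΦ, ?_⟩
  · refine ⟨h1c, ⟨hTx₀, hx₀U⟩, ?_⟩
    refine d.map_source ?_
    exact hx₀S.2
  · intro y hy
    have hy1 : y ∈ d.source := hy.1.1
    have hy2 : d y ∈ T.target := hy.1.2.1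
    have hy3 : T.symm (d y) ∈ U := hy.1.2.2
    have hy4 : T.symm (d y) ∈ c.target := hy3.1.1
    obtain ⟨L', hL'⟩ := hy3.2
    have e1 : ContDiffAt ℝ ∞ T.symm (d y) := by
      refine T.contDiffAt_symm (f₀' := L') hy2 ?_ (hF _ hy3.1)
      rw [hL']
      exact ((hF _ hy3.1).differentiableAt (by simp)).hasFDerivAt
    exact ((hcs _ hy4).comp y (e1.contMDiffAt.comp y (hd y hy1))).contMDiffWithinAt
end Factorization

/-! ### The local projections and their derivatives at the unit. -/

section Algebra
variable {L : Type*} [LieRing L] [LieAlgebra ℝ L] {g h : LieSubalgebra ℝ L}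

lemma projection_add_eq_left (hc : IsCompl g.toSubmodule h.toSubmodule) {x y : L} (hx : x ∈ g)
    (hy : y ∈ h) : g.toSubmodule.projection h.toSubmodule hc (x + y) = x := by
  rw [map_add, Submodule.projection_apply_of_mem_left hc hx,
    Submodule.projection_apply_of_mem_right hc hy, add_zero]
end Algebra

section Factors
variable {E : Type*} [NormedAddCommGroup E] [NormedSpace ℝ E] [FiniteDimensional ℝ E]
  {G : Type*} [TopologicalSpace G] [ChartedSpace E G] [Group G] [LieGroup 𝓘(ℝ, E) ∞ G]
  {E₁ : Type*} [NormedAddCommGroup E₁] [NormedSpace ℝ E₁]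
  {K₁ : Type*} [TopologicalSpace K₁] [ChartedSpace E₁ K₁] [Group K₁]
  {E₂ : Type*} [NormedAddCommGroup E₂] [NormedSpace ℝ E₂]
  {K₂ : Type*} [TopologicalSpace K₂] [ChartedSpace E₂ K₂] [Group K₂]
  {j₁ : K₁ →* G} {j₂ : K₂ →* G} {g h : LieSubalgebra ℝ (GroupLieAlgebra 𝓘(ℝ, E) G)}
  {Φ : OpenPartialHomeomorph (K₁ × K₂) G}

/-- The projection onto `g` along `h`, as an endomorphism of the model space. -/
noncomputable def projL (hc : IsCompl g.toSubmodule h.toSubmodule) : E →L[ℝ] E :=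
  LinearMap.toContinuousLinearMap (E := E) (F' := E) (g.toSubmodule.projection h.toSubmodule hc)

lemma IsLieSubgroup.lieMap_mem (hj : IsLieSubgroup (E := E) (E₁ := E₁) j₁ g) (ξ : E₁) :
    lieMap (E := E) (E₁ := E₁) j₁ ξ ∈ g := by
  rw [← SetLike.mem_coe, ← hj.range_eq]
  exact Set.mem_range_self _

section
omit [FiniteDimensional ℝ E] [LieGroup 𝓘(ℝ, E) ∞ G]
variable (hΦ : IsLocalFactorization (E := E) (E₁ := E₁) (E₂ := E₂) j₁ j₂ Φ)
include hΦ

lemma IsLocalFactorization.apply_one : Φ (1, 1) = 1 := by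
  rw [hΦ.eq_mul _ hΦ.unit_mem]
  simp

lemma IsLocalFactorization.one_mem_target : (1 : G) ∈ Φ.target :=
  hΦ.apply_one ▸ Φ.map_source hΦ.unit_mem

lemma IsLocalFactorization.symm_one : Φ.symm 1 = (1, 1) := by
  rw [← hΦ.apply_one, Φ.left_inv hΦ.unit_mem]

lemma IsLocalFactorization.leftFactor_one : leftFactor j₁ Φ 1 = 1 := by
  simp [leftFactor, hΦ.symm_one]

lemma IsLocalFactorization.rightFactor_one : rightFactor j₂ Φ 1 = 1 := by
  simp [rightFactor, hΦ.symm_one]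

lemma IsLocalFactorization.mul_eq {x : G} (hx : x ∈ Φ.target) :
    j₁ (Φ.symm x).1 * j₂ (Φ.symm x).2 = x := by
  rw [← hΦ.eq_mul _ (Φ.map_target hx), Φ.right_inv hx]

lemma IsLocalFactorization.contMDiffAt_symm {x : G} (hx : x ∈ Φ.target) :
    ContMDiffAt 𝓘(ℝ, E) (𝓘(ℝ, E₁).prod 𝓘(ℝ, E₂)) ∞ Φ.symm x :=
  hΦ.smooth_symm.contMDiffAt (Φ.open_target.mem_nhds hx)

end

lemma contMDiffAt_leftFactor (hΦ : IsLocalFactorization (E := E) (E₁ := E₁) (E₂ := E₂) j₁ j₂ Φ)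
    (h₁ : IsLieSubgroup (E := E) (E₁ := E₁) j₁ g) {x : G} (hx : x ∈ Φ.target) :
    ContMDiffAt 𝓘(ℝ, E) 𝓘(ℝ, E) ∞ (leftFactor j₁ Φ) x :=
  h₁.smooth.contMDiffAt.comp x (contMDiffAt_fst.comp x (hΦ.contMDiffAt_symm hx))

lemma contMDiffAt_rightFactor (hΦ : IsLocalFactorization (E := E) (E₁ := E₁) (E₂ := E₂) j₁ j₂ Φ)
    (h₂ : IsLieSubgroup (E := E) (E₁ := E₂) j₂ h) {x : G} (hx : x ∈ Φ.target) :
    ContMDiffAt 𝓘(ℝ, E) 𝓘(ℝ, E) ∞ (rightFactor j₂ Φ) x :=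
  h₂.smooth.contMDiffAt.comp x (contMDiffAt_snd.comp x (hΦ.contMDiffAt_symm hx))

/-- The derivatives at the unit of the two local projections are the projections of the Lie
algebra. -/
lemma hasD_factors (hΦ : IsLocalFactorization (E := E) (E₁ := E₁) (E₂ := E₂) j₁ j₂ Φ)
    (h₁ : IsLieSubgroup (E := E) (E₁ := E₁) j₁ g) (h₂ : IsLieSubgroup (E := E) (E₁ := E₂) j₂ h)
    (hc : IsCompl g.toSubmodule h.toSubmodule) :
    HasD 𝓘(ℝ, E) 𝓘(ℝ, E) (leftFactor j₁ Φ) 1 (projL hc) ∧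
      HasD 𝓘(ℝ, E) 𝓘(ℝ, E) (rightFactor j₂ Φ) 1 (projL hc.symm) := by
  obtain ⟨S, hS⟩ : ∃ S : E →L[ℝ] (E₁ × E₂),
      HasD 𝓘(ℝ, E) (𝓘(ℝ, E₁).prod 𝓘(ℝ, E₂)) Φ.symm 1 S :=
    ⟨_, (hΦ.contMDiffAt_symm hΦ.one_mem_target).hasD⟩
  have hl := h₁.hasD.comp ((hasD_fst _).comp hS hΦ.symm_one) (by rw [hΦ.symm_one])
  have hr := h₂.hasD.comp ((hasD_snd _).comp hS hΦ.symm_one) (by rw [hΦ.symm_one])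
  -- Near `1` the product of the two factors is the identity, so their derivatives add up to the
  -- identity. As these take values in `g` and `h`, they must be the projections.
  have hm := (hl.mul hr (by simp [hΦ.symm_one]) (by simp [hΦ.symm_one])).unique
    ((hasD_id 1).congr (by
      filter_upwards [Φ.open_target.mem_nhds hΦ.one_mem_target] with x hx
      exact hΦ.mul_eq hx))
  have hv : ∀ v : E, lieMap (E := E) (E₁ := E₁) j₁ (S v).1 +
      lieMap (E := E) (E₁ := E₂) j₂ (S v).2 = v := fun v => DFunLike.congr_fun hm v
  have e1 : ∀ v : E, lieMap (E := E) (E₁ := E₁) j₁ (S v).1 = projL hc v := fun v =>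
    (projection_add_eq_left hc (h₁.lieMap_mem _) (h₂.lieMap_mem _)).symm.trans
      (congrArg (projL hc) (hv v))
  have e2 : ∀ v : E, lieMap (E := E) (E₁ := E₂) j₂ (S v).2 = projL hc.symm v := fun v =>
    (projection_add_eq_left hc.symm (h₂.lieMap_mem _) (h₁.lieMap_mem _)).symm.trans
      (congrArg (projL hc.symm) ((add_comm _ _).trans (hv v)))
  constructor
  · convert! hl using 1
    exact ContinuousLinearMap.ext fun v => (e1 v).symm
  · convert! hr using 1
    exact ContinuousLinearMap.ext fun v => (e2 v).symm
end Factors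

/-! ### The moves `λ_b`, `ρ_b`: smoothness, generators and brackets. -/

section
variable {G : Type*} [Group G]

lemma leftMove_one {p : G → G} (hp : p 1 = 1) (a : G) : leftMove p 1 a = a := by
  simp [leftMove, hp]

lemma rightMove_one {p : G → G} (hp : p 1 = 1) (a : G) : rightMove p 1 a = a := by
  simp [rightMove, hp]
end

section Moves
variable {E : Type*} [NormedAddCommGroup E] [NormedSpace ℝ E]
  {G : Type*} [TopologicalSpace G] [ChartedSpace E G] [Group G] [LieGroup 𝓘(ℝ, E) ∞ G]

lemma contMDiffAt_leftMove {p : G → G} {b a : G}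
    (hp : ContMDiffAt 𝓘(ℝ, E) 𝓘(ℝ, E) ∞ p (a * b⁻¹ * a⁻¹)) :
    ContMDiffAt (𝓘(ℝ, E).prod 𝓘(ℝ, E)) 𝓘(ℝ, E) ∞ (fun q : G × G => leftMove p q.1 q.2) (b, a) := by
  have h : ContMDiff (𝓘(ℝ, E).prod 𝓘(ℝ, E)) 𝓘(ℝ, E) ∞ (fun q : G × G => q.2 * q.1⁻¹ * q.2⁻¹) :=
    (contMDiff_snd.mul contMDiff_fst.inv).mul contMDiff_snd.inv
  exact (ContMDiffAt.comp (b, a) hp h.contMDiffAt).mul contMDiffAt_snd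

lemma contMDiffAt_rightMove {p : G → G} {b a : G}
    (hp : ContMDiffAt 𝓘(ℝ, E) 𝓘(ℝ, E) ∞ p (a⁻¹ * b⁻¹ * a)) :
    ContMDiffAt (𝓘(ℝ, E).prod 𝓘(ℝ, E)) 𝓘(ℝ, E) ∞ (fun q : G × G => rightMove p q.1 q.2) (b, a) := by
  have h : ContMDiff (𝓘(ℝ, E).prod 𝓘(ℝ, E)) 𝓘(ℝ, E) ∞ (fun q : G × G => q.2⁻¹ * q.1⁻¹ * q.2) :=
    (contMDiff_snd.inv.mul contMDiff_fst.inv).mul contMDiff_snd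
  exact contMDiffAt_snd.mul (ContMDiffAt.comp (b, a) hp h.contMDiffAt)

lemma contMDiffAt_leftMove_one {p : G → G} (hp : ContMDiffAt 𝓘(ℝ, E) 𝓘(ℝ, E) ∞ p 1) (a : G) :
    ContMDiffAt 𝓘(ℝ, E) 𝓘(ℝ, E) ∞ (fun b => leftMove p b a) 1 :=
  (contMDiffAt_leftMove (b := 1) (a := a) (by simpa using hp)).comp (1 : G)
    (contMDiffAt_id.prodMk contMDiffAt_const)

lemma contMDiffAt_rightMove_one {p : G → G} (hp : ContMDiffAt 𝓘(ℝ, E) 𝓘(ℝ, E) ∞ p 1) (a : G) :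
    ContMDiffAt 𝓘(ℝ, E) 𝓘(ℝ, E) ∞ (fun b => rightMove p b a) 1 :=
  ContMDiffAt.comp (g := fun q : G × G => rightMove p q.1 q.2) (1 : G)
    (contMDiffAt_rightMove (b := 1) (a := a) (by simpa using hp))
    (contMDiffAt_id.prodMk contMDiffAt_const)

/-- The right translation, as an endomorphism of the model space. -/
noncomputable def rightL (a : G) : E →L[ℝ] E := rightTr (E := E) a

lemma hasD_conj_inv (a : G) : HasD 𝓘(ℝ, E) 𝓘(ℝ, E) (fun x : G => a * x⁻¹ * a⁻¹) 1
    ((AdL a).comp (-ContinuousLinearMap.id ℝ E)) :=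
  HasD.comp (hasD_Ad a) hasD_inv_one inv_one

lemma hasD_leftMove {p : G → G} {P : E →L[ℝ] E} (hp : HasD 𝓘(ℝ, E) 𝓘(ℝ, E) p 1 P) (hp1 : p 1 = 1)
    (a : G) : HasD 𝓘(ℝ, E) 𝓘(ℝ, E) (fun b => leftMove p b a) 1
      ((rightL a).comp (P.comp ((AdL a).comp (-ContinuousLinearMap.id ℝ E)))) :=
  (hasD_rightTr a).comp (hp.comp (hasD_conj_inv a) (by simp)) (by simpa using hp1)

lemma hasD_rightMove {p : G → G} {P : E →L[ℝ] E} (hp : HasD 𝓘(ℝ, E) 𝓘(ℝ, E) p 1 P) (hp1 : p 1 = 1)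
    (a : G) : HasD 𝓘(ℝ, E) 𝓘(ℝ, E) (fun b => rightMove p b a) 1
      ((leftL a).comp (P.comp ((AdL a⁻¹).comp (-ContinuousLinearMap.id ℝ E)))) := by
  have h := hasD_conj_inv (E := E) a⁻¹
  simp only [inv_inv] at h
  exact (hasD_leftTr a).comp (hp.comp h (by simp)) (by simpa using hp1)

lemma gen_leftMove {p : G → G} {P : E →L[ℝ] E} (hp : HasD 𝓘(ℝ, E) 𝓘(ℝ, E) p 1 P) (hp1 : p 1 = 1)
    (B : GroupLieAlgebra 𝓘(ℝ, E) G) (a : G) :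
    gen (leftMove p) B a = -rightTr a (P (Ad a B)) := by
  refine (DFunLike.congr_fun (hasD_leftMove hp hp1 a).mfderiv B).trans ?_
  have h : ∀ v : E, rightL a (P (AdL a (-v))) = -rightL a (P (AdL a v)) := fun v => by
    simp only [map_neg]
  exact h B

lemma gen_rightMove {p : G → G} {P : E →L[ℝ] E} (hp : HasD 𝓘(ℝ, E) 𝓘(ℝ, E) p 1 P) (hp1 : p 1 = 1)
    (B : GroupLieAlgebra 𝓘(ℝ, E) G) (a : G) :
    gen (rightMove p) B a = -leftTr a (P (Ad a⁻¹ B)) := by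
  refine (DFunLike.congr_fun (hasD_rightMove hp hp1 a).mfderiv B).trans ?_
  have h : ∀ v : E, leftL a (P (AdL a⁻¹ (-v))) = -leftL a (P (AdL a⁻¹ v)) := fun v => by
    simp only [map_neg]
  exact h B

/-- Passing from right to left translation costs a factor `Ad a⁻¹`, which is the one in `lamField`.
In this form the bracket formula for left-translated fields applies. -/
lemma gen_leftMove_eq_leftTr {p : G → G} {P : E →L[ℝ] E} (hp : HasD 𝓘(ℝ, E) 𝓘(ℝ, E) p 1 P)
    (hp1 : p 1 = 1) (B : GroupLieAlgebra 𝓘(ℝ, E) G) :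
    gen (leftMove p) B = fun a => leftTr a (lamField (E := E) P B a) := by
  funext a
  refine (gen_leftMove hp hp1 B a).trans ?_
  refine (congrArg Neg.neg (leftTr_Ad_inv a _).symm).trans ?_
  exact (map_neg (leftL a) (AdL a⁻¹ (P (AdL a B)))).symm

lemma gen_rightMove_eq_leftTr {p : G → G} {P : E →L[ℝ] E} (hp : HasD 𝓘(ℝ, E) 𝓘(ℝ, E) p 1 P)
    (hp1 : p 1 = 1) (B : GroupLieAlgebra 𝓘(ℝ, E) G) :
    gen (rightMove p) B = fun a => leftTr a (rhoField (E := E) P B a) := by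
  funext a
  refine (gen_rightMove hp hp1 B a).trans ?_
  exact (map_neg (leftL a) (P (AdL a⁻¹ B))).symm

lemma neg_gen_leftMove {p : G → G} {P : E →L[ℝ] E} (hp : HasD 𝓘(ℝ, E) 𝓘(ℝ, E) p 1 P)
    (hp1 : p 1 = 1) (B : GroupLieAlgebra 𝓘(ℝ, E) G) (a : G) :
    -gen (leftMove p) B a = leftL a (AdL a⁻¹ (P (AdL a B))) := by
  rw [gen_leftMove_eq_leftTr hp hp1]
  exact (map_neg (leftL a) (lamField P B a)).symm.trans (congrArg (leftL a) (neg_neg _))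

lemma smoothField_gen_leftMove {p : G → G} {P : E →L[ℝ] E} (hp : HasD 𝓘(ℝ, E) 𝓘(ℝ, E) p 1 P)
    (hp1 : p 1 = 1) (B : GroupLieAlgebra 𝓘(ℝ, E) G) : SmoothField (E := E) (gen (leftMove p) B) := by
  rw [gen_leftMove_eq_leftTr hp hp1]
  exact smoothField_leftTr (contMDiff_lamField P B)

lemma smoothField_gen_rightMove {p : G → G} {P : E →L[ℝ] E} (hp : HasD 𝓘(ℝ, E) 𝓘(ℝ, E) p 1 P)
    (hp1 : p 1 = 1) (B : GroupLieAlgebra 𝓘(ℝ, E) G) :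
    SmoothField (E := E) (gen (rightMove p) B) := by
  rw [gen_rightMove_eq_leftTr hp hp1]
  exact smoothField_leftTr (contMDiff_rhoField P B)

variable [FiniteDimensional ℝ E] {g h : LieSubalgebra ℝ (GroupLieAlgebra 𝓘(ℝ, E) G)}
  (hc : IsCompl g.toSubmodule h.toSubmodule) {p q : G → G}
  (hp : HasD 𝓘(ℝ, E) 𝓘(ℝ, E) p 1 (projL hc)) (hp1 : p 1 = 1)
  (hq : HasD 𝓘(ℝ, E) 𝓘(ℝ, E) q 1 (projL hc.symm)) (hq1 : q 1 = 1)
include hp hp1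

/-- At each `a` this is `projection_bracket_self` for `Ad a B` and `Ad a B'`, followed by
`Ad_bracket`. -/
lemma mlieBracket_gen_leftMove (B B' : GroupLieAlgebra 𝓘(ℝ, E) G) (a : G) :
    mlieBracket 𝓘(ℝ, E) (gen (leftMove p) B) (gen (leftMove p) B') a =
      -gen (leftMove p) ⁅B, B'⁆ a := by
  have : CompleteSpace E := FiniteDimensional.complete ℝ E
  refine Eq.trans ?_ (neg_gen_leftMove hp hp1 ⁅B, B'⁆ a).symm
  rw [gen_leftMove_eq_leftTr hp hp1, gen_leftMove_eq_leftTr hp hp1]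
  refine (mlieBracket_lamField (projL hc) (projL hc) B B' a).trans ?_
  exact congrArg (fun v : E => leftL (E := E) a (AdL (E := E) a⁻¹ v)) <|
    (projection_bracket_self hc (Ad a B) (Ad a B')).trans <|
      congrArg (projL (E := E) hc) (Ad_bracket a B B').symm

lemma mlieBracket_gen_rightMove (B B' : GroupLieAlgebra 𝓘(ℝ, E) G) (a : G) :
    mlieBracket 𝓘(ℝ, E) (gen (rightMove p) B) (gen (rightMove p) B') a =
      gen (rightMove p) ⁅B, B'⁆ a := by
  rw [gen_rightMove_eq_leftTr hp hp1, gen_rightMove_eq_leftTr hp hp1,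
    gen_rightMove_eq_leftTr hp hp1]
  have : CompleteSpace E := FiniteDimensional.complete ℝ E
  refine (mlieBracket_rhoField (projL hc) (projL hc) B B' a).trans ?_
  exact congrArg (fun v : E => leftL (E := E) a (-v)) <|
    (projection_bracket_self hc (Ad a⁻¹ B) (Ad a⁻¹ B')).trans <|
      congrArg (projL (E := E) hc) (Ad_bracket a⁻¹ B B').symm

include hq hq1

/-- The two complementary projections occur together, so that `projection_bracket_compl` makes the
bracket vanish. -/
lemma mlieBracket_gen_leftMove_compl (B B' : GroupLieAlgebra 𝓘(ℝ, E) G) (a : G) :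
    mlieBracket 𝓘(ℝ, E) (gen (leftMove p) B) (gen (leftMove q) B') a = 0 := by
  rw [gen_leftMove_eq_leftTr hp hp1, gen_leftMove_eq_leftTr hq hq1]
  refine (mlieBracket_lamField (projL hc) (projL hc.symm) B B' a).trans ?_
  refine (congrArg (fun v : E => leftL (E := E) a (AdL (E := E) a⁻¹ v))
    (projection_bracket_compl hc (Ad a B) (Ad a B'))).trans ?_
  exact (congrArg (leftL (E := E) a) (map_zero (AdL (E := E) a⁻¹))).trans (map_zero (leftL (E := E) a))

lemma mlieBracket_gen_rightMove_compl (B B' : GroupLieAlgebra 𝓘(ℝ, E) G) (a : G) :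
    mlieBracket 𝓘(ℝ, E) (gen (rightMove p) B) (gen (rightMove q) B') a = 0 := by
  rw [gen_rightMove_eq_leftTr hp hp1, gen_rightMove_eq_leftTr hq hq1]
  refine (mlieBracket_rhoField (projL hc) (projL hc.symm) B B' a).trans ?_
  refine (congrArg (fun v : E => leftL (E := E) a (-v))
    (projection_bracket_compl hc (Ad a⁻¹ B) (Ad a⁻¹ B'))).trans ?_
  exact (congrArg (leftL (E := E) a) (neg_zero (G := E))).trans (map_zero (leftL (E := E) a))
end Moves

/-! ### From `ad`-invariance to `Ad`-invariance on connected groups. -/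

section LocallyConstant
variable {E : Type*} [NormedAddCommGroup E] [NormedSpace ℝ E]
  {M : Type*} [TopologicalSpace M] [ChartedSpace E M] [IsManifold 𝓘(ℝ, E) ∞ M]
  {F : Type*} [NormedAddCommGroup F] [NormedSpace ℝ F]

/-- In a chart the derivative vanishes on a ball, where the function is therefore constant. -/
lemma isLocallyConstant_of_hasD_zero {f : M → F} (hf : ∀ x, HasD 𝓘(ℝ, E) 𝓘(ℝ, F) f x 0) :
    IsLocallyConstant f := by
  refine (IsLocallyConstant.iff_eventually_eq f).2 fun a => ?_
  obtain ⟨r, hr, hb⟩ := Metric.isOpen_iff.1 (isOpen_extChartAt_target (I := 𝓘(ℝ, E)) a) _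
    (mem_extChartAt_target a)
  have hd : ∀ y ∈ Metric.ball (extChartAt 𝓘(ℝ, E) a a) r,
      HasFDerivAt (fun z => f ((extChartAt 𝓘(ℝ, E) a).symm z)) (0 : E →L[ℝ] F) y := fun y hy => by
    obtain ⟨D, hD⟩ : ∃ D : E →L[ℝ] E, HasD 𝓘(ℝ, E) 𝓘(ℝ, E) (extChartAt 𝓘(ℝ, E) a).symm y D :=
      ⟨_, (contMDiffAt_extChartAt_symm a (hb hy)).hasD⟩
    have h := (hf _).comp hD rfl
    rw [ContinuousLinearMap.zero_comp] at h
    exact h.hasFDerivAt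
  have hnear : ∀ᶠ x in nhds a, x ∈ (extChartAt 𝓘(ℝ, E) a).source ∧
      extChartAt 𝓘(ℝ, E) a x ∈ Metric.ball (extChartAt 𝓘(ℝ, E) a a) r :=
    Filter.Eventually.and (extChartAt_source_mem_nhds a)
      ((continuousAt_extChartAt a).preimage_mem_nhds (Metric.ball_mem_nhds _ hr))
  filter_upwards [hnear] with x hx
  have h := Metric.isOpen_ball.is_const_of_fderiv_eq_zero (convex_ball _ _).isPreconnected
    (fun y hy => (hd y hy).differentiableAt.differentiableWithinAt)
    (fun y hy => (hd y hy).fderiv) hx.2 (Metric.mem_ball_self hr)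
  simpa only [(extChartAt 𝓘(ℝ, E) a).left_inv hx.1, extChartAt_to_inv] using h
end LocallyConstant

section Invariance
variable {E : Type*} [NormedAddCommGroup E] [NormedSpace ℝ E]
  {G : Type*} [TopologicalSpace G] [ChartedSpace E G]

lemma hasD_bilin {β : E →L[ℝ] E →L[ℝ] ℝ} {f g : G → E} {a : G} {f' g' : E →L[ℝ] E}
    (hf : HasD 𝓘(ℝ, E) 𝓘(ℝ, E) f a f') (hg : HasD 𝓘(ℝ, E) 𝓘(ℝ, E) g a g') :
    HasD 𝓘(ℝ, E) 𝓘(ℝ, ℝ) (fun x => β (f x) (g x)) a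
      ((β (f a)).comp g' + (β.flip (g a)).comp f') := by
  have h1 : HasD 𝓘(ℝ, E × E) 𝓘(ℝ, ℝ) (fun p : E × E => β p.1 p.2) (f a, g a) _ :=
    (β.isBoundedBilinearMap.hasFDerivAt _).hasMFDerivAt
  have h2 : HasD 𝓘(ℝ, E) 𝓘(ℝ, E × E) (fun x => (f x, g x)) a (f'.prod g') := by
    rw [modelWithCornersSelf_prod, ← chartedSpaceSelf_prod]
    exact hf.prodMk hg
  exact h1.comp h2 rfl

variable [Group G] [LieGroup 𝓘(ℝ, E) ∞ G]

/-- The derivative along the left translate of `X` at `x` is `hβ` evaluated at `Ad x X`, `Ad x V`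
and `Ad x W`. -/
lemma isLocallyConstant_bilin_AdL [CompleteSpace E] {β : E →L[ℝ] E →L[ℝ] ℝ}
    (hβ : ∀ X V W : E, β V (brk G X W) + β (brk G X V) W = 0) (V W : E) :
    IsLocallyConstant (fun x : G => β (AdL x V) (AdL x W)) := by
  refine isLocallyConstant_of_hasD_zero (E := E) fun x => ?_
  obtain ⟨D₁, h₁⟩ : ∃ D : E →L[ℝ] E, HasD 𝓘(ℝ, E) 𝓘(ℝ, E) (fun x : G => AdL x V) x D :=
    ⟨_, (contMDiff_AdL_apply V).contMDiffAt.hasD⟩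
  obtain ⟨D₂, h₂⟩ : ∃ D : E →L[ℝ] E, HasD 𝓘(ℝ, E) 𝓘(ℝ, E) (fun x : G => AdL x W) x D :=
    ⟨_, (contMDiff_AdL_apply W).contMDiffAt.hasD⟩
  have h := hasD_bilin (β := β) h₁ h₂
  convert! h using 1
  refine (ContinuousLinearMap.ext fun v => ?_).symm
  obtain ⟨X, rfl⟩ : ∃ X : E, leftL x X = v := ⟨leftTrInv (E := E) x v, leftTr_leftTrInv x v⟩
  have e₁ := hasD_AdL_apply_leftL x X V h₁
  have e₂ := hasD_AdL_apply_leftL x X W h₂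
  rw [AdL_brk] at e₁ e₂
  refine Eq.trans ?_ (hβ (AdL x X) (AdL x V) (AdL x W))
  exact congrArg₂ (· + ·) (congrArg (β (AdL x V)) e₂) (congrArg (fun w : E => β w (AdL x W)) e₁)

/-- An `ad`-invariant bilinear form on the Lie algebra of a connected Lie group is `Ad`-invariant. -/
lemma Ad_invariant_of_connected [FiniteDimensional ℝ E] [ConnectedSpace G]
    (γ : LinearMap.BilinForm ℝ (GroupLieAlgebra 𝓘(ℝ, E) G))
    (hγ : ∀ x y z, γ ⁅x, y⁆ z = γ x ⁅y, z⁆) (a : G) (V W : GroupLieAlgebra 𝓘(ℝ, E) G) :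
    γ (Ad a V) (Ad a W) = γ V W := by
  have : CompleteSpace E := FiniteDimensional.complete ℝ E
  let β : E →L[ℝ] E →L[ℝ] ℝ := LinearMap.toContinuousBilinearMap (E := E) (F := E) (𝕜 := ℝ) γ
  have key : ∀ X' V' W' : GroupLieAlgebra 𝓘(ℝ, E) G, γ V' ⁅X', W'⁆ + γ ⁅X', V'⁆ W' = 0 :=
    fun X' V' W' => by
      rw [← hγ, ← lie_skew X' V', map_neg]
      simp
  have h := (isLocallyConstant_bilin_AdL (β := β) key V W).apply_eq_of_preconnectedSpace a 1
  refine Eq.trans h ?_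
  exact congrArg₂ (fun v w : E => β v w) (Ad_one V) (Ad_one W)
end Invariance

/-! ### Contractions of 2-tensors, and the bivector of a Manin decomposition. -/

section Sharp
variable {V W : Type*} [AddCommGroup V] [Module ℝ V] [AddCommGroup W] [Module ℝ W]

lemma sharp_tmul (x y : V) (α : Module.Dual ℝ V) : sharp (x ⊗ₜ[ℝ] y) α = α x • y := by
  simp [sharp]

lemma sharp_add (Λ Λ' : V ⊗[ℝ] V) (α : Module.Dual ℝ V) :
    sharp (Λ + Λ') α = sharp Λ α + sharp Λ' α := by
  simp [sharp]

lemma sharp_sub (Λ Λ' : V ⊗[ℝ] V) (α : Module.Dual ℝ V) :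
    sharp (Λ - Λ') α = sharp Λ α - sharp Λ' α := by
  simp [sharp]

lemma sharp_smul (c : ℝ) (Λ : V ⊗[ℝ] V) (α : Module.Dual ℝ V) :
    sharp (c • Λ) α = c • sharp Λ α := by
  simp [sharp]

lemma sharp_sum {ι : Type*} (s : Finset ι) (Λ : ι → V ⊗[ℝ] V) (α : Module.Dual ℝ V) :
    sharp (∑ i ∈ s, Λ i) α = ∑ i ∈ s, sharp (Λ i) α := by
  simp [sharp]

lemma sharp_add_right (Λ : V ⊗[ℝ] V) (α β : Module.Dual ℝ V) :
    sharp Λ (α + β) = sharp Λ α + sharp Λ β := by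
  simp [sharp, LinearMap.rTensor_add]

/-- Contracting a translated tensor is the same as contracting the original one with the pulled-back
form; this reduces the tensor fields `Λ_±` to computations in the Lie algebra. -/
lemma sharp_map (f : V →ₗ[ℝ] W) (C : V ⊗[ℝ] V) (α : Module.Dual ℝ W) :
    sharp (TensorProduct.map f f C) α = f (sharp C (α ∘ₗ f)) := by
  induction C using TensorProduct.induction_on with
  | zero => simp [sharp]
  | tmul x y => simp [sharp_tmul]
  | add x y hx hy => rw [map_add, sharp_add, sharp_add, hx, hy, map_add]

lemma sharp_bivector {ι : Type*} [Fintype ι] (X Y : ι → V) (α : Module.Dual ℝ V) :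
    sharp (bivector X Y) α = ∑ i, (α (Y i) • X i - α (X i) • Y i) := by
  simp only [bivector, sharp_sum, sharp_sub, sharp_tmul]
end Sharp

section Manin
variable {L : Type*} [LieRing L] [LieAlgebra ℝ L] {γ : LinearMap.BilinForm ℝ L}
  {gp gm : LieSubalgebra ℝ L} (hM : IsManinDecomposition γ gp gm)
include hM

lemma IsManinDecomposition.prPlus_add_prMinus (V : L) : hM.prPlus V + hM.prMinus V = V :=
  projection_add_projection hM.isCompl V

lemma IsManinDecomposition.prPlus_mem (V : L) : hM.prPlus V ∈ gp :=
  Submodule.projection_apply_mem hM.isCompl V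

lemma IsManinDecomposition.prMinus_mem (V : L) : hM.prMinus V ∈ gm :=
  Submodule.projection_apply_mem hM.isCompl.symm V

variable {ι : Type*} [Fintype ι] [DecidableEq ι] (X : Module.Basis ι ℝ gp) (Y : Module.Basis ι ℝ gm)
  (hXY : ∀ i j, γ (X i) (Y j) = if i = j then 1 else 0)
include hXY

omit hM in
lemma sum_dual_smul {V : L} (hV : V ∈ gp) :
    ∑ i, γ V (Y i) • (X i : L) = V := by
  have h : ∑ i, X.repr ⟨V, hV⟩ i • (X i : L) = V := by
    have h := congrArg gp.toSubmodule.subtype (X.sum_repr ⟨V, hV⟩)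
    rw [map_sum] at h
    exact h
  conv_rhs => rw [← h]
  refine Finset.sum_congr rfl fun i _ => congrArg (· • (X i : L)) ?_
  conv_lhs => rw [← h]
  simp [hXY]

lemma IsManinDecomposition.sum_minus {V : L} (hV : V ∈ gm) :
    ∑ i, γ V (X i) • (Y i : L) = V := by
  have h : ∑ i, Y.repr ⟨V, hV⟩ i • (Y i : L) = V := by
    have h := congrArg gm.toSubmodule.subtype (Y.sum_repr ⟨V, hV⟩)
    rw [map_sum] at h
    exact h
  conv_rhs => rw [← h]
  refine Finset.sum_congr rfl fun i _ => congrArg (· • (Y i : L)) ?_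
  rw [hM.symm]
  conv_lhs => rw [← h]
  simp [hXY]

/-- By isotropy, pairing `V` with `Y i` sees only its part in `gp`, and pairing it with `X i` only
its part in `gm`. Duality of the bases reconstructs these parts, and the antisymmetry of the
bivector gives the relative sign. -/
lemma IsManinDecomposition.sharp_bivector (V : L) :
    sharp (bivector (fun i => (X i : L)) (fun i => (Y i : L))) (γ V) =
      hM.prPlus V - hM.prMinus V := by
  rw [DoubleGroup.sharp_bivector, Finset.sum_sub_distrib]
  have h1 : ∀ i, γ V (Y i) = γ (hM.prPlus V) (Y i) := fun i => by
    conv_lhs => rw [← hM.prPlus_add_prMinus V]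
    simp [hM.isotropic_minus _ (hM.prMinus_mem V) _ (Y i).2]
  have h2 : ∀ i, γ V (X i) = γ (hM.prMinus V) (X i) := fun i => by
    conv_lhs => rw [← hM.prPlus_add_prMinus V]
    simp [hM.isotropic_plus _ (hM.prPlus_mem V) _ (X i).2]
  simp only [h1, h2, sum_dual_smul X Y hXY (hM.prPlus_mem V), hM.sum_minus X Y hXY (hM.prMinus_mem V)]

end Manin

/-! ### The dressing vector fields of `Λ₊` and `Λ₋`. -/

section Dressing
variable {E : Type*} [NormedAddCommGroup E] [NormedSpace ℝ E]
  {G : Type*} [TopologicalSpace G] [ChartedSpace E G] [Group G] 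

lemma leftDressing_add (Λ : (a : G) → TangentSpace 𝓘(ℝ, E) a ⊗[ℝ] TangentSpace 𝓘(ℝ, E) a)
    (α β : Module.Dual ℝ (GroupLieAlgebra 𝓘(ℝ, E) G)) (a : G) :
    leftDressing Λ (α + β) a = leftDressing Λ α a + leftDressing Λ β a := by
  rw [leftDressing, LinearMap.add_comp, sharp_add_right, neg_add]
  rfl

lemma sharp_LambdaPlus (C : GroupLieAlgebra 𝓘(ℝ, E) G ⊗[ℝ] GroupLieAlgebra 𝓘(ℝ, E) G) (a : G)
    (α : Module.Dual ℝ (TangentSpace 𝓘(ℝ, E) a)) :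
    sharp (LambdaPlus C a) α = (1 / 2 : ℝ) • (leftTr a (sharp C (α ∘ₗ (leftTr a).toLinearMap)) +
      rightTr a (sharp C (α ∘ₗ (rightTr a).toLinearMap))) := by
  rw [LambdaPlus, sharp_smul, sharp_add, leftTr₂, rightTr₂, sharp_map, sharp_map]
  rfl

lemma sharp_LambdaMinus (C : GroupLieAlgebra 𝓘(ℝ, E) G ⊗[ℝ] GroupLieAlgebra 𝓘(ℝ, E) G) (a : G)
    (α : Module.Dual ℝ (TangentSpace 𝓘(ℝ, E) a)) :
    sharp (LambdaMinus C a) α = (1 / 2 : ℝ) • (leftTr a (sharp C (α ∘ₗ (leftTr a).toLinearMap)) -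
      rightTr a (sharp C (α ∘ₗ (rightTr a).toLinearMap))) := by
  rw [LambdaMinus, sharp_smul, sharp_sub, leftTr₂, rightTr₂, sharp_map, sharp_map]
  rfl

section
variable [LieGroup 𝓘(ℝ, E) ∞ G] {γ : LinearMap.BilinForm ℝ (GroupLieAlgebra 𝓘(ℝ, E) G)}
  (α : Module.Dual ℝ (GroupLieAlgebra 𝓘(ℝ, E) G)) (a : G)

lemma comp_leftTrInv_leftTr :
    (α ∘ₗ (leftTrInv a).toLinearMap) ∘ₗ (leftTr a).toLinearMap = α :=
  LinearMap.ext fun W => congrArg α (leftTrInv_leftTr a W)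

lemma comp_rightTrInv_rightTr :
    (α ∘ₗ (rightTrInv a).toLinearMap) ∘ₗ (rightTr a).toLinearMap = α :=
  LinearMap.ext fun W => congrArg α (rightTrInv_rightTr a W)

variable (hγ : ∀ (a : G) (V W : GroupLieAlgebra 𝓘(ℝ, E) G), γ (Ad a V) (Ad a W) = γ V W)
  (V : GroupLieAlgebra 𝓘(ℝ, E) G)
include hγ

/-- This is where `Ad`-invariance enters: `γ(V, Ad(a⁻¹)W) = γ(Ad(a)V, W)`, so the left invariant
form of `γ V` is the right invariant form of `γ (Ad a V)`. -/
lemma comp_leftTrInv_rightTr :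
    (γ V ∘ₗ (leftTrInv a).toLinearMap) ∘ₗ (rightTr a).toLinearMap = γ (Ad a V) := by
  refine LinearMap.ext fun W => ?_
  have h : leftTrInv a (rightTr a W) = Ad a⁻¹ W := by rw [← leftTr_Ad_inv, leftTrInv_leftTr]
  refine (congrArg (γ V) h).trans ?_
  rw [← hγ a, Ad_Ad_inv]

lemma comp_rightTrInv_leftTr :
    (γ V ∘ₗ (rightTrInv a).toLinearMap) ∘ₗ (leftTr a).toLinearMap = γ (Ad a⁻¹ V) := by
  refine LinearMap.ext fun W => ?_
  have h : rightTrInv a (leftTr a W) = Ad a W := by rw [← rightTr_Ad, rightTrInv_rightTr]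
  refine (congrArg (γ V) h).trans ?_
  rw [← hγ a⁻¹, Ad_inv_Ad]
end

variable [FiniteDimensional ℝ E] [LieGroup 𝓘(ℝ, E) ∞ G]
  {γ : LinearMap.BilinForm ℝ (GroupLieAlgebra 𝓘(ℝ, E) G)}
  {gp gm : LieSubalgebra ℝ (GroupLieAlgebra 𝓘(ℝ, E) G)}
  (hM : IsManinDecomposition γ gp gm)
  (hγ : ∀ (a : G) (V W : GroupLieAlgebra 𝓘(ℝ, E) G), γ (Ad a V) (Ad a W) = γ V W)
  {ι : Type*} [Fintype ι] [DecidableEq ι] (X : Module.Basis ι ℝ gp) (Y : Module.Basis ι ℝ gm)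
  (hXY : ∀ i j, γ (X i) (Y j) = if i = j then 1 else 0)
include hM hγ hXY

lemma leftDressing_LambdaPlus (V : GroupLieAlgebra 𝓘(ℝ, E) G) (a : G) :
    leftDressing (LambdaPlus (bivector (fun i => (X i : GroupLieAlgebra 𝓘(ℝ, E) G))
      (fun i => Y i))) (γ V) a = -((1 / 2 : ℝ) • (rightTr a (Ad a (hM.prPlus V - hM.prMinus V)) +
        rightTr a (hM.prPlus (Ad a V) - hM.prMinus (Ad a V)))) := by
  rw [leftDressing, sharp_LambdaPlus, comp_leftTrInv_leftTr, comp_leftTrInv_rightTr a hγ,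
    hM.sharp_bivector X Y hXY, hM.sharp_bivector X Y hXY, rightTr_Ad]

lemma leftDressing_LambdaMinus (V : GroupLieAlgebra 𝓘(ℝ, E) G) (a : G) :
    leftDressing (LambdaMinus (bivector (fun i => (X i : GroupLieAlgebra 𝓘(ℝ, E) G))
      (fun i => Y i))) (γ V) a = -((1 / 2 : ℝ) • (rightTr a (Ad a (hM.prPlus V - hM.prMinus V)) -
        rightTr a (hM.prPlus (Ad a V) - hM.prMinus (Ad a V)))) := by
  rw [leftDressing, sharp_LambdaMinus, comp_leftTrInv_leftTr, comp_leftTrInv_rightTr a hγ,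
    hM.sharp_bivector X Y hXY, hM.sharp_bivector X Y hXY, rightTr_Ad]

lemma rightDressing_LambdaPlus (V : GroupLieAlgebra 𝓘(ℝ, E) G) (a : G) :
    rightDressing (LambdaPlus (bivector (fun i => (X i : GroupLieAlgebra 𝓘(ℝ, E) G))
      (fun i => Y i))) (γ V) a = (1 / 2 : ℝ) • (leftTr a (hM.prPlus (Ad a⁻¹ V) -
        hM.prMinus (Ad a⁻¹ V)) + leftTr a (Ad a⁻¹ (hM.prPlus V - hM.prMinus V))) := by
  rw [rightDressing, sharp_LambdaPlus, comp_rightTrInv_rightTr, comp_rightTrInv_leftTr a hγ,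
    hM.sharp_bivector X Y hXY, hM.sharp_bivector X Y hXY, leftTr_Ad_inv]

lemma rightDressing_LambdaMinus (V : GroupLieAlgebra 𝓘(ℝ, E) G) (a : G) :
    rightDressing (LambdaMinus (bivector (fun i => (X i : GroupLieAlgebra 𝓘(ℝ, E) G))
      (fun i => Y i))) (γ V) a = (1 / 2 : ℝ) • (leftTr a (hM.prPlus (Ad a⁻¹ V) -
        hM.prMinus (Ad a⁻¹ V)) - leftTr a (Ad a⁻¹ (hM.prPlus V - hM.prMinus V))) := by
  rw [rightDressing, sharp_LambdaMinus, comp_rightTrInv_rightTr, comp_rightTrInv_leftTr a hγ,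
    hM.sharp_bivector X Y hXY, hM.sharp_bivector X Y hXY, leftTr_Ad_inv]

/-- For `V ∈ gp` one has `pr₊V - pr₋V = V`. With `W = Ad a V` or `W = Ad a⁻¹ V`, the half sums and
differences of `W = pr₊W + pr₋W` and `pr₊W - pr₋W` leave a single projection, up to sign. -/
lemma dressing_of_mem_plus {V : GroupLieAlgebra 𝓘(ℝ, E) G} (hV : V ∈ gp) (a : G) :
    leftDressing (LambdaPlus (bivector (fun i => (X i : GroupLieAlgebra 𝓘(ℝ, E) G))
        (fun i => Y i))) (γ V) a = -rightTr a (hM.prPlus (Ad a V)) ∧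
      rightDressing (LambdaPlus (bivector (fun i => (X i : GroupLieAlgebra 𝓘(ℝ, E) G))
        (fun i => Y i))) (γ V) a = leftTr a (hM.prPlus (Ad a⁻¹ V)) ∧
      leftDressing (LambdaMinus (bivector (fun i => (X i : GroupLieAlgebra 𝓘(ℝ, E) G))
        (fun i => Y i))) (γ V) a = -rightTr a (hM.prMinus (Ad a V)) ∧
      rightDressing (LambdaMinus (bivector (fun i => (X i : GroupLieAlgebra 𝓘(ℝ, E) G))
        (fun i => Y i))) (γ V) a = -leftTr a (hM.prMinus (Ad a⁻¹ V)) := by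
  have e : hM.prPlus V - hM.prMinus V = V := by
    rw [IsManinDecomposition.prPlus, IsManinDecomposition.prMinus,
      Submodule.projection_apply_of_mem_left hM.isCompl hV,
      Submodule.projection_apply_of_mem_right hM.isCompl.symm hV, sub_zero]
  have e1 : rightTr a (Ad a V) = rightTr a (hM.prPlus (Ad a V)) + rightTr a (hM.prMinus (Ad a V)) := by
    rw [← map_add, hM.prPlus_add_prMinus]
  have e2 : leftTr a (Ad a⁻¹ V) =
      leftTr a (hM.prPlus (Ad a⁻¹ V)) + leftTr a (hM.prMinus (Ad a⁻¹ V)) := by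
    rw [← map_add, hM.prPlus_add_prMinus]
  refine ⟨?_, ?_, ?_, ?_⟩
  · rw [leftDressing_LambdaPlus hM hγ X Y hXY, e, e1, map_sub]
    module
  · rw [rightDressing_LambdaPlus hM hγ X Y hXY, e, e2, map_sub]
    module
  · rw [leftDressing_LambdaMinus hM hγ X Y hXY, e, e1, map_sub]
    module
  · rw [rightDressing_LambdaMinus hM hγ X Y hXY, e, e2, map_sub]
    module

/-- The same computation, with `pr₊V - pr₋V = -V`; this sign exchanges the roles of the two
projections. -/
lemma dressing_of_mem_minus {V : GroupLieAlgebra 𝓘(ℝ, E) G} (hV : V ∈ gm) (a : G) :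
    leftDressing (LambdaPlus (bivector (fun i => (X i : GroupLieAlgebra 𝓘(ℝ, E) G))
        (fun i => Y i))) (γ V) a = rightTr a (hM.prMinus (Ad a V)) ∧
      rightDressing (LambdaPlus (bivector (fun i => (X i : GroupLieAlgebra 𝓘(ℝ, E) G))
        (fun i => Y i))) (γ V) a = -leftTr a (hM.prMinus (Ad a⁻¹ V)) ∧
      leftDressing (LambdaMinus (bivector (fun i => (X i : GroupLieAlgebra 𝓘(ℝ, E) G))
        (fun i => Y i))) (γ V) a = rightTr a (hM.prPlus (Ad a V)) ∧
      rightDressing (LambdaMinus (bivector (fun i => (X i : GroupLieAlgebra 𝓘(ℝ, E) G))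
        (fun i => Y i))) (γ V) a = leftTr a (hM.prPlus (Ad a⁻¹ V)) := by
  have e : hM.prPlus V - hM.prMinus V = -V := by
    rw [IsManinDecomposition.prPlus, IsManinDecomposition.prMinus,
      Submodule.projection_apply_of_mem_left hM.isCompl.symm hV,
      Submodule.projection_apply_of_mem_right hM.isCompl hV, zero_sub]
  have e1 : rightTr a (Ad a (-V)) =
      -(rightTr a (hM.prPlus (Ad a V)) + rightTr a (hM.prMinus (Ad a V))) := by
    rw [← map_add, hM.prPlus_add_prMinus, map_neg, map_neg]
  have e2 : leftTr a (Ad a⁻¹ (-V)) =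
      -(leftTr a (hM.prPlus (Ad a⁻¹ V)) + leftTr a (hM.prMinus (Ad a⁻¹ V))) := by
    rw [← map_add, hM.prPlus_add_prMinus, map_neg, map_neg]
  refine ⟨?_, ?_, ?_, ?_⟩
  · rw [leftDressing_LambdaPlus hM hγ X Y hXY, e, e1, map_sub]
    module
  · rw [rightDressing_LambdaPlus hM hγ X Y hXY, e, e2, map_sub]
    module
  · rw [leftDressing_LambdaMinus hM hγ X Y hXY, e, e1, map_sub]
    module
  · rw [rightDressing_LambdaMinus hM hγ X Y hXY, e, e2, map_sub]
    module
end Dressing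

/-! ### A criterion for local actions defined by factorization. -/

section LocalAction
variable {EK : Type*} [NormedAddCommGroup EK] [NormedSpace ℝ EK]
  {HK : Type*} [TopologicalSpace HK] {IK : ModelWithCorners ℝ EK HK}
  {A B G : Type*} [TopologicalSpace A] [TopologicalSpace B] [TopologicalSpace G]
  [Group A] [Group B] [Group G]

/-- The set `O` restricts the factors so that a product of two pairs of them stays in the domain on
which factorizations are unique. -/
lemma exists_isOpen_mulOp_mem [ContinuousMul A] [ContinuousMul B] {S : Set (A × B)}
    (hS : IsOpen S) (h1 : (1, 1) ∈ S) :
    ∃ O : Set (A × B), IsOpen O ∧ (1, 1) ∈ O ∧ ∀ x ∈ O, ∀ y ∈ O, mulOp x y ∈ S := by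
  have hc : Continuous (fun p : (A × B) × (A × B) => mulOp p.1 p.2) := by
    unfold mulOp
    fun_prop
  have hn : (fun p : (A × B) × (A × B) => mulOp p.1 p.2) ⁻¹' S ∈
      nhds (((1 : A), (1 : B)), ((1 : A), (1 : B))) :=
    (hS.preimage hc).mem_nhds (by simpa [mulOp] using h1)
  rw [nhds_prod_eq, Filter.mem_prod_same_iff] at hn
  obtain ⟨t, ht, hts⟩ := hn
  exact ⟨interior t, isOpen_interior, mem_interior_iff_mem_nhds.2 ht, fun x hx y hy =>
    hts (Set.mk_mem_prod (interior_subset hx) (interior_subset hy))⟩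

variable {E : Type*} [NormedAddCommGroup E] [NormedSpace ℝ E] [ChartedSpace E G]
  [ChartedSpace HK (A × B)]

/-- A criterion for a local left action of `A × Bᵒᵖ` on `G`, of the form `(k, a) ↦ s a c(k)`, where
`s ∈ B` is the second factor of `a m(k) a⁻¹`. -/
lemma exists_isLocalLeftAction [ContinuousMul A] [ContinuousMul B] {jA : A →* G} {jB : B →* G}
    {Φ : OpenPartialHomeomorph (A × B) G} (h1 : ((1 : A), (1 : B)) ∈ Φ.source)
    (hΦ : ∀ k ∈ Φ.source, Φ k = jA k.1 * jB k.2)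
    {U : Set ((A × B) × G)} (hU : IsOpen U) (hU1 : ∀ a, ((1, 1), a) ∈ U)
    {κ : (A × B) × G → A × B} (hκ : ContinuousOn κ U) (hκ1 : ∀ a, κ ((1, 1), a) = (1, 1))
    {m c : A × B → G} (hm : ∀ k k', m (mulOp k k') = m k' * c k' * m k * (c k')⁻¹)
    (hc : ∀ k k', c (mulOp k k') = c k' * c k) {σ : A × B → G → G}
    (hσ : ContMDiffOn (IK.prod 𝓘(ℝ, E)) 𝓘(ℝ, E) ∞ (fun p : (A × B) × G => σ p.1 p.2) U)
    (hσ1 : ∀ a, σ (1, 1) a = a)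
    (hσκ : ∀ p ∈ U, σ p.1 p.2 = jB (κ p).2 * p.2 * c p.1)
    (hmκ : ∀ p ∈ U, jA (κ p).1 * jB (κ p).2 = p.2 * m p.1 * p.2⁻¹) :
    ∃ W : Set ((A × B) × G), IsLocalLeftAction (E := E) IK mulOp (1, 1) W σ ∧
      ∀ p ∈ W, p ∈ U ∧ p.2 * m p.1 * p.2⁻¹ ∈ Φ.target ∧
        σ p.1 p.2 = rightFactor jB Φ (p.2 * m p.1 * p.2⁻¹) * p.2 * c p.1 := by
  obtain ⟨O, hO, hO1, hOS⟩ := exists_isOpen_mulOp_mem Φ.open_source h1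
  have hOs : ∀ x ∈ O, x ∈ Φ.source := fun x hx => by simpa [mulOp] using hOS x hx _ hO1
  -- The domain consists of the points whose factorization `κ` is small. It is open because `κ` is
  -- continuous, and it contains the unit because `κ` is trivial there.
  refine ⟨U ∩ κ ⁻¹' O, ⟨hκ.isOpen_inter_preimage hU hO,
    fun a => ⟨hU1 a, by rw [Set.mem_preimage, hκ1]; exact hO1⟩, hσ.mono Set.inter_subset_left,
    hσ1, ?_⟩, ?_⟩
  · rintro k k' a ⟨h₁, h₁'⟩ ⟨h₂, h₂'⟩ ⟨h₃, h₃'⟩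
    have e₁ := hmκ _ h₁
    have e₂ := hmκ _ h₂
    have e₃ := hmκ _ h₃
    have s₁ := hσκ _ h₁
    have s₂ := hσκ _ h₂
    have s₃ := hσκ _ h₃
    simp only at e₁ e₂ e₃ s₁ s₂ s₃
    -- Let `r' s' = a m(k') a⁻¹` and `r s = b m(k) b⁻¹`, where `b = s' a c(k')`. Then `(r' r)(s s')
    -- = a m(k k') a⁻¹` by the cocycle property `hm`. So `(r' r, s s')` and `κ (k k', a)` have the
    -- same product, and injectivity of `Φ` on its source identifies them.
    have key : mulOp (κ (k', a)) (κ (k, σ k' a)) = κ (mulOp k k', a) := by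
      refine Φ.injOn (hOS _ h₁' _ h₂') (hOs _ h₃') ?_
      rw [hΦ _ (hOS _ h₁' _ h₂'), hΦ _ (hOs _ h₃'), e₃, hm]
      have e₄ : jA (κ (k, σ k' a)).1 * jB (κ (k, σ k' a)).2 * jB (κ (k', a)).2 =
          jB (κ (k', a)).2 * a * c k' * m k * (c k')⁻¹ * a⁻¹ := by
        rw [e₂, s₁]
        group
      have e₅ : jA (κ (k', a)).1 = a * m k' * a⁻¹ * (jB (κ (k', a)).2)⁻¹ := by
        rw [← e₁]
        group
      simp only [mulOp, map_mul]
      rw [mul_assoc (jA _), ← mul_assoc (jA (κ (k, σ k' a)).1), e₄, e₅]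
      group
    rw [s₂, s₃, ← key, hc, s₁]
    simp only [mulOp, map_mul]
    group
  · rintro p ⟨hp, hp'⟩
    have e := hΦ _ (hOs _ hp')
    rw [hmκ p hp] at e
    refine ⟨hp, e ▸ Φ.map_source (hOs _ hp'), ?_⟩
    rw [rightFactor, ← e, Φ.left_inv (hOs _ hp')]
    exact hσκ p hp
end LocalAction

/-! ### Composites of two moves. -/

section TwoSteps
variable {EK : Type*} [NormedAddCommGroup EK] [NormedSpace ℝ EK]
  {HK : Type*} [TopologicalSpace HK] {IK : ModelWithCorners ℝ EK HK}
  {K : Type*} [TopologicalSpace K] [ChartedSpace HK K]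
  {E : Type*} [NormedAddCommGroup E] [NormedSpace ℝ E]
  {G : Type*} [TopologicalSpace G] [ChartedSpace E G] [Group G] [LieGroup 𝓘(ℝ, E) ∞ G]

/-- The set of all `(k, a)` with `a b₁(k)⁻¹ a⁻¹ ∈ T₁` and `x b₂(k)⁻¹ x⁻¹ ∈ T₂`, where `x` is the
image of `a` under the move by `b₁(k)`. -/
def moveDomain {G : Type*} [Group G] (p₁ : G → G) (T₁ T₂ : Set G) (b₁ b₂ : K → G) : Set (K × G) :=
  {p | p.2 * (b₁ p.1)⁻¹ * p.2⁻¹ ∈ T₁ ∧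
    leftMove p₁ (b₁ p.1) p.2 * (b₂ p.1)⁻¹ * (leftMove p₁ (b₁ p.1) p.2)⁻¹ ∈ T₂}

variable {p₁ p₂ : G → G} {T₁ T₂ : Set G} {b₁ b₂ : K → G}

lemma continuous_conj_inv_move (hb : ContMDiff IK 𝓘(ℝ, E) ∞ b₁) :
    Continuous (fun p : K × G => p.2 * (b₁ p.1)⁻¹ * p.2⁻¹) := by
  have := topologicalGroup_of_lieGroup (G := G) 𝓘(ℝ, E) ∞
  have := hb.continuous
  fun_prop

lemma contMDiffOn_leftMove_comp (hb₁ : ContMDiff IK 𝓘(ℝ, E) ∞ b₁)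
    (hp₁ : ∀ x ∈ T₁, ContMDiffAt 𝓘(ℝ, E) 𝓘(ℝ, E) ∞ p₁ x) :
    ContMDiffOn (IK.prod 𝓘(ℝ, E)) 𝓘(ℝ, E) ∞ (fun p : K × G => leftMove p₁ (b₁ p.1) p.2)
      {p | p.2 * (b₁ p.1)⁻¹ * p.2⁻¹ ∈ T₁} := fun p hp =>
  (ContMDiffAt.comp (g := fun q : G × G => leftMove p₁ q.1 q.2) p (contMDiffAt_leftMove (hp₁ _ hp))
    (((hb₁.comp contMDiff_fst).prodMk contMDiff_snd).contMDiffAt)).contMDiffWithinAt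

lemma continuousOn_conj_leftMove_comp (hb₁ : ContMDiff IK 𝓘(ℝ, E) ∞ b₁)
    (hb₂ : ContMDiff IK 𝓘(ℝ, E) ∞ b₂) (hp₁ : ∀ x ∈ T₁, ContMDiffAt 𝓘(ℝ, E) 𝓘(ℝ, E) ∞ p₁ x) :
    ContinuousOn (fun p : K × G => leftMove p₁ (b₁ p.1) p.2 * (b₂ p.1)⁻¹ *
      (leftMove p₁ (b₁ p.1) p.2)⁻¹) {p | p.2 * (b₁ p.1)⁻¹ * p.2⁻¹ ∈ T₁} :=
  (continuous_conj_inv_move hb₂).comp_continuousOn (f := fun p : K × G => (p.1, leftMove p₁ (b₁ p.1) p.2))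
    (continuous_fst.continuousOn.prodMk (contMDiffOn_leftMove_comp hb₁ hp₁).continuousOn)

lemma isOpen_moveDomain (hb₁ : ContMDiff IK 𝓘(ℝ, E) ∞ b₁) (hb₂ : ContMDiff IK 𝓘(ℝ, E) ∞ b₂)
    (hp₁ : ∀ x ∈ T₁, ContMDiffAt 𝓘(ℝ, E) 𝓘(ℝ, E) ∞ p₁ x) (hT₁ : IsOpen T₁) (hT₂ : IsOpen T₂) :
    IsOpen (moveDomain p₁ T₁ T₂ b₁ b₂) :=
  (continuousOn_conj_leftMove_comp hb₁ hb₂ hp₁).isOpen_inter_preimage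
    (hT₁.preimage (continuous_conj_inv_move hb₁)) hT₂

lemma contMDiffOn_moveDomain (hb₁ : ContMDiff IK 𝓘(ℝ, E) ∞ b₁) (hb₂ : ContMDiff IK 𝓘(ℝ, E) ∞ b₂)
    (hp₁ : ∀ x ∈ T₁, ContMDiffAt 𝓘(ℝ, E) 𝓘(ℝ, E) ∞ p₁ x)
    (hp₂ : ∀ x ∈ T₂, ContMDiffAt 𝓘(ℝ, E) 𝓘(ℝ, E) ∞ p₂ x) :
    ContMDiffOn (IK.prod 𝓘(ℝ, E)) 𝓘(ℝ, E) ∞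
      (fun p : K × G => leftMove p₂ (b₂ p.1) (leftMove p₁ (b₁ p.1) p.2))
      (moveDomain p₁ T₁ T₂ b₁ b₂) :=
  (contMDiffOn_leftMove_comp hb₂ hp₂).comp
    (contMDiffOn_fst.prodMk ((contMDiffOn_leftMove_comp hb₁ hp₁).mono fun _ h => h.1))
    fun _ h => h.2

omit [TopologicalSpace K] [TopologicalSpace G] in
lemma mem_moveDomain_one {e : K} (hb₁ : b₁ e = 1) (hb₂ : b₂ e = 1) (hT₁ : 1 ∈ T₁) (hT₂ : 1 ∈ T₂)
    (a : G) : (e, a) ∈ moveDomain p₁ T₁ T₂ b₁ b₂ := by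
  simp [moveDomain, hb₁, hb₂, hT₁, hT₂]

/-- At `e` both moves are the identity in `a`, so the chain rule simply adds the two generators. -/
lemma infGen_leftMove_comp {P₁ P₂ : E →L[ℝ] E} (hp₁ : HasD 𝓘(ℝ, E) 𝓘(ℝ, E) p₁ 1 P₁)
    (hp₂ : HasD 𝓘(ℝ, E) 𝓘(ℝ, E) p₂ 1 P₂) (hs₂ : ContMDiffAt 𝓘(ℝ, E) 𝓘(ℝ, E) ∞ p₂ 1)
    (hp₁1 : p₁ 1 = 1) (hp₂1 : p₂ 1 = 1) {e : K} {B₁ B₂ : EK →L[ℝ] E}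
    (hb₁ : HasD IK 𝓘(ℝ, E) b₁ e B₁) (hb₂ : HasD IK 𝓘(ℝ, E) b₂ e B₂) (hb₁1 : b₁ e = 1)
    (hb₂1 : b₂ e = 1) (v : EK) (a : G) :
    infGen (E := E) IK (fun k a => leftMove p₂ (b₂ k) (leftMove p₁ (b₁ k) a)) e v a =
      gen (leftMove p₂) (B₂ v : E) a + gen (leftMove p₁) (B₁ v : E) a := by
  have h₂ := (contMDiffAt_leftMove (p := p₂) (b := 1) (a := a) (by simpa using hs₂)).hasD_prod
    (f₂ := .id ℝ E) (hasD_leftMove hp₂ hp₂1 a)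
    (by simpa only [leftMove_one hp₂1] using hasD_id a)
  have h₁ := (hasD_leftMove hp₁ hp₁1 a).comp hb₁ hb₁1
  have h := h₂.comp (hb₂.prodMk h₁) (by rw [hb₁1, hb₂1, leftMove_one hp₁1])
  refine (DFunLike.congr_fun h.mfderiv v).trans ?_
  exact (congrArg₂ (fun x y : E => x + y)
    (DFunLike.congr_fun (hasD_leftMove hp₂ hp₂1 a).mfderiv (B₂ v))
    (DFunLike.congr_fun (hasD_leftMove hp₁ hp₁1 a).mfderiv (B₁ v))).symm
end TwoSteps

/-! ### The two local dressing actions of `G₊ × G₋ᵒᵖ`. -/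

section DressingActions
variable {E : Type*} [NormedAddCommGroup E] [NormedSpace ℝ E] [FiniteDimensional ℝ E]
  {G : Type*} [TopologicalSpace G] [ChartedSpace E G] [Group G] [LieGroup 𝓘(ℝ, E) ∞ G]
  {Ep : Type*} [NormedAddCommGroup Ep] [NormedSpace ℝ Ep]
  {Gp : Type*} [TopologicalSpace Gp] [ChartedSpace Ep Gp] [Group Gp] [LieGroup 𝓘(ℝ, Ep) ∞ Gp]
  {Em : Type*} [NormedAddCommGroup Em] [NormedSpace ℝ Em]
  {Gm : Type*} [TopologicalSpace Gm] [ChartedSpace Em Gm] [Group Gm] [LieGroup 𝓘(ℝ, Em) ∞ Gm]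
  {gp gm : LieSubalgebra ℝ (GroupLieAlgebra 𝓘(ℝ, E) G)}
  {jp : Gp →* G} {jm : Gm →* G}
  {Φ : OpenPartialHomeomorph (Gp × Gm) G} {Ψ : OpenPartialHomeomorph (Gm × Gp) G}

section
variable (hjp : IsLieSubgroup (E := E) (E₁ := Ep) jp gp)
  (hjm : IsLieSubgroup (E := E) (E₁ := Em) jm gm)

omit [LieGroup 𝓘(ℝ, Ep) ∞ Gp] [Group Gm] [LieGroup 𝓘(ℝ, Em) ∞ Gm] in
include hjp in
lemma contMDiff_plus_fst : ContMDiff (𝓘(ℝ, Ep).prod 𝓘(ℝ, Em)) 𝓘(ℝ, E) ∞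
    (fun k : Gp × Gm => jp k.1) := hjp.smooth.comp contMDiff_fst

omit [Group Gp] [LieGroup 𝓘(ℝ, Ep) ∞ Gp] [LieGroup 𝓘(ℝ, Em) ∞ Gm] in
include hjm in
lemma contMDiff_minus_snd_inv : ContMDiff (𝓘(ℝ, Ep).prod 𝓘(ℝ, Em)) 𝓘(ℝ, E) ∞
    (fun k : Gp × Gm => (jm k.2)⁻¹) := (hjm.smooth.comp contMDiff_snd).inv

omit [LieGroup 𝓘(ℝ, Ep) ∞ Gp] [LieGroup 𝓘(ℝ, Em) ∞ Gm] in
include hjp in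
lemma hasD_plus_fst : HasD (𝓘(ℝ, Ep).prod 𝓘(ℝ, Em)) 𝓘(ℝ, E) (fun k : Gp × Gm => jp k.1) (1, 1)
    ((lieMap (E := E) (E₁ := Ep) jp : Ep →L[ℝ] E).comp (.fst ℝ Ep Em)) :=
  hjp.hasD.comp (hasD_fst _) rfl

omit [LieGroup 𝓘(ℝ, Ep) ∞ Gp] [LieGroup 𝓘(ℝ, Em) ∞ Gm] in
include hjm in
lemma hasD_minus_snd_inv :
    HasD (𝓘(ℝ, Ep).prod 𝓘(ℝ, Em)) 𝓘(ℝ, E) (fun k : Gp × Gm => (jm k.2)⁻¹) (1, 1)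
      ((-ContinuousLinearMap.id ℝ E).comp
        ((lieMap (E := E) (E₁ := Em) jm : Em →L[ℝ] E).comp (.snd ℝ Ep Em))) :=
  HasD.comp hasD_inv_one (hjm.hasD.comp (hasD_snd _) rfl) (by simp)

include hjp hjm

/-- The criterion is applied with `m(g, u) = u g` and `c(g, u) = g⁻¹`. The factors of `a u g a⁻¹`
are assembled from those of the two steps, which makes them continuous on the whole domain of the
composite. -/
lemma exists_isLocalLeftAction_dressPlus
    (hΦ : IsLocalFactorization (E := E) (E₁ := Ep) (E₂ := Em) jp jm Φ)
    (hΨ : IsLocalFactorization (E := E) (E₁ := Em) (E₂ := Ep) jm jp Ψ) :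
    ∃ W : Set ((Gp × Gm) × G),
      IsLocalLeftAction (E := E) (𝓘(ℝ, Ep).prod 𝓘(ℝ, Em)) mulOp (1, 1) W (dressPlus jp jm Φ Ψ) ∧
      ∀ (g : Gp) (u : Gm) (a : G), ((g, u), a) ∈ W →
        a * jm u * a⁻¹ ∈ Φ.target ∧
        lamMinus jm Φ (jm u)⁻¹ a * (jp g)⁻¹ * (lamMinus jm Φ (jm u)⁻¹ a)⁻¹ ∈ Ψ.target ∧
        a * jm u * jp g * a⁻¹ ∈ Φ.target ∧
        dressPlus jp jm Φ Ψ (g, u) a =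
          rightFactor jm Φ (a * jm u * jp g * a⁻¹) * a * (jp g)⁻¹ := by
  have := topologicalGroup_of_lieGroup (G := Gp) 𝓘(ℝ, Ep) ∞
  have := topologicalGroup_of_lieGroup (G := Gm) 𝓘(ℝ, Em) ∞
  have hb₁ := contMDiff_minus_snd_inv (Ep := Ep) (Gp := Gp) hjm
  have hb₂ := contMDiff_plus_fst (Em := Em) (Gm := Gm) hjp
  have hp₁ := fun x (hx : x ∈ Φ.target) => contMDiffAt_rightFactor hΦ hjm hx
  have hp₂ := fun x (hx : x ∈ Ψ.target) => contMDiffAt_rightFactor hΨ hjp hx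
  set U := moveDomain (rightFactor jm Φ) Φ.target Ψ.target (fun k : Gp × Gm => (jm k.2)⁻¹)
    (fun k => jp k.1) with hU
  let f₁ : (Gp × Gm) × G → G := fun p => p.2 * ((jm p.1.2)⁻¹)⁻¹ * p.2⁻¹
  let x : (Gp × Gm) × G → G := fun p => leftMove (rightFactor jm Φ) (jm p.1.2)⁻¹ p.2
  let f₂ : (Gp × Gm) × G → G := fun p => x p * (jp p.1.1)⁻¹ * (x p)⁻¹
  have h₁ : ContinuousOn (fun p => Φ.symm (f₁ p)) U := Φ.symm.continuousOn.comp
    (continuous_conj_inv_move hb₁).continuousOn fun _ h => h.1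
  have h₂ : ContinuousOn (fun p => Ψ.symm (f₂ p)) U := Ψ.symm.continuousOn.comp
    ((continuousOn_conj_leftMove_comp hb₁ hb₂ hp₁).mono fun _ h => h.1) fun _ h => h.2
  have hU1 : ∀ a, ((1, 1), a) ∈ U := mem_moveDomain_one (by simp) (by simp) hΦ.one_mem_target
    hΨ.one_mem_target
  have e₁ : ∀ p ∈ U, jp (Φ.symm (f₁ p)).1 * jm (Φ.symm (f₁ p)).2 = p.2 * jm p.1.2 * p.2⁻¹ :=
    fun p hp => by simpa only [f₁, inv_inv] using hΦ.mul_eq hp.1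
  have e₂ : ∀ p ∈ U, jm (Ψ.symm (f₂ p)).1 * jp (Ψ.symm (f₂ p)).2 =
      x p * (jp p.1.1)⁻¹ * (x p)⁻¹ := fun p hp => hΨ.mul_eq hp.2
  have e₃ : ∀ p, x p = jm (Φ.symm (f₁ p)).2 * p.2 := fun p => rfl
  obtain ⟨W, hW, hW'⟩ := exists_isLocalLeftAction (E := E) (IK := 𝓘(ℝ, Ep).prod 𝓘(ℝ, Em))
    (jA := jp) (jB := jm) hΦ.unit_mem hΦ.eq_mul
    (isOpen_moveDomain hb₁ hb₂ hp₁ Φ.open_target Ψ.open_target) hU1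
    -- Write `a u a⁻¹ = g₁ u₁`, `x = u₁ a` and `x g⁻¹ x⁻¹ = v₂ h₂`. Then the composite move gives
    -- `h₂ x = (v₂⁻¹ u₁) a g⁻¹`, and `(g₁ h₂⁻¹)(v₂⁻¹ u₁) = a u g a⁻¹`.
    (κ := fun p => ((Φ.symm (f₁ p)).1 * (Ψ.symm (f₂ p)).2⁻¹,
      (Ψ.symm (f₂ p)).1⁻¹ * (Φ.symm (f₁ p)).2))
    ((h₁.fst.mul h₂.snd.inv).prodMk (h₂.fst.inv.mul h₁.snd))
    (fun a => by simp [f₁, f₂, x, hΦ.symm_one, hΨ.symm_one])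
    (m := fun k => jm k.2 * jp k.1) (c := fun k => (jp k.1)⁻¹)
    (fun k k' => by simp [mulOp, mul_assoc]) (fun k k' => by simp [mulOp])
    (σ := dressPlus jp jm Φ Ψ) (contMDiffOn_moveDomain hb₁ hb₂ hp₁ hp₂)
    (fun a => by
      simp [dressPlus, lamPlus, lamMinus, leftMove_one, hΦ.rightFactor_one, hΨ.rightFactor_one])
    (fun p hp => by
      have h : dressPlus jp jm Φ Ψ p.1 p.2 = jp (Ψ.symm (f₂ p)).2 * x p := rfl
      rw [h, eq_inv_mul_of_mul_eq (e₂ p hp), e₃]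
      simp [mul_assoc])
    (fun p hp => by
      have h := eq_mul_inv_of_mul_eq (e₁ p hp)
      have h' := congrArg Inv.inv (e₂ p hp)
      simp only [mul_inv_rev, inv_inv] at h'
      simp only [map_mul, map_inv]
      rw [mul_assoc (jp _), ← mul_assoc _ (jm _)⁻¹, h', e₃, h]
      group)
  refine ⟨W, hW, fun g u a h => ?_⟩
  obtain ⟨⟨hd₁, hd₂⟩, ht, he⟩ := hW' _ h
  simp only [inv_inv] at hd₁
  simp only [← mul_assoc] at ht he
  exact ⟨hd₁, hd₂, ht, he⟩

/-- Here the criterion is applied with `m(g, u) = g⁻¹ u⁻¹` and `c(g, u) = u`. -/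
lemma exists_isLocalLeftAction_dressMinus
    (hΦ : IsLocalFactorization (E := E) (E₁ := Ep) (E₂ := Em) jp jm Φ)
    (hΨ : IsLocalFactorization (E := E) (E₁ := Em) (E₂ := Ep) jm jp Ψ) :
    ∃ W : Set ((Gp × Gm) × G),
      IsLocalLeftAction (E := E) (𝓘(ℝ, Ep).prod 𝓘(ℝ, Em)) mulOp (1, 1) W (dressMinus jp jm Φ Ψ) ∧
      ∀ (g : Gp) (u : Gm) (a : G), ((g, u), a) ∈ W →
        a * jm u * a⁻¹ ∈ Ψ.target ∧
        lamPlus jp Ψ (jm u)⁻¹ a * (jp g)⁻¹ * (lamPlus jp Ψ (jm u)⁻¹ a)⁻¹ ∈ Φ.target ∧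
        a * (jp g)⁻¹ * (jm u)⁻¹ * a⁻¹ ∈ Φ.target ∧
        dressMinus jp jm Φ Ψ (g, u) a =
          rightFactor jm Φ (a * (jp g)⁻¹ * (jm u)⁻¹ * a⁻¹) * a * jm u := by
  have := topologicalGroup_of_lieGroup (G := Gp) 𝓘(ℝ, Ep) ∞
  have := topologicalGroup_of_lieGroup (G := Gm) 𝓘(ℝ, Em) ∞
  have hb₁ := contMDiff_minus_snd_inv (Ep := Ep) (Gp := Gp) hjm
  have hb₂ := contMDiff_plus_fst (Em := Em) (Gm := Gm) hjp
  have hp₁ := fun x (hx : x ∈ Ψ.target) => contMDiffAt_rightFactor hΨ hjp hx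
  have hp₂ := fun x (hx : x ∈ Φ.target) => contMDiffAt_rightFactor hΦ hjm hx
  set U := moveDomain (rightFactor jp Ψ) Ψ.target Φ.target (fun k : Gp × Gm => (jm k.2)⁻¹)
    (fun k => jp k.1) with hU
  let f₁ : (Gp × Gm) × G → G := fun p => p.2 * ((jm p.1.2)⁻¹)⁻¹ * p.2⁻¹
  let x : (Gp × Gm) × G → G := fun p => leftMove (rightFactor jp Ψ) (jm p.1.2)⁻¹ p.2
  let f₂ : (Gp × Gm) × G → G := fun p => x p * (jp p.1.1)⁻¹ * (x p)⁻¹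
  have h₁ : ContinuousOn (fun p => Ψ.symm (f₁ p)) U := Ψ.symm.continuousOn.comp
    (continuous_conj_inv_move hb₁).continuousOn fun _ h => h.1
  have h₂ : ContinuousOn (fun p => Φ.symm (f₂ p)) U := Φ.symm.continuousOn.comp
    ((continuousOn_conj_leftMove_comp hb₁ hb₂ hp₁).mono fun _ h => h.1) fun _ h => h.2
  have hU1 : ∀ a, ((1, 1), a) ∈ U := mem_moveDomain_one (by simp) (by simp) hΨ.one_mem_target
    hΦ.one_mem_target
  have e₁ : ∀ p ∈ U, jm (Ψ.symm (f₁ p)).1 * jp (Ψ.symm (f₁ p)).2 = p.2 * jm p.1.2 * p.2⁻¹ :=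
    fun p hp => by simpa only [f₁, inv_inv] using hΨ.mul_eq hp.1
  have e₂ : ∀ p ∈ U, jp (Φ.symm (f₂ p)).1 * jm (Φ.symm (f₂ p)).2 =
      x p * (jp p.1.1)⁻¹ * (x p)⁻¹ := fun p hp => hΦ.mul_eq hp.2
  have e₃ : ∀ p, x p = jp (Ψ.symm (f₁ p)).2 * p.2 := fun p => rfl
  obtain ⟨W, hW, hW'⟩ := exists_isLocalLeftAction (E := E) (IK := 𝓘(ℝ, Ep).prod 𝓘(ℝ, Em))
    (jA := jp) (jB := jm) hΦ.unit_mem hΦ.eq_mul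
    (isOpen_moveDomain hb₁ hb₂ hp₁ Ψ.open_target Φ.open_target) hU1
    -- Write `a u a⁻¹ = v₁ h₁`, `x = h₁ a` and `x g⁻¹ x⁻¹ = g₂ u₂`. Since `h₁ a = v₁⁻¹ a u`, the
    -- composite move gives `u₂ x = (u₂ v₁⁻¹) a u`, and `(h₁⁻¹ g₂)(u₂ v₁⁻¹) = a g⁻¹ u⁻¹ a⁻¹`.
    (κ := fun p => ((Ψ.symm (f₁ p)).2⁻¹ * (Φ.symm (f₂ p)).1,
      (Φ.symm (f₂ p)).2 * (Ψ.symm (f₁ p)).1⁻¹))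
    ((h₁.snd.inv.mul h₂.fst).prodMk (h₂.snd.mul h₁.fst.inv))
    (fun a => by simp [f₁, f₂, x, hΦ.symm_one, hΨ.symm_one])
    (m := fun k => (jp k.1)⁻¹ * (jm k.2)⁻¹) (c := fun k => jm k.2)
    (fun k k' => by simp [mulOp, mul_assoc]) (fun k k' => by simp [mulOp])
    (σ := dressMinus jp jm Φ Ψ) (contMDiffOn_moveDomain hb₁ hb₂ hp₁ hp₂)
    (fun a => by
      simp [dressMinus, lamPlus, lamMinus, leftMove_one, hΦ.rightFactor_one, hΨ.rightFactor_one])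
    (fun p hp => by
      have h : dressMinus jp jm Φ Ψ p.1 p.2 = jm (Φ.symm (f₂ p)).2 * x p := rfl
      rw [h, e₃, eq_inv_mul_of_mul_eq (e₁ p hp)]
      simp [mul_assoc])
    (fun p hp => by
      have h := eq_inv_mul_of_mul_eq (e₁ p hp)
      simp only [map_mul, map_inv]
      rw [mul_assoc (jp _)⁻¹, ← mul_assoc (jp _) (jm _), e₂ p hp, e₃, h]
      group)
  refine ⟨W, hW, fun g u a h => ?_⟩
  obtain ⟨⟨hd₁, hd₂⟩, ht, he⟩ := hW' _ h
  simp only [inv_inv] at hd₁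
  simp only [← mul_assoc] at ht he
  exact ⟨hd₁, hd₂, ht, he⟩

omit [LieGroup 𝓘(ℝ, Ep) ∞ Gp] [LieGroup 𝓘(ℝ, Em) ∞ Gm] in
/-- The infinitesimal generators of a map `(g, u) ↦ (a ↦ λ_g λ'_{u⁻¹}(a))`. -/
lemma infGen_leftMove_subgroups {p₁ p₂ : G → G} {P₁ P₂ : E →L[ℝ] E}
    (hp₁ : HasD 𝓘(ℝ, E) 𝓘(ℝ, E) p₁ 1 P₁) (hp₂ : HasD 𝓘(ℝ, E) 𝓘(ℝ, E) p₂ 1 P₂)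
    (hs₂ : ContMDiffAt 𝓘(ℝ, E) 𝓘(ℝ, E) ∞ p₂ 1) (hp₁1 : p₁ 1 = 1) (hp₂1 : p₂ 1 = 1)
    (ξ : GroupLieAlgebra 𝓘(ℝ, Ep) Gp) (η : GroupLieAlgebra 𝓘(ℝ, Em) Gm) (a : G) :
    infGen (𝓘(ℝ, Ep).prod 𝓘(ℝ, Em))
        (fun (k : Gp × Gm) a => leftMove p₂ (jp k.1) (leftMove p₁ (jm k.2)⁻¹ a)) (1, 1) (ξ, η) a =
      -rightTr a (P₂ (Ad a (lieMap jp ξ))) + rightTr a (P₁ (Ad a (lieMap jm η))) := by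
  refine (infGen_leftMove_comp hp₁ hp₂ hs₂ hp₁1 hp₂1 (hasD_minus_snd_inv hjm) (hasD_plus_fst hjp)
    (by simp) (by simp) ((ξ, η) : Ep × Em) a).trans ?_
  refine congrArg₂ (· + ·) (gen_leftMove hp₂ hp₂1 _ a) ((gen_leftMove hp₁ hp₁1 _ a).trans ?_)
  have h : ∀ w : E, -rightL a (P₁ (AdL a (-w))) = rightL a (P₁ (AdL a w)) := fun w => by
    simp only [map_neg, neg_neg]
  exact h _
end
end DressingActions

end DoubleGroup

/-! ### The theorem, assembled from the parts above. -/

theorem theorem6p10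
    -- the Lie group `G`
    {E : Type*} [NormedAddCommGroup E] [NormedSpace ℝ E] [FiniteDimensional ℝ E]
    {G : Type*} [TopologicalSpace G] [ChartedSpace E G] [Group G] [LieGroup 𝓘(ℝ, E) ∞ G]
    -- the Manin decomposition of its metrical Lie algebra
    (γ : LinearMap.BilinForm ℝ (GroupLieAlgebra 𝓘(ℝ, E) G))
    (gp gm : LieSubalgebra ℝ (GroupLieAlgebra 𝓘(ℝ, E) G))
    (hM : IsManinDecomposition γ gp gm)
    -- `γ` is invariant under `G`, which is automatic if `G` is connected
    (hG : ConnectedSpace G ∨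
      ∀ (a : G) (V W : GroupLieAlgebra 𝓘(ℝ, E) G),
        γ (Ad a V) (Ad a W) = γ V W)
    -- dual bases of `gp` and `gm`
    {ι : Type*} [Fintype ι] [DecidableEq ι]
    (X : Module.Basis ι ℝ gp) (Y : Module.Basis ι ℝ gm)
    (hXY : ∀ i j, γ (X i) (Y j) = if i = j then 1 else 0)
    -- the Lie subgroups `G₊`, `G₋`
    {Ep : Type*} [NormedAddCommGroup Ep] [NormedSpace ℝ Ep] [FiniteDimensional ℝ Ep]
    {Gp : Type*} [TopologicalSpace Gp] [ChartedSpace Ep Gp] [Group Gp] [LieGroup 𝓘(ℝ, Ep) ∞ Gp]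
    {Em : Type*} [NormedAddCommGroup Em] [NormedSpace ℝ Em] [FiniteDimensional ℝ Em]
    {Gm : Type*} [TopologicalSpace Gm] [ChartedSpace Em Gm] [Group Gm] [LieGroup 𝓘(ℝ, Em) ∞ Gm]
    (jp : Gp →* G) (jm : Gm →* G)
    (hjp : IsLieSubgroup (E := E) (E₁ := Ep) jp gp)
    (hjm : IsLieSubgroup (E := E) (E₁ := Em) jm gm) :
    -- the local inverses that define the projections exist
    (∃ Φ : OpenPartialHomeomorph (Gp × Gm) G,
      IsLocalFactorization (E := E) (E₁ := Ep) (E₂ := Em) jp jm Φ) ∧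
    (∃ Ψ : OpenPartialHomeomorph (Gm × Gp) G,
      IsLocalFactorization (E := E) (E₁ := Em) (E₂ := Ep) jm jp Ψ) ∧
    -- and for every choice of them the following holds
    ∀ (Φ : OpenPartialHomeomorph (Gp × Gm) G) (Ψ : OpenPartialHomeomorph (Gm × Gp) G),
      IsLocalFactorization (E := E) (E₁ := Ep) (E₂ := Em) jp jm Φ →
      IsLocalFactorization (E := E) (E₁ := Em) (E₂ := Ep) jm jp Ψ →
      -- the infinitesimal generators
      ((∀ a : G,
          lamPlus jp Ψ 1 a = a ∧ lamMinus jm Φ 1 a = a ∧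
          rhoPlus jp Φ 1 a = a ∧ rhoMinus jm Ψ 1 a = a ∧
          ContMDiffAt 𝓘(ℝ, E) 𝓘(ℝ, E) ∞ (fun b => lamPlus jp Ψ b a) 1 ∧
          ContMDiffAt 𝓘(ℝ, E) 𝓘(ℝ, E) ∞ (fun b => lamMinus jm Φ b a) 1 ∧
          ContMDiffAt 𝓘(ℝ, E) 𝓘(ℝ, E) ∞ (fun b => rhoPlus jp Φ b a) 1 ∧
          ContMDiffAt 𝓘(ℝ, E) 𝓘(ℝ, E) ∞ (fun b => rhoMinus jm Ψ b a) 1) ∧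
        ∀ (B : GroupLieAlgebra 𝓘(ℝ, E) G) (a : G),
          gen (lamPlus jp Ψ) B a =
            -rightTr a (hM.prPlus (Ad a B)) ∧
          gen (lamMinus jm Φ) B a =
            -rightTr a (hM.prMinus (Ad a B)) ∧
          gen (rhoPlus jp Φ) B a =
            -leftTr a (hM.prPlus (Ad a⁻¹ B)) ∧
          gen (rhoMinus jm Ψ) B a =
            -leftTr a (hM.prMinus (Ad a⁻¹ B))) ∧
      -- they are smooth vector fields and satisfy the bracket relations
      (∀ B : GroupLieAlgebra 𝓘(ℝ, E) G,
        SmoothField (E := E) (gen (lamPlus jp Ψ) B) ∧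
        SmoothField (E := E) (gen (lamMinus jm Φ) B) ∧
        SmoothField (E := E) (gen (rhoPlus jp Φ) B) ∧
        SmoothField (E := E) (gen (rhoMinus jm Ψ) B)) ∧
      (∀ (B B' : GroupLieAlgebra 𝓘(ℝ, E) G) (a : G),
        VectorField.mlieBracket 𝓘(ℝ, E)
            (gen (lamPlus jp Ψ) B)
            (gen (lamPlus jp Ψ) B') a =
          -gen (lamPlus jp Ψ) ⁅B, B'⁆ a ∧
        VectorField.mlieBracket 𝓘(ℝ, E)
            (gen (lamMinus jm Φ) B)
            (gen (lamMinus jm Φ) B') a =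
          -gen (lamMinus jm Φ) ⁅B, B'⁆ a ∧
        VectorField.mlieBracket 𝓘(ℝ, E)
            (gen (rhoPlus jp Φ) B)
            (gen (rhoPlus jp Φ) B') a =
          gen (rhoPlus jp Φ) ⁅B, B'⁆ a ∧
        VectorField.mlieBracket 𝓘(ℝ, E)
            (gen (rhoMinus jm Ψ) B)
            (gen (rhoMinus jm Ψ) B') a =
          gen (rhoMinus jm Ψ) ⁅B, B'⁆ a ∧
        VectorField.mlieBracket 𝓘(ℝ, E)
            (gen (lamPlus jp Ψ) B)
            (gen (lamMinus jm Φ) B') a = 0 ∧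
        VectorField.mlieBracket 𝓘(ℝ, E)
            (gen (rhoPlus jp Φ) B)
            (gen (rhoMinus jm Ψ) B') a = 0) ∧
      -- the dressing vector fields of `Λ₊` and `Λ₋`
      (∀ (V : GroupLieAlgebra 𝓘(ℝ, E) G) (a : G), V ∈ gp →
        leftDressing (LambdaPlus (bivector (fun i => (X i : GroupLieAlgebra 𝓘(ℝ, E) G)) (fun i => Y i))) (γ V) a =
          gen (lamPlus jp Ψ) V a ∧
        rightDressing (LambdaPlus (bivector (fun i => (X i : GroupLieAlgebra 𝓘(ℝ, E) G)) (fun i => Y i))) (γ V) a =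
          -gen (rhoPlus jp Φ) V a ∧
        leftDressing (LambdaMinus (bivector (fun i => (X i : GroupLieAlgebra 𝓘(ℝ, E) G)) (fun i => Y i))) (γ V) a =
          gen (lamMinus jm Φ) V a ∧
        rightDressing (LambdaMinus (bivector (fun i => (X i : GroupLieAlgebra 𝓘(ℝ, E) G)) (fun i => Y i))) (γ V) a =
          gen (rhoMinus jm Ψ) V a) ∧
      (∀ (V : GroupLieAlgebra 𝓘(ℝ, E) G) (a : G), V ∈ gm →
        leftDressing (LambdaPlus (bivector (fun i => (X i : GroupLieAlgebra 𝓘(ℝ, E) G)) (fun i => Y i))) (γ V) a =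
          -gen (lamMinus jm Φ) V a ∧
        rightDressing (LambdaPlus (bivector (fun i => (X i : GroupLieAlgebra 𝓘(ℝ, E) G)) (fun i => Y i))) (γ V) a =
          gen (rhoMinus jm Ψ) V a ∧
        leftDressing (LambdaMinus (bivector (fun i => (X i : GroupLieAlgebra 𝓘(ℝ, E) G)) (fun i => Y i))) (γ V) a =
          -gen (lamPlus jp Ψ) V a ∧
        rightDressing (LambdaMinus (bivector (fun i => (X i : GroupLieAlgebra 𝓘(ℝ, E) G)) (fun i => Y i))) (γ V) a =
          -gen (rhoPlus jp Φ) V a) ∧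
      -- the local left dressing action of `G₊ × G₋ᵒᵖ` on `G` for `Λ₊`
      (∃ W : Set ((Gp × Gm) × G),
        IsLocalLeftAction (E := E) (𝓘(ℝ, Ep).prod 𝓘(ℝ, Em))
          mulOp (1, 1) W (dressPlus jp jm Φ Ψ) ∧
        (∀ (g : Gp) (u : Gm) (a : G), ((g, u), a) ∈ W →
          a * jm u * a⁻¹ ∈ Φ.target ∧
          lamMinus jm Φ (jm u)⁻¹ a * (jp g)⁻¹ *
            (lamMinus jm Φ (jm u)⁻¹ a)⁻¹ ∈ Ψ.target ∧
          a * jm u * jp g * a⁻¹ ∈ Φ.target ∧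
          dressPlus jp jm Φ Ψ (g, u) a =
            rightFactor jm Φ (a * jm u * jp g * a⁻¹) * a * (jp g)⁻¹)) ∧
      (∀ (ξ : GroupLieAlgebra 𝓘(ℝ, Ep) Gp) (η : GroupLieAlgebra 𝓘(ℝ, Em) Gm) (a : G),
        infGen (𝓘(ℝ, Ep).prod 𝓘(ℝ, Em)) (dressPlus jp jm Φ Ψ)
            (1, 1) (ξ, η) a =
          leftDressing (LambdaPlus (bivector (fun i => (X i : GroupLieAlgebra 𝓘(ℝ, E) G)) (fun i => Y i)))
            (γ (lieMap jp ξ + lieMap jm η)) a) ∧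
      -- the local left dressing action of `G₊ × G₋ᵒᵖ` on `G` for `Λ₋`
      (∃ W : Set ((Gp × Gm) × G),
        IsLocalLeftAction (E := E) (𝓘(ℝ, Ep).prod 𝓘(ℝ, Em))
          mulOp (1, 1) W (dressMinus jp jm Φ Ψ) ∧
        (∀ (g : Gp) (u : Gm) (a : G), ((g, u), a) ∈ W →
          a * jm u * a⁻¹ ∈ Ψ.target ∧
          lamPlus jp Ψ (jm u)⁻¹ a * (jp g)⁻¹ *
            (lamPlus jp Ψ (jm u)⁻¹ a)⁻¹ ∈ Φ.target ∧
          a * (jp g)⁻¹ * (jm u)⁻¹ * a⁻¹ ∈ Φ.target ∧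
          dressMinus jp jm Φ Ψ (g, u) a =
            rightFactor jm Φ (a * (jp g)⁻¹ * (jm u)⁻¹ * a⁻¹) * a * jm u)) ∧
      (∀ (ξ : GroupLieAlgebra 𝓘(ℝ, Ep) Gp) (η : GroupLieAlgebra 𝓘(ℝ, Em) Gm) (a : G),
        infGen (𝓘(ℝ, Ep).prod 𝓘(ℝ, Em)) (dressMinus jp jm Φ Ψ)
            (1, 1) (ξ, η) a =
          leftDressing (LambdaMinus (bivector (fun i => (X i : GroupLieAlgebra 𝓘(ℝ, E) G)) (fun i => Y i)))
            (γ (lieMap jp ξ + lieMap jm η)) a) := by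
  have hγ : ∀ (a : G) (V W : GroupLieAlgebra 𝓘(ℝ, E) G), γ (Ad a V) (Ad a W) = γ V W :=
    hG.elim (fun _ => Ad_invariant_of_connected γ hM.invariant) id
  refine ⟨exists_isLocalFactorization hjp hjm hM.isCompl,
    exists_isLocalFactorization hjm hjp hM.isCompl.symm, fun Φ Ψ hΦ hΨ => ?_⟩
  have cΦl := contMDiffAt_leftFactor hΦ hjp hΦ.one_mem_target
  have cΦr := contMDiffAt_rightFactor hΦ hjm hΦ.one_mem_target
  have cΨl := contMDiffAt_leftFactor hΨ hjm hΨ.one_mem_target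
  have cΨr := contMDiffAt_rightFactor hΨ hjp hΨ.one_mem_target
  obtain ⟨dΦl, dΦr⟩ := hasD_factors hΦ hjp hjm hM.isCompl
  obtain ⟨dΨl, dΨr⟩ := hasD_factors hΨ hjm hjp hM.isCompl.symm
  have oΦl := hΦ.leftFactor_one
  have oΦr := hΦ.rightFactor_one
  have oΨl := hΨ.leftFactor_one
  have oΨr := hΨ.rightFactor_one
  have g₁ : ∀ (B : GroupLieAlgebra 𝓘(ℝ, E) G) (a : G),
      gen (lamPlus jp Ψ) B a = -rightTr a (hM.prPlus (Ad a B)) := gen_leftMove dΨr oΨr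
  have g₂ : ∀ (B : GroupLieAlgebra 𝓘(ℝ, E) G) (a : G),
      gen (lamMinus jm Φ) B a = -rightTr a (hM.prMinus (Ad a B)) := gen_leftMove dΦr oΦr
  have g₃ : ∀ (B : GroupLieAlgebra 𝓘(ℝ, E) G) (a : G),
      gen (rhoPlus jp Φ) B a = -leftTr a (hM.prPlus (Ad a⁻¹ B)) := gen_rightMove dΦl oΦl
  have g₄ : ∀ (B : GroupLieAlgebra 𝓘(ℝ, E) G) (a : G),
      gen (rhoMinus jm Ψ) B a = -leftTr a (hM.prMinus (Ad a⁻¹ B)) := gen_rightMove dΨl oΨl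
  refine ⟨⟨fun a => ⟨leftMove_one oΨr a, leftMove_one oΦr a, rightMove_one oΦl a,
      rightMove_one oΨl a, contMDiffAt_leftMove_one cΨr a, contMDiffAt_leftMove_one cΦr a,
      contMDiffAt_rightMove_one cΦl a, contMDiffAt_rightMove_one cΨl a⟩,
      fun B a => ⟨g₁ B a, g₂ B a, g₃ B a, g₄ B a⟩⟩,
    fun B => ⟨smoothField_gen_leftMove dΨr oΨr B, smoothField_gen_leftMove dΦr oΦr B,
      smoothField_gen_rightMove dΦl oΦl B, smoothField_gen_rightMove dΨl oΨl B⟩,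
    fun B B' a => ⟨mlieBracket_gen_leftMove hM.isCompl dΨr oΨr B B' a,
      mlieBracket_gen_leftMove hM.isCompl.symm dΦr oΦr B B' a,
      mlieBracket_gen_rightMove hM.isCompl dΦl oΦl B B' a,
      mlieBracket_gen_rightMove hM.isCompl.symm dΨl oΨl B B' a,
      mlieBracket_gen_leftMove_compl hM.isCompl dΨr oΨr dΦr oΦr B B' a,
      mlieBracket_gen_rightMove_compl hM.isCompl dΦl oΦl dΨl oΨl B B' a⟩,
    fun V a hV => ?_, fun V a hV => ?_, exists_isLocalLeftAction_dressPlus hjp hjm hΦ hΨ,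
    fun ξ η a => ?_, exists_isLocalLeftAction_dressMinus hjp hjm hΦ hΨ, fun ξ η a => ?_⟩
  · obtain ⟨d₁, d₂, d₃, d₄⟩ := dressing_of_mem_plus hM hγ X Y hXY hV a
    rw [g₁, g₂, g₃, g₄, neg_neg]
    exact ⟨d₁, d₂, d₃, d₄⟩
  · obtain ⟨d₁, d₂, d₃, d₄⟩ := dressing_of_mem_minus hM hγ X Y hXY hV a
    rw [g₁, g₂, g₃, g₄, neg_neg, neg_neg, neg_neg]
    exact ⟨d₁, d₂, d₃, d₄⟩
  -- The dressing field is additive in the Lie algebra element, so it splits into its values on `gp`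
  -- and on `gm`. The sign of the `gm` part matches the inverse `u⁻¹` in the action.
  · rw [map_add, leftDressing_add, (dressing_of_mem_plus hM hγ X Y hXY (hjp.lieMap_mem ξ) a).1,
      (dressing_of_mem_minus hM hγ X Y hXY (hjm.lieMap_mem η) a).1]
    exact infGen_leftMove_subgroups hjp hjm dΦr dΨr cΨr oΦr oΨr ξ η a
  · rw [map_add, leftDressing_add, (dressing_of_mem_plus hM hγ X Y hXY (hjp.lieMap_mem ξ) a).2.2.1,
      (dressing_of_mem_minus hM hγ X Y hXY (hjm.lieMap_mem η) a).2.2.1]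
    exact infGen_leftMove_subgroups hjp hjm dΨr dΦr cΦr oΨr oΦr ξ η a
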